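/- All graphs are finite, simple and undirected. A \emph{drawing} of a graph represents its vertices by distinct points of the plane and each edge by a simple curve between its endpoints, such that an edge contains no vertices other than its own endpoints and no three edges meet at a common point other than a common endpoint. A \emph{crossing} is a point of intersection of two edges other than a common endpoint; the \emph{crossing number} $\mathrm{cr}(G)$ is the minimum number of crossings in a drawing of $G$, and a graph is \emph{planar} if it has a drawing without crossings. A \emph{decomposition} of a graph $G$ is a graph $D$ together with a set of vertices of $G$ (a \emph{bag}) for each vertex of $D$, distinct vertices of $D$ being allowed to have equal bags, such that (a) for each $v\in V(G)$, the subgraph $D(v)$ of $D$ induced by the vertices of $D$ whose bags contain $v$ is nonempty and connected, and (b) for each edge $vw$ of $G$, $D(v)$ and $D(w)$ share a vertex or are joined by an edge of $D$. Its \emph{width} is the maximum cardinality of a bag, its \emph{order} is $|V(D)|$, and it is \emph{planar} if $D$ is planar. \textbf{Theorem.} Let $\Delta$ be an integer and let $\mathcal{G}$ be a family of graphs, each with maximum degree at most $\Delta$. The following are equivalent: \begin{enumerate} \item there is a constant $c_1$ such that $\mathrm{cr}(G)\le c_1|V(G)|$ for every $G\in\mathcal{G}$; \item there is a constant $c_2$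 such that every $G\in\mathcal{G}$ has a planar decomposition of width at most $c_2$ and order exactly $|V(G)|$; \item there is a constant $c_3$ such that every $G\in\mathcal{G}$ has a planar decomposition of width at most $2$ and order at most $c_3|V(G)|$. \end{enumerate} -/

import Mathlib

open scoped NNReal ENNReal

namespace SimpleGraph

/-- A drawing of a graph in the plane: vertices are distinct points, each edge is (the image of) a
simple curve between its endpoints, an edge contains no vertices but its endpoints, and three
distinct edges meet only at a common endpoint. -/
structure Drawing {V : Type*} (G : SimpleGraph V) where
  point : V → EuclideanSpace ℝ (Fin 2)
  point_injective : Function.Injective point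
  arc : G.edgeSet → Set (EuclideanSpace ℝ (Fin 2))
  arc_simple : ∀ (v w : V) (h : G.Adj v w), ∃ γ : _root_.Path (point v) (point w),
    Function.Injective γ ∧ Set.range γ = arc ⟨s(v, w), h⟩
  mem_of_point_mem_arc : ∀ (e : G.edgeSet) (v : V), point v ∈ arc e → v ∈ (e : Sym2 V)
  no_three : ∀ e f g : G.edgeSet, e ≠ f → e ≠ g → f ≠ g →
    ∀ p ∈ arc e ∩ arc f ∩ arc g,
      ∃ v : V, p = point v ∧ v ∈ (e : Sym2 V) ∧ v ∈ (f : Sym2 V) ∧ v ∈ (g : Sym2 V)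

/-- The crossings of a drawing: the points common to two distinct edges, other than a common
endpoint. -/
def Drawing.crossings {V : Type*} {G : SimpleGraph V} (φ : G.Drawing) :
    Set (EuclideanSpace ℝ (Fin 2)) :=
  {p | ∃ e f : G.edgeSet, e ≠ f ∧ p ∈ φ.arc e ∧ p ∈ φ.arc f ∧
    ¬ ∃ v : V, p = φ.point v ∧ v ∈ (e : Sym2 V) ∧ v ∈ (f : Sym2 V)}

/-- The crossing number: the minimum number of crossings in a drawing. -/
noncomputable def crossingNumber {V : Type*} (G : SimpleGraph V) : ℕ∞ :=
  ⨅ φ : G.Drawing, φ.crossings.encard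

/-- A graph is planar if it has a drawing without crossings. -/
def IsPlanar {V : Type*} (G : SimpleGraph V) : Prop :=
  ∃ φ : G.Drawing, φ.crossings = ∅

/-- A decomposition of `G`: a finite graph each of whose nodes carries a set of vertices of `G`
(its bag; distinct nodes may carry the same bag), such that the nodes whose bags contain a given
vertex induce a nonempty connected subgraph, and such that for adjacent vertices of `G` these
subgraphs touch. -/
structure Decomposition {V : Type*} (G : SimpleGraph V) where
  Node : Type
  [fintypeNode : Fintype Node]
  graph : SimpleGraph Node
  bag : Node → Finset V
  connected : ∀ v : V, (graph.induce {x | v ∈ bag x}).Connected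
  touch : ∀ v w : V, G.Adj v w →
    ∃ x y : Node, v ∈ bag x ∧ w ∈ bag y ∧ (x = y ∨ graph.Adj x y)

/-- The width: the maximum cardinality of a bag (`0` if there are no bags). -/
def Decomposition.width {V : Type*} {G : SimpleGraph V} (D : G.Decomposition) : ℕ :=
  letI := D.fintypeNode
  Finset.univ.sup fun x => (D.bag x).card

/-- The order: the number of bags, counted with multiplicity. -/
def Decomposition.order {V : Type*} {G : SimpleGraph V} (D : G.Decomposition) : ℕ :=
  letI := D.fintypeNode
  Fintype.card D.Node

/-- A decomposition is planar if its underlying graph is planar. -/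
def Decomposition.Planar {V : Type*} {G : SimpleGraph V} (D : G.Decomposition) : Prop :=
  D.graph.IsPlanar

end SimpleGraph

/-!
Turning the crossings of a drawing into vertices yields a planar graph. It carries a decomposition
of width two: orient the edges, and assign each crossing to the tails of the two edges through it.
This graph has bounded degree, so it can be cut into connected parts of bounded size, few enough
that contracting them leaves at most one node for each vertex of `G`.

Conversely, draw the graph of a planar decomposition with pairwise disjoint disks for its nodes and
polygonal lines for its edges, and route each edge `vw` of `G` through the nodes whose bags contain
`v` or `w`, along parallel copies of the lines. Two edges cross only inside a disk that both of them
enter; at most `k * Δ` edges enter a disk, and each of them has few segments there.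

That contractions preserve planarity is obtained from the same kind of drawing: the edges at the
contracted vertex are rerouted along parallel copies of the contracted line, which do not cross if
they are ordered by the directions in which the edges leave.
-/

/-! ### Arcs and general position -/

section Arc

variable {X : Type*} [TopologicalSpace X] {a b c : X} {S T : Set X}

/-- `S` is a simple arc from `a` to `b`. -/
def IsArc (a b : X) (S : Set X) : Prop :=
  ∃ γ : Path a b, Function.Injective γ ∧ Set.range γ = S

theorem IsArc.symm (h : IsArc a b S) : IsArc b a S := by
  obtain ⟨γ, hγ, rfl⟩ := h
  exact ⟨γ.symm, hγ.comp unitInterval.symm_bijective.injective, γ.symm_range⟩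

theorem IsArc.isCompact (h : IsArc a b S) : IsCompact S := by
  obtain ⟨γ, -, rfl⟩ := h
  exact isCompact_range γ.continuous

theorem IsArc.left_mem (h : IsArc a b S) : a ∈ S := by
  obtain ⟨γ, -, rfl⟩ := h
  exact ⟨0, γ.source⟩

theorem IsArc.trans (hS : IsArc a b S) (hT : IsArc b c T) (hST : S ∩ T ⊆ {b}) :
    IsArc a c (S ∪ T) := by
  obtain ⟨γ, hγ, rfl⟩ := hS
  obtain ⟨δ, hδ, rfl⟩ := hT
  refine ⟨γ.trans δ, ?_, Path.trans_range _ _⟩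
  have ne_of_le_of_lt : ∀ s t : unitInterval, (s : ℝ) ≤ 1 / 2 → ¬ (t : ℝ) ≤ 1 / 2 →
      (γ.trans δ) s ≠ (γ.trans δ) t := by
    intro s t hs ht h
    rw [Path.trans_apply, Path.trans_apply, dif_pos hs, dif_neg ht] at h
    have h1 : δ ⟨2 * t - 1, unitInterval.two_mul_sub_one_mem_iff.2 ⟨(not_le.1 ht).le, t.2.2⟩⟩ = b :=
      hST ⟨h ▸ ⟨_, rfl⟩, ⟨_, rfl⟩⟩
    have h2 := congrArg Subtype.val (hδ (h1.trans δ.source.symm))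
    simp only [Set.Icc.coe_zero] at h2
    linarith
  intro s t hst
  by_cases hs : (s : ℝ) ≤ 1 / 2 <;> by_cases ht : (t : ℝ) ≤ 1 / 2
  · rw [Path.trans_apply, Path.trans_apply, dif_pos hs, dif_pos ht] at hst
    have := congrArg Subtype.val (hγ hst)
    exact Subtype.ext (by simpa using this)
  · exact (ne_of_le_of_lt s t hs ht hst).elim
  · exact (ne_of_le_of_lt t s ht hs hst.symm).elim
  · rw [Path.trans_apply, Path.trans_apply, dif_neg hs, dif_neg ht] at hst
    have := congrArg Subtype.val (hδ hst)
    exact Subtype.ext (by simpa using this)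

end Arc

section Segment

variable {E : Type*} [AddCommGroup E] [Module ℝ E] [TopologicalSpace E] [IsTopologicalAddGroup E]
  [ContinuousSMul ℝ E]

theorem isArc_segment {a b : E} (hab : a ≠ b) : IsArc a b (segment ℝ a b) := by
  refine ⟨⟨⟨fun t => AffineMap.lineMap a b (t : ℝ), ?_⟩, by simp, by simp⟩, ?_, ?_⟩
  · exact AffineMap.lineMap_continuous.comp continuous_subtype_val
  · exact fun s t h => Subtype.ext (AffineMap.lineMap_injective ℝ hab h)
  · rw [segment_eq_image_lineMap, Set.image_eq_range]
    rfl

theorem isOpen_disjoint_segment [T2Space E] :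
    IsOpen {q : E × E × E × E | Disjoint (segment ℝ q.1 q.2.1) (segment ℝ q.2.2.1 q.2.2.2)} := by
  rw [← isClosed_compl_iff]
  have hc : IsClosed {x : (unitInterval × unitInterval) × (E × E × E × E) |
      AffineMap.lineMap x.2.1 x.2.2.1 (x.1.1 : ℝ)
        = (AffineMap.lineMap x.2.2.2.1 x.2.2.2.2 (x.1.2 : ℝ) : E)} := by
    apply isClosed_eq <;> simp only [AffineMap.lineMap_apply_module] <;> fun_prop
  convert isClosedMap_snd_of_compactSpace _ hc using 1
  ext q
  simp only [Set.mem_compl_iff, Set.mem_ofPred_eq, Set.not_disjoint_iff, segment_eq_image_lineMap,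
    Set.mem_image]
  constructor
  · rintro ⟨z, ⟨s, hs, rfl⟩, t, ht, h⟩
    exact ⟨((⟨s, hs⟩, ⟨t, ht⟩), q), h.symm, rfl⟩
  · rintro ⟨⟨⟨s, t⟩, q'⟩, h, rfl⟩
    exact ⟨_, ⟨s, s.2, rfl⟩, t, t.2, h.symm⟩

end Segment

theorem dense_ne_zero_of_analyticOnNhd {E : Type*} [NormedAddCommGroup E] [NormedSpace ℝ E]
    {F : E → ℝ} (hF : AnalyticOnNhd ℝ F Set.univ) {p : E} (hp : F p ≠ 0) :
    Dense {q | F q ≠ 0} := by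
  intro q
  rw [mem_closure_iff_frequently]
  intro hq
  refine hp (hF.eqOn_zero_of_preconnected_of_eventuallyEq_zero isPreconnected_univ
    (Set.mem_univ q) ?_ (Set.mem_univ p))
  filter_upwards [hq] with x hx
  simpa using hx

theorem isOpen_dense_forall_embedding_ne_zero {κ ι E : Type*} [Fintype κ] [Finite ι]
    [NormedAddCommGroup E] [NormedSpace ℝ E] [CompleteSpace E] {F : (κ → E) → ℝ}
    (hF : AnalyticOnNhd ℝ F Set.univ) {p : κ → E} (hp : F p ≠ 0) :
    IsOpen {q : ι → E | ∀ f : κ ↪ ι, F (q ∘ f) ≠ 0} ∧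
      Dense {q : ι → E | ∀ f : κ ↪ ι, F (q ∘ f) ≠ 0} := by
  have := Fintype.ofFinite ι
  have isOpen_ne (f : κ ↪ ι) : IsOpen {q : ι → E | F (q ∘ f) ≠ 0} :=
    isOpen_ne_fun ((continuousOn_univ.1 hF.continuousOn).comp (by fun_prop)) continuous_const
  have dense_ne (f : κ ↪ ι) : Dense {q : ι → E | F (q ∘ f) ≠ 0} := by
    let restrict : (ι → E) →L[ℝ] (κ → E) := .pi fun k => .proj (f k)
    refine dense_ne_zero_of_analyticOnNhd (p := Function.extend f p 0)
      (fun q _ => (hF (restrict q) trivial).comp (restrict.analyticAt q)) ?_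
    rwa [show Function.extend f p 0 ∘ f = p from Function.extend_comp f.injective p 0]
  simp only [Set.ofPred_forall]
  exact ⟨isOpen_iInter_of_finite isOpen_ne, dense_iInter_of_isOpen isOpen_ne dense_ne⟩

/-- The Euclidean plane. -/
abbrev Plane := EuclideanSpace ℝ (Fin 2)

namespace Plane

/-- The determinant of two plane vectors. -/
def det (a b : Plane) : ℝ := a 0 * b 1 - a 1 * b 0

/-- Twice the signed area of the triangle `abc`, which vanishes iff the three points are
collinear. -/
def orient (a b c : Plane) : ℝ := det (b - a) (c - a)

/-- The determinant of the coefficients of the three lines `ab`, `cd` and `ef`, which vanishes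
when the lines are concurrent. The rows are such that the product of the first one with
`(z 0, z 1, 1)` is `orient a b z`. -/
def lineDet (a b c d e f : Plane) : ℝ :=
  !![a 1 - b 1, b 0 - a 0, det a b; c 1 - d 1, d 0 - c 0, det c d;
    e 1 - f 1, f 0 - e 0, det e f].det

@[ext] theorem ext_coord {a b : Plane} (h0 : a 0 = b 0) (h1 : a 1 = b 1) : a = b := by
  ext i
  fin_cases i
  exacts [h0, h1]

theorem exists_coord_of_mem_segment {a b z : Plane} (h : z ∈ segment ℝ a b) :
    ∃ t : ℝ, z 0 = a 0 + t * (b 0 - a 0) ∧ z 1 = a 1 + t * (b 1 - a 1) := by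
  obtain ⟨t, -, rfl⟩ := segment_eq_image' ℝ a b ▸ h
  exact ⟨t, by simp, by simp⟩

theorem orient_eq_zero_of_mem_segment {a b z : Plane} (h : z ∈ segment ℝ a b) :
    orient a b z = 0 := by
  obtain ⟨t, h0, h1⟩ := exists_coord_of_mem_segment h
  simp only [orient, det, PiLp.sub_apply, h0, h1]
  ring

theorem lineDet_eq_zero_of_mem_segment {a b c d e f z : Plane} (hab : z ∈ segment ℝ a b)
    (hcd : z ∈ segment ℝ c d) (hef : z ∈ segment ℝ e f) : lineDet a b c d e f = 0 := by
  refine Matrix.exists_mulVec_eq_zero_iff.1 ⟨![z 0, z 1, 1], fun h => ?_, ?_⟩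
  · exact one_ne_zero (congrFun h 2)
  · have row {x y : Plane} (h : z ∈ segment ℝ x y) :
        (x 1 - y 1) * z 0 + (y 0 - x 0) * z 1 + det x y = 0 := by
      have := orient_eq_zero_of_mem_segment h
      simp only [orient, det, PiLp.sub_apply] at this ⊢
      linear_combination this
    ext i
    fin_cases i <;>
      simp [Matrix.mulVec, dotProduct, Fin.sum_univ_three, row hab, row hcd, row hef]

theorem eq_of_mem_segment_of_mem_segment {a b c z : Plane} (h : orient a b c ≠ 0)
    (hb : z ∈ segment ℝ a b) (hc : z ∈ segment ℝ a c) : z = a := by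
  obtain ⟨s, hs0, hs1⟩ := exists_coord_of_mem_segment hb
  obtain ⟨t, ht0, ht1⟩ := exists_coord_of_mem_segment hc
  have key : s * orient a b c = 0 := by
    simp only [orient, det, PiLp.sub_apply]
    linear_combination (c 1 - a 1) * (ht0 - hs0) - (c 0 - a 0) * (ht1 - hs1)
  obtain rfl : s = 0 := (mul_eq_zero.1 key).resolve_right h
  exact ext_coord (by linarith) (by linarith)

theorem segment_inter_segment_subsingleton {a b c d : Plane} (h : orient a b c ≠ 0) :
    (segment ℝ a b ∩ segment ℝ c d).Subsingleton := by
  rintro z ⟨hz, hz'⟩ w ⟨hw, hw'⟩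
  have orient_add {u : Plane} {t : ℝ} (hu : u ∈ segment ℝ a b) (h0 : u 0 = c 0 + t * (d 0 - c 0))
      (h1 : u 1 = c 1 + t * (d 1 - c 1)) : orient a b c + t * det (b - a) (d - c) = 0 := by
    have := orient_eq_zero_of_mem_segment hu
    simp only [orient, det, PiLp.sub_apply, h0, h1] at this ⊢
    linear_combination this
  obtain ⟨s, hs0, hs1⟩ := exists_coord_of_mem_segment hz'
  obtain ⟨t, ht0, ht1⟩ := exists_coord_of_mem_segment hw'
  have hs := orient_add hz hs0 hs1
  have ht := orient_add hw ht0 ht1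
  have hst : (s - t) * det (b - a) (d - c) = 0 := by linear_combination hs - ht
  obtain rfl : s = t := by
    refine sub_eq_zero.1 ((mul_eq_zero.1 hst).resolve_right fun h0 => h ?_)
    simpa [h0] using hs
  exact ext_coord (hs0.trans ht0.symm) (hs1.trans ht1.symm)

/-- A family of points in general position: the points are distinct, no three of them are
collinear, and no three of the lines through disjoint pairs are concurrent. -/
structure GeneralPosition {ι : Type*} (q : ι → Plane) : Prop where
  injective : Function.Injective q
  orient_ne : ∀ a b c, [a, b, c].Nodup → orient (q a) (q b) (q c) ≠ 0
  lineDet_ne : ∀ a b c d e f, [a, b, c, d, e, f].Nodup →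
    lineDet (q a) (q b) (q c) (q d) (q e) (q f) ≠ 0

@[fun_prop]
theorem analyticAt_coord {κ : Type*} [Fintype κ] (k : κ) (i : Fin 2) (q : κ → Plane) :
    AnalyticAt ℝ (fun q : κ → Plane => q k i) q :=
  ((EuclideanSpace.proj (𝕜 := ℝ) i).comp
    (ContinuousLinearMap.proj (R := ℝ) (φ := fun _ : κ => Plane) k)).analyticAt q

theorem exists_generalPosition {ι : Type*} [Finite ι] {U : Set (ι → Plane)} (hU : IsOpen U)
    (hne : U.Nonempty) : ∃ q ∈ U, GeneralPosition q := by
  obtain ⟨ho₁, hd₁⟩ := isOpen_dense_forall_embedding_ne_zero (ι := ι)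
    (F := fun q : Fin 2 → Plane => (q 0 0 - q 1 0) ^ 2 + (q 0 1 - q 1 1) ^ 2)
    (fun q _ => by fun_prop) (p := ![!₂[0, 0], !₂[1, 0]]) (by simp)
  obtain ⟨ho₂, hd₂⟩ := isOpen_dense_forall_embedding_ne_zero (ι := ι)
    (F := fun q : Fin 3 → Plane => orient (q 0) (q 1) (q 2))
    (fun q _ => by simp only [orient, det, PiLp.sub_apply]; fun_prop)
    (p := ![!₂[0, 0], !₂[1, 0], !₂[0, 1]]) (by simp [orient, det])
  obtain ⟨-, hd₃⟩ := isOpen_dense_forall_embedding_ne_zero (ι := ι)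
    (F := fun q : Fin 6 → Plane => lineDet (q 0) (q 1) (q 2) (q 3) (q 4) (q 5))
    (fun q _ => by
      simp only [lineDet, Matrix.det_fin_three, Matrix.of_apply, Matrix.cons_val, det]
      fun_prop)
    (p := ![!₂[0, 0], !₂[1, 0], !₂[0, 1], !₂[0, 2], !₂[2, 3], !₂[3, 2]])
    (by simp [lineDet, det, Matrix.det_fin_three]; norm_num)
  obtain ⟨q, hqU, ⟨h₁, h₂⟩, h₃⟩ :=
    ((hd₁.inter_of_isOpen_left hd₂ ho₁).inter_of_isOpen_left hd₃ (ho₁.inter ho₂)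
      ).inter_open_nonempty U hU hne
  refine ⟨q, hqU, fun a b hab => ?_, fun a b c h => ?_, fun a b c d e f h => ?_⟩
  · by_contra h
    exact h₁ ⟨[a, b].get, List.nodup_iff_injective_get.1 (by simpa)⟩ (by simp [hab])
  · exact h₂ ⟨[a, b, c].get, List.nodup_iff_injective_get.1 h⟩
  · exact h₃ ⟨[a, b, c, d, e, f].get, List.nodup_iff_injective_get.1 h⟩

section GeneralPosition

variable {W : Type*} {pos : W → Plane} {s t r : Sym2 W} {w : W} {z z' : Plane}

/-- The segment spanned by an unordered pair of indices of points. -/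
def seg (pos : W → Plane) (s : Sym2 W) : Set Plane :=
  Sym2.lift ⟨fun a b => segment ℝ (pos a) (pos b), fun _ _ => segment_symm ℝ _ _⟩ s

@[simp] theorem seg_mk (pos : W → Plane) (a b : W) :
    seg pos s(a, b) = segment ℝ (pos a) (pos b) := rfl

theorem eventually_disjoint_seg {pos : W → Plane} (h : Disjoint (seg pos s) (seg pos t)) :
    ∀ᶠ pos' in nhds pos, Disjoint (seg pos' s) (seg pos' t) := by
  induction s with | _ a b
  induction t with | _ c d
  have : Continuous fun pos' : W → Plane => (pos' a, pos' b, pos' c, pos' d) := by fun_prop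
  exact (isOpen_disjoint_segment.preimage this).mem_nhds h

namespace GeneralPosition

theorem eq_of_mem_seg_of_mem_seg (hg : GeneralPosition pos) (hs : ¬ s.IsDiag) (ht : ¬ t.IsDiag)
    (hst : s ≠ t) (hws : w ∈ s) (hwt : w ∈ t) (hzs : z ∈ seg pos s) (hzt : z ∈ seg pos t) :
    z = pos w := by
  obtain ⟨a, rfl⟩ := hws
  obtain ⟨b, rfl⟩ := hwt
  refine eq_of_mem_segment_of_mem_segment (hg.orient_ne w a b ?_) hzs hzt
  simp_all

theorem mem_of_pos_mem_seg (hg : GeneralPosition pos) (hs : ¬ s.IsDiag) (h : pos w ∈ seg pos s) :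
    w ∈ s := by
  induction s with | _ a b
  by_contra hw
  refine hg.orient_ne a b w ?_ (orient_eq_zero_of_mem_segment h)
  simp_all [eq_comm]

theorem eq_of_mem_seg (hg : GeneralPosition pos) (hs : ¬ s.IsDiag) (hst : ∀ w ∈ s, w ∉ t)
    (h₁ : z ∈ seg pos s) (h₂ : z ∈ seg pos t) (h₁' : z' ∈ seg pos s) (h₂' : z' ∈ seg pos t) :
    z = z' := by
  induction s with | _ a b
  induction t with | _ c d
  refine segment_inter_segment_subsingleton (hg.orient_ne a b c ?_) ⟨h₁, h₂⟩ ⟨h₁', h₂'⟩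
  simp_all

theorem not_concurrent (hg : GeneralPosition pos) (hs : ¬ s.IsDiag) (ht : ¬ t.IsDiag)
    (hr : ¬ r.IsDiag) (hst : ∀ w ∈ s, w ∉ t) (hsr : ∀ w ∈ s, w ∉ r) (htr : ∀ w ∈ t, w ∉ r)
    (h₁ : z ∈ seg pos s) (h₂ : z ∈ seg pos t) (h₃ : z ∈ seg pos r) : False := by
  induction s with | _ a b
  induction t with | _ c d
  induction r with | _ e f
  refine hg.lineDet_ne a b c d e f ?_ (lineDet_eq_zero_of_mem_segment h₁ h₂ h₃)
  simp_all

theorem isArc_walk (hg : GeneralPosition pos) {S : SimpleGraph W} {u v : W} (p : S.Walk u v)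
    (hp : p.IsPath) (huv : u ≠ v)
    (hd : ∀ s ∈ p.edges, ∀ t ∈ p.edges, (∀ w ∈ s, w ∉ t) → Disjoint (seg pos s) (seg pos t)) :
    IsArc (pos u) (pos v) (⋃ s ∈ p.edges, seg pos s) := by
  induction p with
  | nil => exact (huv rfl).elim
  | @cons u x v h p ih =>
    rw [SimpleGraph.Walk.cons_isPath_iff] at hp
    have hux : pos u ≠ pos x := fun e => h.ne (hg.injective e)
    by_cases hxv : x = v
    · subst hxv
      rw [SimpleGraph.Walk.isPath_iff_nil] at hp
      rw [hp.1.eq_nil]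
      simpa using isArc_segment hux
    have tail := ih hp.1 hxv fun s hs t ht => hd s (by simp [hs]) t (by simp [ht])
    have inter : segment ℝ (pos u) (pos x) ∩ (⋃ s ∈ p.edges, seg pos s) ⊆ {pos x} := by
      rintro z ⟨hz, hz'⟩
      obtain ⟨t, ht, hzt⟩ := Set.mem_iUnion₂.1 hz'
      have hut : u ∉ t := fun hut => hp.2 (p.mem_support_of_mem_edges ht hut)
      have htd : ¬ t.IsDiag := S.not_isDiag_of_mem_edgeSet (p.edges_subset_edgeSet ht)
      by_cases hxt : x ∈ t
      · refine hg.eq_of_mem_seg_of_mem_seg (s := s(u, x)) (by simpa using h.ne) htd ?_ (by simp)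
          hxt hz hzt
        rintro rfl
        exact hut (by simp)
      · refine (Set.disjoint_left.1 (hd s(u, x) (by simp) t (by simp [ht]) ?_) hz hzt).elim
        intro w hw
        rcases Sym2.mem_iff.1 hw with rfl | rfl <;> assumption
    simpa only [SimpleGraph.Walk.edges_cons, List.mem_cons, Set.iUnion_iUnion_eq_or_left,
      seg_mk] using (isArc_segment hux).trans tail inter

end GeneralPosition

end GeneralPosition

end Plane

/-! ### Routings -/

/-- A combinatorial routing of the edges of `G` along paths through points indexed by `W`, which
becomes a drawing once the points are placed in the plane and the steps of the paths are drawn as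
segments. Each edge has its own host graph `host g`, so that it can be kept inside the part of the
plane reserved for it. -/
structure Routing {V : Type*} (G : SimpleGraph V) (W : Type*) where
  point : V ↪ W
  host : G.edgeSet → SimpleGraph W
  tail : G.edgeSet → V
  head : G.edgeSet → V
  edge_eq : ∀ g : G.edgeSet, (g : Sym2 V) = s(tail g, head g)
  walk : ∀ g, (host g).Walk (point (tail g)) (point (head g))
  isPath : ∀ g, (walk g).IsPath
  mem_of_point_mem : ∀ g v, point v ∈ (walk g).support → v ∈ (g : Sym2 V)
  exists_point_eq : ∀ g h, g ≠ h → ∀ w ∈ (walk g).support, w ∈ (walk h).support →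
    ∃ v, point v = w

namespace Routing

open Plane

variable {V W : Type*} {G : SimpleGraph V} (R : Routing G W) (pos : W → Plane)

/-- The route of an edge avoids itself once the points are placed by `pos`. -/
def SelfAvoiding : Prop :=
  ∀ g, ∀ s ∈ (R.walk g).edges, ∀ t ∈ (R.walk g).edges, (∀ w ∈ s, w ∉ t) →
    Disjoint (seg pos s) (seg pos t)

/-- The pairs of segments, from routes of different edges and without a common end point, that
meet once the points are placed by `pos`. -/
def meetings : Set (Sym2 W × Sym2 W) :=
  {q | ∃ g h, g ≠ h ∧ q.1 ∈ (R.walk g).edges ∧ q.2 ∈ (R.walk h).edges ∧ (∀ w ∈ q.1, w ∉ q.2) ∧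
    ¬ Disjoint (seg pos q.1) (seg pos q.2)}

/-- The polygonal line drawn for an edge. -/
def arc (g : G.edgeSet) : Set Plane := ⋃ s ∈ (R.walk g).edges, seg pos s

variable {R pos} {g h : G.edgeSet} {s t : Sym2 W} {w : W} {z : Plane}

theorem mem_arc : z ∈ R.arc pos g ↔ ∃ s ∈ (R.walk g).edges, z ∈ seg pos s := by
  simp [arc]

theorem not_isDiag (hs : s ∈ (R.walk g).edges) : ¬ s.IsDiag :=
  (R.host g).not_isDiag_of_mem_edgeSet ((R.walk g).edges_subset_edgeSet hs)

theorem tail_ne_head (g : G.edgeSet) : R.tail g ≠ R.head g := by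
  simpa [R.edge_eq] using G.not_isDiag_of_mem_edgeSet g.2

theorem SelfAvoiding.isArc_arc (hR : R.SelfAvoiding pos) (hpos : GeneralPosition pos)
    (g : G.edgeSet) : IsArc (pos (R.point (R.tail g))) (pos (R.point (R.head g))) (R.arc pos g) :=
  hpos.isArc_walk (R.walk g) (R.isPath g) (R.point.injective.ne (tail_ne_head g)) (hR g)

theorem mem_of_pos_mem_arc (hpos : GeneralPosition pos) {v : V}
    (h : pos (R.point v) ∈ R.arc pos g) : v ∈ (g : Sym2 V) := by
  obtain ⟨s, hs, h⟩ := mem_arc.1 h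
  exact R.mem_of_point_mem g v
    ((R.walk g).mem_support_of_mem_edges hs (hpos.mem_of_pos_mem_seg (not_isDiag hs) h))

/-- Both ends of a common step would be vertices, and these would belong to both edges. -/
theorem ne_of_mem_edges (hgh : g ≠ h) (hs : s ∈ (R.walk g).edges) (ht : t ∈ (R.walk h).edges) :
    s ≠ t := by
  rintro rfl
  have exists_vertex (w : W) (hw : w ∈ s) :
      ∃ v, R.point v = w ∧ v ∈ (g : Sym2 V) ∧ v ∈ (h : Sym2 V) := by
    have hwg := (R.walk g).mem_support_of_mem_edges hs hw
    have hwh := (R.walk h).mem_support_of_mem_edges ht hw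
    obtain ⟨v, rfl⟩ := R.exists_point_eq g h hgh w hwg hwh
    exact ⟨v, rfl, R.mem_of_point_mem g v hwg, R.mem_of_point_mem h v hwh⟩
  induction s with | _ x y
  obtain ⟨v, rfl, hvg, hvh⟩ := exists_vertex x (by simp)
  obtain ⟨v', rfl, hvg', hvh'⟩ := exists_vertex y (by simp)
  have hvv : v ≠ v' := by
    rintro rfl
    exact not_isDiag hs rfl
  exact hgh (Subtype.ext (((Sym2.mem_and_mem_iff hvv).1 ⟨hvg, hvg'⟩).trans
    ((Sym2.mem_and_mem_iff hvv).1 ⟨hvh, hvh'⟩).symm))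

theorem exists_common_vertex (hpos : GeneralPosition pos) (hgh : g ≠ h)
    (hs : s ∈ (R.walk g).edges) (ht : t ∈ (R.walk h).edges) (hst : ∃ w ∈ s, w ∈ t)
    (hzs : z ∈ seg pos s) (hzt : z ∈ seg pos t) :
    ∃ v, z = pos (R.point v) ∧ v ∈ (g : Sym2 V) ∧ v ∈ (h : Sym2 V) := by
  obtain ⟨w, hws, hwt⟩ := hst
  have hwg := (R.walk g).mem_support_of_mem_edges hs hws
  have hwh := (R.walk h).mem_support_of_mem_edges ht hwt
  obtain ⟨v, rfl⟩ := R.exists_point_eq g h hgh w hwg hwh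
  exact ⟨v, hpos.eq_of_mem_seg_of_mem_seg (not_isDiag hs) (not_isDiag ht)
    (ne_of_mem_edges hgh hs ht) hws hwt hzs hzt, R.mem_of_point_mem g v hwg,
    R.mem_of_point_mem h v hwh⟩

theorem no_three (hpos : GeneralPosition pos) {e f g : G.edgeSet} (hef : e ≠ f) (heg : e ≠ g)
    (hfg : f ≠ g) (he : z ∈ R.arc pos e) (hf : z ∈ R.arc pos f) (hg : z ∈ R.arc pos g) :
    ∃ v, z = pos (R.point v) ∧ v ∈ (e : Sym2 V) ∧ v ∈ (f : Sym2 V) ∧ v ∈ (g : Sym2 V) := by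
  obtain ⟨s, hs, hzs⟩ := mem_arc.1 he
  obtain ⟨t, ht, hzt⟩ := mem_arc.1 hf
  obtain ⟨r, hr, hzr⟩ := mem_arc.1 hg
  by_cases hst : ∃ w ∈ s, w ∈ t
  · obtain ⟨v, rfl, hve, hvf⟩ := exists_common_vertex hpos hef hs ht hst hzs hzt
    exact ⟨v, rfl, hve, hvf, mem_of_pos_mem_arc hpos hg⟩
  by_cases hsr : ∃ w ∈ s, w ∈ r
  · obtain ⟨v, rfl, hve, hvg⟩ := exists_common_vertex hpos heg hs hr hsr hzs hzr
    exact ⟨v, rfl, hve, mem_of_pos_mem_arc hpos hf, hvg⟩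
  by_cases htr : ∃ w ∈ t, w ∈ r
  · obtain ⟨v, rfl, hvf, hvg⟩ := exists_common_vertex hpos hfg ht hr htr hzt hzr
    exact ⟨v, rfl, mem_of_pos_mem_arc hpos he, hvf, hvg⟩
  push Not at hst hsr htr
  exact (hpos.not_concurrent (not_isDiag hs) (not_isDiag ht) (not_isDiag hr) hst hsr htr hzs hzt
    hzr).elim

variable (R) in
/-- The drawing of `G` given by a routing and a placement of its points. -/
def drawing (hpos : GeneralPosition pos) (hR : R.SelfAvoiding pos) : G.Drawing where
  point v := pos (R.point v)
  point_injective := hpos.injective.comp R.point.injective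
  arc := R.arc pos
  arc_simple v w hvw := by
    have arc := hR.isArc_arc hpos ⟨s(v, w), hvw⟩
    have edge : s(v, w) = _ := R.edge_eq ⟨s(v, w), hvw⟩
    rcases Sym2.eq_iff.1 edge with ⟨hv, hw⟩ | ⟨hv, hw⟩
    · rwa [← hv, ← hw] at arc
    · rw [← hv, ← hw] at arc
      exact arc.symm
  mem_of_point_mem_arc _ _ := mem_of_pos_mem_arc hpos
  no_three _ _ _ hef heg hfg _ hp := no_three hpos hef heg hfg hp.1.1 hp.1.2 hp.2

theorem encard_crossings_drawing_le (hpos : GeneralPosition pos) (hR : R.SelfAvoiding pos) :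
    (R.drawing hpos hR).crossings.encard ≤ (R.meetings pos).encard := by
  have exists_meeting : ∀ p ∈ (R.drawing hpos hR).crossings,
      ∃ q ∈ R.meetings pos, p ∈ seg pos q.1 ∩ seg pos q.2 := by
    rintro p ⟨g, h, hgh, hpg, hph, hnot⟩
    obtain ⟨s, hs, hps⟩ := mem_arc.1 hpg
    obtain ⟨t, ht, hpt⟩ := mem_arc.1 hph
    exact ⟨(s, t), ⟨g, h, hgh, hs, ht, fun w hws hwt =>
      hnot (exists_common_vertex hpos hgh hs ht ⟨w, hws, hwt⟩ hps hpt),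
      Set.not_disjoint_iff.2 ⟨p, hps, hpt⟩⟩, hps, hpt⟩
  rcases (R.drawing hpos hR).crossings.eq_empty_or_nonempty with h0 | ⟨p₀, hp₀⟩
  · simp [h0]
  have : Nonempty (Sym2 W × Sym2 W) := ⟨(exists_meeting p₀ hp₀).choose⟩
  choose! f hf hmem using exists_meeting
  refine Set.encard_le_encard_of_injOn hf fun p hp p' hp' hpp => ?_
  obtain ⟨g, h, -, hs, -, hst, -⟩ := hf p hp
  have hp_mem := hmem p' hp'
  rw [← hpp] at hp_mem
  exact hpos.eq_of_mem_seg (not_isDiag hs) hst (hmem p hp).1 (hmem p hp).2 hp_mem.1 hp_mem.2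

/-- Moving the points slightly into general position creates no new meetings. -/
theorem SelfAvoiding.exists_drawing [Finite W] (hR : R.SelfAvoiding pos) :
    ∃ φ : G.Drawing, φ.crossings.encard ≤ (R.meetings pos).encard := by
  have near : ∀ᶠ pos' in nhds pos, ∀ s t, Disjoint (seg pos s) (seg pos t) →
      Disjoint (seg pos' s) (seg pos' t) := by
    simp only [Filter.eventually_all]
    exact fun s t h => eventually_disjoint_seg h
  obtain ⟨U, hU, hUo, hmem⟩ := eventually_nhds_iff.1 near
  obtain ⟨pos', hpos', hg⟩ := exists_generalPosition hUo ⟨pos, hmem⟩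
  have disj := hU pos' hpos'
  refine ⟨R.drawing hg fun g s hs t ht hst => disj s t (hR g s hs t ht hst),
    (encard_crossings_drawing_le _ _).trans (Set.encard_le_encard ?_)⟩
  rintro q ⟨g, h, hgh, hs, ht, hst, hq⟩
  exact ⟨g, h, hgh, hs, ht, hst, fun h => hq (disj _ _ h)⟩

end Routing

theorem length_filter_mem_edges_le_two {V : Type*} [DecidableEq V] {G : SimpleGraph V} {u v : V}
    {p : G.Walk u v} (hp : p.IsPath) (w : V) : (p.edges.filter (w ∈ ·)).length ≤ 2 := by
  have eq_zero (u v : V) (p : G.Walk u v) (hw : w ∉ p.support) :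
      (p.edges.filter (w ∈ ·)).length = 0 := by
    simpa using fun e he hwe => hw (p.mem_support_of_mem_edges he hwe)
  suffices (p.edges.filter (w ∈ ·)).length ≤ if w = u then 1 else 2 by
    split_ifs at this <;> omega
  induction p with
  | nil => simp
  | @cons u x v h p ih =>
    rw [SimpleGraph.Walk.cons_isPath_iff] at hp
    specialize ih hp.1
    rw [SimpleGraph.Walk.edges_cons, List.filter_cons]
    by_cases hwu : w = u
    · subst hwu
      simp [eq_zero x v p hp.2]
    by_cases hwx : w = x
    · simp_all
    · simp_all

/-! ### Polygonal drawings -/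

namespace Plane

theorem inner_eq (a b : Plane) : inner ℝ a b = a 0 * b 0 + a 1 * b 1 := by
  simp [PiLp.inner_apply, mul_comm]

theorem orient_eq_det (a b c : Plane) : orient a b c = det (b - a) (c - b) := by
  simp only [orient, det, PiLp.sub_apply]
  ring

theorem exists_eq_smul_of_det_eq_zero {d w : Plane} (hd : d ≠ 0) (h : det d w = 0) :
    w = (inner ℝ w d / inner ℝ d d) • d := by
  have hdd : d 0 * d 0 + d 1 * d 1 ≠ 0 := by
    rw [← inner_eq]
    exact inner_self_ne_zero.2 hd
  simp only [det] at h
  simp only [inner_eq]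
  apply ext_coord <;> rw [PiLp.smul_apply, smul_eq_mul, div_mul_eq_mul_div, eq_div_iff hdd]
  · linear_combination -(d 1) * h
  · linear_combination d 0 * h

theorem exists_lineMap_of_orient_eq_zero {a b c : Plane} (h : orient a b c = 0) :
    ∃ d : Plane, ∃ s t : ℝ, b = AffineMap.lineMap a d s ∧ c = AffineMap.lineMap a d t := by
  rcases eq_or_ne b a with rfl | hab
  · exact ⟨c, 0, 1, by simp, by simp⟩
  · refine ⟨b, 1, inner ℝ (c - a) (b - a) / inner ℝ (b - a) (b - a), by simp, ?_⟩
    rw [AffineMap.lineMap_apply, vsub_eq_sub, ← exists_eq_smul_of_det_eq_zero (sub_ne_zero.2 hab) h]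
    simp

theorem segment_subset_union_of_orient_eq_zero {a b c : Plane} (h : orient a b c = 0) :
    segment ℝ a c ⊆ segment ℝ a b ∪ segment ℝ b c := by
  obtain ⟨d, s, t, hb, hc⟩ := exists_lineMap_of_orient_eq_zero h
  have ha : a = AffineMap.lineMap a d (0 : ℝ) := by simp
  rw [hb, hc]
  nth_rw 1 3 [ha]
  simp only [← image_segment, segment_eq_uIcc, ← Set.image_union]
  exact Set.image_mono Set.uIcc_subset_uIcc_union_uIcc

/-- The graph on the points of the plane in which two points are adjacent if the segment between
them lies in `S`. Its walks are the polygonal lines in `S`. -/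
def visibilityGraph (S : Set Plane) : SimpleGraph Plane where
  Adj a b := a ≠ b ∧ segment ℝ a b ⊆ S
  symm := ⟨fun a b h => ⟨h.1.symm, segment_symm ℝ a b ▸ h.2⟩⟩
  loopless := ⟨fun _ h => h.1 rfl⟩

section Visibility

variable {S T M : Set Plane} {a b c : Plane}

theorem visibilityGraph_mono (h : S ⊆ T) : visibilityGraph S ≤ visibilityGraph T :=
  fun _ _ hab => ⟨hab.1, hab.2.trans h⟩

theorem edist_visibilityGraph_le_one (h : segment ℝ a b ⊆ S) :
    (visibilityGraph S).edist a b ≤ 1 := by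
  rw [SimpleGraph.edist_le_one_iff_adj_or_eq]
  by_cases hab : a = b
  · exact .inr hab
  · exact .inl ⟨hab, h⟩

theorem reachable_visibilityGraph (h : segment ℝ a b ⊆ S) : (visibilityGraph S).Reachable a b :=
  SimpleGraph.reachable_of_edist_ne_top
    ((edist_visibilityGraph_le_one h).trans_lt ENat.one_lt_top).ne

theorem reachable_visibilityGraph_thickening (hM : IsPreconnected M) {δ : ℝ} (hδ : 0 < δ)
    (ha : a ∈ M) (hb : b ∈ M) : (visibilityGraph (Metric.thickening δ M)).Reachable a b := by
  refine hM.induction₂ _ (fun x hx => ?_) (fun _ _ _ _ _ _ => .trans) (fun _ _ _ _ => .symm) ha hb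
  filter_upwards [mem_nhdsWithin_of_mem_nhds (Metric.ball_mem_nhds x hδ)] with y hy
  exact reachable_visibilityGraph
    (((convex_ball x δ).segment_subset (Metric.mem_ball_self hδ) hy).trans
      (Metric.ball_subset_thickening hx δ))

end Visibility

/-- A simple polygonal line with vertices `p 0, …, p len` that turns at each inner vertex. -/
structure PolyLine where
  len : ℕ
  len_pos : 0 < len
  p : ℕ → Plane
  ne_succ : ∀ i < len, p i ≠ p (i + 1)
  turn : ∀ i, i + 1 < len → orient (p i) (p (i + 1)) (p (i + 2)) ≠ 0
  disjoint : ∀ i j, i + 1 < j → j < len →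
    Disjoint (segment ℝ (p i) (p (i + 1))) (segment ℝ (p j) (p (j + 1)))

/-- The set of points on a polygonal line. -/
def PolyLine.carrier (L : PolyLine) : Set Plane :=
  ⋃ i < L.len, segment ℝ (L.p i) (L.p (i + 1))

theorem PolyLine.segment_subset_carrier (L : PolyLine) {i : ℕ} (hi : i < L.len) :
    segment ℝ (L.p i) (L.p (i + 1)) ⊆ L.carrier :=
  Set.subset_biUnion_of_mem (u := fun i => segment ℝ (L.p i) (L.p (i + 1))) hi

theorem edist_getVert_of_length_eq {V : Type*} {G : SimpleGraph V} {a b : V} {w : G.Walk a b}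
    (hw : w.length = G.edist a b) {i j : ℕ} (hij : i ≤ j) (hj : j ≤ w.length) :
    (j - i : ℕ) ≤ G.edist (w.getVert i) (w.getVert j) := by
  have hi : G.edist a (w.getVert i) ≤ i :=
    (SimpleGraph.edist_le (w.take i)).trans (by simp [SimpleGraph.Walk.take_length])
  have hj' : G.edist (w.getVert j) b ≤ (w.length - j : ℕ) :=
    (SimpleGraph.edist_le (w.drop j)).trans (by simp [SimpleGraph.Walk.drop_length])
  have tri := (SimpleGraph.edist_triangle (G := G) (v := w.getVert i)).trans
    (add_le_add_right (SimpleGraph.edist_triangle (v := w.getVert j)) _) |>.trans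
    (add_le_add hi (add_le_add_right hj' _))
  rw [← hw] at tri
  cases h : G.edist (w.getVert i) (w.getVert j) with
  | top => exact le_top
  | coe d =>
    rw [h] at tri
    norm_cast at tri ⊢
    omega

theorem exists_polyLine {S : Set Plane} {a b : Plane} (hab : a ≠ b)
    (h : (visibilityGraph S).Reachable a b) :
    ∃ L : PolyLine, L.p 0 = a ∧ L.p L.len = b ∧ L.carrier ⊆ S := by
  obtain ⟨w, hw⟩ := h.exists_walk_length_eq_edist
  have geodesic {i j : ℕ} (hij : i ≤ j) (hj : j ≤ w.length) :=
    edist_getVert_of_length_eq hw hij hj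
  have adj (i : ℕ) (hi : i < w.length) := w.adj_getVert_succ hi
  refine ⟨⟨w.length, ?_, w.getVert, fun i hi => (adj i hi).1, fun i hi h0 => ?_, ?_⟩,
    w.getVert_zero, w.getVert_length, ?_⟩
  · exact Nat.pos_of_ne_zero fun h0 => hab (SimpleGraph.Walk.eq_of_length_eq_zero h0)
  · have short := (geodesic (show i ≤ i + 2 by omega) hi).trans
      (edist_visibilityGraph_le_one ((segment_subset_union_of_orient_eq_zero h0).trans
        (Set.union_subset (adj i (by omega)).2 (adj (i + 1) hi).2)))
    norm_cast at short
    omega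
  · intro i j hij hj
    rw [Set.disjoint_left]
    intro z hzi hzj
    have first : (visibilityGraph S).edist (w.getVert i) z ≤ 1 := edist_visibilityGraph_le_one
      (((convex_segment _ _).segment_subset (left_mem_segment ℝ _ _) hzi).trans
        (adj i (by omega)).2)
    have last : (visibilityGraph S).edist z (w.getVert (j + 1)) ≤ 1 :=
      edist_visibilityGraph_le_one
        (((convex_segment _ _).segment_subset hzj (right_mem_segment ℝ _ _)).trans (adj j hj).2)
    have short := (geodesic (show i ≤ j + 1 by omega) hj).trans
      ((SimpleGraph.edist_triangle).trans (add_le_add first last))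
    norm_cast at short
    omega
  · exact Set.iUnion₂_subset fun i hi => (adj i hi).2

end Plane

theorem exists_last_eq {f : ℝ → ℝ} (hf : Continuous f) {a b r : ℝ} (hab : a ≤ b) (ha : f a ≤ r)
    (hb : r ≤ f b) : ∃ s ∈ Set.Icc a b, f s = r ∧ ∀ t ∈ Set.Icc s b, r ≤ f t := by
  have compact : IsCompact (Set.Icc a b ∩ {t | f t = r}) :=
    isCompact_Icc.inter_right (isClosed_eq hf continuous_const)
  obtain ⟨t₀, ht₀, h₀⟩ := intermediate_value_Icc hab hf.continuousOn ⟨ha, hb⟩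
  obtain ⟨s, ⟨hs, hsr⟩, greatest⟩ := compact.exists_isGreatest ⟨t₀, ht₀, h₀⟩
  refine ⟨s, hs, hsr, fun t ht => le_of_not_gt fun hlt => ?_⟩
  obtain ⟨u, hu, hur⟩ := intermediate_value_Icc ht.2 hf.continuousOn ⟨hlt.le, hb⟩
  have hus : u ≤ s := greatest ⟨⟨hs.1.trans (ht.1.trans hu.1), hu.2⟩, hur⟩
  have hts : t = s := le_antisymm (hu.1.trans hus) ht.1
  exact hlt.ne (hts ▸ hsr)

theorem exists_first_eq {f : ℝ → ℝ} (hf : Continuous f) {a b r : ℝ} (hab : a ≤ b) (ha : r ≤ f a)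
    (hb : f b ≤ r) : ∃ s ∈ Set.Icc a b, f s = r ∧ ∀ t ∈ Set.Icc a s, r ≤ f t := by
  obtain ⟨s, hs, hsr, h⟩ := exists_last_eq (f := fun t => f (-t)) (by fun_prop)
    (neg_le_neg hab) (by simpa using hb) (by simpa using ha)
  refine ⟨-s, ⟨le_neg.1 hs.2, neg_le.1 hs.1⟩, hsr, fun t ht => ?_⟩
  simpa using h (-t) ⟨le_neg.1 ht.2, neg_le_neg ht.1⟩

namespace Plane

/-- A connected compact set outside the open disks of radius `r` around `c` and `c'` that touches
the boundary of the first disk at `a` and that of the second one at `b`. An arc from `c` to `c'`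
contains such a set. -/
structure ArcCore (c c' : Plane) (r : ℝ) where
  M : Set Plane
  isCompact : IsCompact M
  isPreconnected : IsPreconnected M
  pos : 0 < r
  lt_dist : 2 * r < dist c c'
  a : Plane
  a_mem : a ∈ M
  dist_a : dist a c = r
  le_dist_left : ∀ z ∈ M, r ≤ dist z c
  b : Plane
  b_mem : b ∈ M
  dist_b : dist b c' = r
  le_dist_right : ∀ z ∈ M, r ≤ dist z c'

theorem _root_.IsArc.exists_core {c c' : Plane} {A : Set Plane} (hA : IsArc c c' A) {r : ℝ}
    (hr : 0 < r) (hcc : 2 * r < dist c c') : ∃ K : ArcCore c c' r, K.M ⊆ A := by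
  obtain ⟨γ, -, rfl⟩ := hA
  have hγ : Continuous γ.extend := γ.continuous_extend
  obtain ⟨s, hs, hsr, after⟩ := exists_last_eq (f := fun t => dist (γ.extend t) c) (r := r)
    (by fun_prop) zero_le_one (by simpa using hr.le)
    (by simp only [γ.extend_one, dist_comm c' c]; linarith)
  have leaves : r ≤ dist (γ.extend s) c' := by
    have := dist_triangle_left c c' (γ.extend s)
    linarith
  obtain ⟨t, ht, htr, before⟩ := exists_first_eq (f := fun t => dist (γ.extend t) c') (r := r)
    (by fun_prop) hs.2 leaves (by simpa using hr.le)
  refine ⟨⟨γ.extend '' Set.Icc s t, isCompact_Icc.image hγ,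
    isPreconnected_Icc.image _ hγ.continuousOn, hr, hcc,
    _, ⟨s, ⟨le_rfl, ht.1⟩, rfl⟩, hsr, ?_, _, ⟨t, ⟨ht.1, le_rfl⟩, rfl⟩, htr, ?_⟩, ?_⟩
  · rintro _ ⟨u, hu, rfl⟩
    exact after u ⟨hu.1, hu.2.trans ht.2⟩
  · rintro _ ⟨u, hu, rfl⟩
    exact before u hu
  · rw [← γ.extend_range]
    exact Set.image_subset_range _ _

theorem lt_dist_of_mem_thickening {M : Set Plane} {x z : Plane} {r δ : ℝ}
    (h : ∀ m ∈ M, r ≤ dist m x) (hz : z ∈ Metric.thickening δ M) : r - δ < dist z x := by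
  obtain ⟨m, hm, hzm⟩ := Metric.mem_thickening_iff.1 hz
  have := dist_triangle_left m x z
  linarith [h m hm]

namespace ArcCore

variable {c c' : Plane} {r : ℝ} (K : ArcCore c c' r) {δ : ℝ} {x z : Plane}

/-- The same core with its two ends exchanged. -/
noncomputable def swap : ArcCore c' c r :=
  ⟨K.M, K.isCompact, K.isPreconnected, K.pos, dist_comm c c' ▸ K.lt_dist, K.b, K.b_mem, K.dist_b,
    K.le_dist_right, K.a, K.a_mem, K.dist_a, K.le_dist_left⟩

/-- The piece of the ray from `c` through the contact point `a` at distance `r - 2 * δ` to `r`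
from `c`. -/
def spike (δ : ℝ) : Set Plane :=
  AffineMap.lineMap c K.a '' Set.Icc (1 - 2 * δ / r) 1

/-- The end near `c` of the spike at `c`. -/
noncomputable def start (δ : ℝ) : Plane :=
  AffineMap.lineMap c K.a (1 - 2 * δ / r)

/-- A neighbourhood of the core with a straight spike towards `c` and one towards `c'`. -/
def tube (δ : ℝ) : Set Plane :=
  Metric.thickening δ K.M ∪ (K.spike δ ∪ K.swap.spike δ)

theorem tube_swap : K.swap.tube δ = K.tube δ := by
  rw [tube, tube, Set.union_comm (K.swap.spike δ)]
  rfl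

theorem dist_lineMap {t : ℝ} (ht : 0 ≤ t) : dist (AffineMap.lineMap c K.a t) c = t * r := by
  rw [dist_lineMap_left, dist_comm, K.dist_a, Real.norm_of_nonneg ht]

theorem one_sub_div_pos (hpos : 0 < r) (hr : 4 * δ < r) : 0 < 1 - 2 * δ / r := by
  rw [sub_pos, div_lt_one hpos]
  linarith

theorem dist_start (hr : 4 * δ < r) : dist (K.start δ) c = r - 2 * δ := by
  have := K.pos
  rw [start, K.dist_lineMap (one_sub_div_pos K.pos hr).le]
  field_simp

theorem dist_le_of_mem_spike (hr : 4 * δ < r) (hz : z ∈ K.spike δ) : dist z c ≤ r := by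
  obtain ⟨t, ht, rfl⟩ := hz
  rw [K.dist_lineMap ((one_sub_div_pos K.pos hr).le.trans ht.1)]
  exact mul_le_of_le_one_left K.pos.le ht.2

theorem spike_subset_thickening (hδ : 0 < δ) : K.spike δ ⊆ Metric.thickening (3 * δ) K.M := by
  have := K.pos
  rintro _ ⟨t, ht, rfl⟩
  refine Metric.mem_thickening_iff.2 ⟨K.a, K.a_mem, ?_⟩
  rw [dist_lineMap_right, dist_comm, K.dist_a, Real.norm_of_nonneg (sub_nonneg.2 ht.2)]
  calc (1 - t) * r ≤ 2 * δ / r * r := by gcongr; linarith [ht.1]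
    _ = 2 * δ := by field_simp
    _ < 3 * δ := by linarith

theorem tube_subset_thickening (hδ : 0 < δ) : K.tube δ ⊆ Metric.thickening (3 * δ) K.M :=
  Set.union_subset (Metric.thickening_mono (by linarith) _)
    (Set.union_subset (K.spike_subset_thickening hδ) (K.swap.spike_subset_thickening hδ))

theorem lt_dist_of_mem_spike (hr : 4 * δ < r) (hx : 2 * r < dist c x) (hz : z ∈ K.spike δ) :
    r < dist z x := by
  have := dist_triangle_left c x z
  linarith [K.dist_le_of_mem_spike hr hz]

theorem lt_dist_of_mem_tube (hδ : 0 < δ) (hr : 4 * δ < r) (hc : 2 * r < dist c x)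
    (hc' : 2 * r < dist c' x) (hM : ∀ m ∈ K.M, r ≤ dist m x) (hz : z ∈ K.tube δ) :
    r - 2 * δ < dist z x := by
  rcases hz with hz | hz | hz
  · linarith [lt_dist_of_mem_thickening hM hz]
  · linarith [K.lt_dist_of_mem_spike hr hc hz]
  · linarith [K.swap.lt_dist_of_mem_spike hr hc' hz]

theorem mem_spike_of_mem_tube (hδ : 0 < δ) (hr : 4 * δ < r) (hz : z ∈ K.tube δ)
    (hd : dist z c ≤ r - δ) : z ∈ K.spike δ := by
  rcases hz with hz | hz | hz
  · exact absurd (lt_dist_of_mem_thickening K.le_dist_left hz) (not_lt.2 hd)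
  · exact hz
  · linarith [K.swap.lt_dist_of_mem_spike hr K.swap.lt_dist hz]

theorem eq_start_of_mem_tube (hδ : 0 < δ) (hr : 4 * δ < r) (hz : z ∈ K.tube δ)
    (hd : dist z c ≤ r - 2 * δ) : z = K.start δ := by
  obtain ⟨t, ht, rfl⟩ := K.mem_spike_of_mem_tube hδ hr hz (by linarith)
  rw [← K.dist_start hr, start, K.dist_lineMap (one_sub_div_pos K.pos hr).le,
    K.dist_lineMap ((one_sub_div_pos K.pos hr).le.trans ht.1), mul_le_mul_iff_left₀ K.pos] at hd
  rw [start, le_antisymm hd ht.1]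

theorem start_ne_swap_start (hδ : 0 < δ) (hr : 4 * δ < r) : K.start δ ≠ K.swap.start δ := by
  intro h
  have := dist_triangle_left c c' (K.start δ)
  have hc' := K.swap.dist_start hr
  rw [← h] at hc'
  linarith [K.dist_start hr, K.lt_dist]

theorem reachable_start (hδ : 0 < δ) :
    (visibilityGraph (K.tube δ)).Reachable (K.start δ) K.a := by
  refine reachable_visibilityGraph fun z hz => .inr (.inl ?_)
  have hle : 1 - 2 * δ / r ≤ 1 := by
    have := K.pos
    have : 0 ≤ 2 * δ / r := by positivity
    linarith
  have ha : K.a = AffineMap.lineMap c K.a (1 : ℝ) := by simp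
  rw [start] at hz
  nth_rw 2 [ha] at hz
  rwa [← image_segment, segment_eq_Icc hle] at hz

theorem inner_sub_start_pos (hδ : 0 < δ) (hr : 4 * δ < r) {q : Plane} (hq : K.start δ ≠ q)
    (h : segment ℝ (K.start δ) q ⊆ K.tube δ) :
    0 < inner ℝ (q - K.start δ) (K.start δ - c) := by
  set p := K.start δ with hp
  have near : ∀ᶠ τ in nhdsWithin (0 : ℝ) (Set.Ioi 0),
      dist (AffineMap.lineMap p q τ) c < r - δ := by
    apply Filter.Eventually.filter_mono nhdsWithin_le_nhds
    refine ContinuousAt.eventually_lt (by fun_prop) continuousAt_const ?_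
    rw [AffineMap.lineMap_apply_zero, hp, K.dist_start hr]
    linarith
  obtain ⟨τ, hτ, hτ0, hτ1⟩ := (near.and (Ioo_mem_nhdsGT one_pos)).exists
  obtain ⟨t, ⟨ht, -⟩, hz⟩ := K.mem_spike_of_mem_tube hδ hr
    (h (lineMap_mem_segment ℝ p q ⟨hτ0.le, hτ1.le⟩)) hτ.le
  set ρ := 1 - 2 * δ / r with hρ
  have hρ0 : 0 < ρ := one_sub_div_pos K.pos hr
  have hpc : p - c = ρ • (K.a - c) := by
    rw [hp, start, AffineMap.lineMap_apply, vsub_eq_sub, vadd_eq_add, add_sub_cancel_right]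
  have radial : τ • (q - p) = (t - ρ) • (K.a - c) := by
    rw [AffineMap.lineMap_apply, AffineMap.lineMap_apply, vsub_eq_sub, vadd_eq_add, vsub_eq_sub,
      vadd_eq_add] at hz
    rw [sub_smul, ← hpc, ← sub_eq_zero, ← sub_eq_zero.2 hz.symm]
    abel
  have hac : K.a - c ≠ 0 := by
    rw [← norm_pos_iff, ← dist_eq_norm, K.dist_a]
    exact K.pos
  have htρ : ρ < t := by
    refine lt_of_le_of_ne ht fun e => ?_
    rw [← e, sub_self, zero_smul, smul_eq_zero, sub_eq_zero] at radial
    exact radial.elim hτ0.ne' fun e => hq e.symm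
  have scaled : τ * inner ℝ (q - p) (p - c) = (t - ρ) * ρ * inner ℝ (K.a - c) (K.a - c) := by
    rw [← real_inner_smul_left, radial, hpc, real_inner_smul_left, real_inner_smul_right]
    ring
  have : 0 < τ * inner ℝ (q - p) (p - c) := by
    rw [scaled]
    exact mul_pos (mul_pos (sub_pos.2 htρ) hρ0) (real_inner_self_pos.2 hac)
  exact pos_of_mul_pos_right this hτ0.le

theorem exists_polyLine (hδ : 0 < δ) (hr : 4 * δ < r) :
    ∃ L : PolyLine, L.p 0 = K.start δ ∧ L.p L.len = K.swap.start δ ∧ L.carrier ⊆ K.tube δ := by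
  refine Plane.exists_polyLine (K.start_ne_swap_start hδ hr) ((K.reachable_start hδ).trans ?_)
  refine .trans ?_ (K.tube_swap (δ := δ) ▸ K.swap.reachable_start hδ).symm
  exact (reachable_visibilityGraph_thickening K.isPreconnected hδ K.a_mem K.b_mem).mono
    (visibilityGraph_mono Set.subset_union_left)

end ArcCore

end Plane

open Filter Topology in
theorem eventually_forall_disjoint_thickening {ι X : Type*} [Finite ι] [PseudoMetricSpace X]
    {M : ι → Set X} (hM : ∀ i, IsCompact (M i)) (hclosed : ∀ i, IsClosed (M i))
    (hd : Pairwise fun i j => Disjoint (M i) (M j)) :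
    ∀ᶠ δ in 𝓝[>] (0 : ℝ), Pairwise fun i j =>
      Disjoint (Metric.thickening δ (M i)) (Metric.thickening δ (M j)) := by
  simp only [Pairwise, eventually_all]
  intro i j hij
  obtain ⟨ε, hε, h⟩ := (hd hij).exists_thickenings (hM i) (hclosed j)
  filter_upwards [Ioo_mem_nhdsGT hε] with δ hδ
  exact h.mono (Metric.thickening_mono hδ.2.le _) (Metric.thickening_mono hδ.2.le _)

theorem SimpleGraph.Drawing.isArc_of_eq {V : Type*} {G : SimpleGraph V} (φ : G.Drawing)
    {e : G.edgeSet} {x y : V} (h : (e : Sym2 V) = s(x, y)) :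
    IsArc (φ.point x) (φ.point y) (φ.arc e) := by
  obtain ⟨e, he⟩ := e
  subst h
  exact φ.arc_simple x y he

theorem SimpleGraph.Drawing.exists_eq_point_of_mem_arc {V : Type*} {G : SimpleGraph V}
    {φ : G.Drawing} (hφ : φ.crossings = ∅) {e f : G.edgeSet} (hef : e ≠ f) {z : Plane}
    (he : z ∈ φ.arc e) (hf : z ∈ φ.arc f) : ∃ v, z = φ.point v := by
  by_contra! hno
  have : z ∈ φ.crossings := ⟨e, f, hef, he, hf, fun ⟨v, hv, _⟩ => hno v hv⟩
  simp [hφ] at this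

namespace Plane

open Filter Topology in
theorem exists_drawing_radius {V : Type*} [Finite V] {G : SimpleGraph V}
    (φ : G.Drawing) : ∃ r : ℝ, 0 < r ∧ (∀ x y, x ≠ y → 2 * r < dist (φ.point x) (φ.point y)) ∧
      ∀ e : G.edgeSet, ∀ x, x ∉ (e : Sym2 V) → ∀ z ∈ φ.arc e, r ≤ dist z (φ.point x) := by
  have points : ∀ᶠ r in 𝓝[>] (0 : ℝ), ∀ x y, x ≠ y →
      2 * r < dist (φ.point x) (φ.point y) := by
    simp only [eventually_all]
    intro x y hxy
    apply Eventually.filter_mono nhdsWithin_le_nhds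
    refine ContinuousAt.eventually_lt (by fun_prop) continuousAt_const ?_
    simpa using fun h => hxy (φ.point_injective h)
  have arcs : ∀ᶠ r in 𝓝[>] (0 : ℝ), ∀ e : G.edgeSet, ∀ x, x ∉ (e : Sym2 V) →
      ∀ z ∈ φ.arc e, r ≤ dist z (φ.point x) := by
    have : Finite G.edgeSet := Subtype.finite
    simp only [eventually_all]
    intro e x hx
    obtain ⟨u, v, he⟩ : ∃ u v, (e : Sym2 V) = s(u, v) := Sym2.exists.1 ⟨e, rfl⟩
    have arc := φ.isArc_of_eq he
    have positive : 0 < Metric.infDist (φ.point x) (φ.arc e) :=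
      (arc.isCompact.isClosed.notMem_iff_infDist_pos ⟨_, arc.left_mem⟩).1
        fun h => hx (φ.mem_of_point_mem_arc e x h)
    filter_upwards [Ioo_mem_nhdsGT positive] with r hr z hz
    rw [dist_comm]
    exact hr.2.le.trans (Metric.infDist_le_dist_of_mem hz)
  obtain ⟨r, ⟨hpoints, harcs⟩, hr⟩ := ((points.and arcs).and self_mem_nhdsWithin).exists
  exact ⟨r, hr, hpoints, harcs⟩

/-- A polygonal layout of a graph: pairwise disjoint disks of radius `R` for the vertices, and for
each edge a polygonal line joining the boundaries of the disks of its ends. The lines are pairwise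
disjoint, meet the disks only at their ends, and leave them transversally. -/
structure PolyPlan {N : Type*} (D : SimpleGraph N) where
  center : N → Plane
  R : ℝ
  R_pos : 0 < R
  tail : D.edgeSet → N
  head : D.edgeSet → N
  edge_eq : ∀ e : D.edgeSet, (e : Sym2 N) = s(tail e, head e)
  line : D.edgeSet → PolyLine
  disjoint_ball : ∀ x y, x ≠ y →
    Disjoint (Metric.closedBall (center x) R) (Metric.closedBall (center y) R)
  disjoint_carrier : ∀ e f, e ≠ f → Disjoint (line e).carrier (line f).carrier
  mem_ball : ∀ e x, ∀ z ∈ (line e).carrier, z ∈ Metric.closedBall (center x) R →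
    (x = tail e ∧ z = (line e).p 0) ∨ (x = head e ∧ z = (line e).p (line e).len)
  dist_tail : ∀ e, dist ((line e).p 0) (center (tail e)) = R
  dist_head : ∀ e, dist ((line e).p (line e).len) (center (head e)) = R
  out_tail : ∀ e, 0 < inner ℝ ((line e).p 1 - (line e).p 0) ((line e).p 0 - center (tail e))
  out_head : ∀ e, 0 < inner ℝ ((line e).p ((line e).len - 1) - (line e).p (line e).len)
    ((line e).p (line e).len - center (head e))

/-- A pairwise disjoint system of arc cores for the edges of a graph whose vertices have been
placed at `center`. -/
structure CoreSystem {N : Type*} (D : SimpleGraph N) where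
  center : N → Plane
  r : ℝ
  r_pos : 0 < r
  lt_dist : ∀ x y, x ≠ y → 2 * r < dist (center x) (center y)
  tail : D.edgeSet → N
  head : D.edgeSet → N
  edge_eq : ∀ e : D.edgeSet, (e : Sym2 N) = s(tail e, head e)
  core : ∀ e, ArcCore (center (tail e)) (center (head e)) r
  le_dist : ∀ e x, ∀ z ∈ (core e).M, r ≤ dist z (center x)
  disjoint : Pairwise fun e f => Disjoint (core e).M (core f).M

theorem exists_coreSystem {N : Type*} [Finite N] {D : SimpleGraph N} {φ : D.Drawing}
    (hφ : φ.crossings = ∅) : Nonempty (CoreSystem D) := by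
  obtain ⟨r, hr, points, arcs⟩ := exists_drawing_radius φ
  have ends (e : D.edgeSet) : ∃ x y, (e : Sym2 N) = s(x, y) := Sym2.exists.1 ⟨e, rfl⟩
  choose tail head edge_eq using ends
  have ne (e) : tail e ≠ head e := D.ne_of_adj (by
    rw [← SimpleGraph.mem_edgeSet, ← edge_eq e]
    exact e.2)
  have cores (e) := (φ.isArc_of_eq (edge_eq e)).exists_core hr (points _ _ (ne e))
  choose K hK using cores
  have le_dist (e x) : ∀ z ∈ (K e).M, r ≤ dist z (φ.point x) := by
    intro z hz
    by_cases hx : x ∈ (e : Sym2 N)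
    · rw [edge_eq e, Sym2.mem_iff] at hx
      rcases hx with rfl | rfl
      · exact (K e).le_dist_left z hz
      · exact (K e).le_dist_right z hz
    · exact arcs e x hx z (hK e hz)
  refine ⟨⟨φ.point, r, hr, points, tail, head, edge_eq, K, le_dist, fun e f hef => ?_⟩⟩
  refine Set.disjoint_left.2 fun z he hf => ?_
  obtain ⟨v, rfl⟩ := φ.exists_eq_point_of_mem_arc hφ hef (hK e he) (hK f hf)
  have := le_dist e v _ he
  rw [dist_self] at this
  exact hr.not_ge this

theorem CoreSystem.eq_of_mem_tube {N : Type*} {D : SimpleGraph N} (S : CoreSystem D) {δ : ℝ}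
    (hδ : 0 < δ) (hr : 4 * δ < S.r) {e : D.edgeSet} {x : N} {z : Plane}
    (hz : z ∈ (S.core e).tube δ) (hx : dist z (S.center x) ≤ S.r - 2 * δ) :
    (x = S.tail e ∧ z = (S.core e).start δ) ∨
      (x = S.head e ∧ z = (S.core e).swap.start δ) := by
  by_cases htail : x = S.tail e
  · subst htail
    exact .inl ⟨rfl, (S.core e).eq_start_of_mem_tube hδ hr hz hx⟩
  by_cases hhead : x = S.head e
  · subst hhead
    exact .inr ⟨rfl, (S.core e).swap.eq_start_of_mem_tube hδ hr ((S.core e).tube_swap ▸ hz) hx⟩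
  exact absurd hx ((S.core e).lt_dist_of_mem_tube hδ hr (S.lt_dist _ _ (Ne.symm htail))
    (S.lt_dist _ _ (Ne.symm hhead)) (S.le_dist e x) hz).not_ge

open Filter Topology in
theorem CoreSystem.exists_width {N : Type*} [Finite N] {D : SimpleGraph N} (S : CoreSystem D) :
    ∃ δ : ℝ, 0 < δ ∧ 4 * δ < S.r ∧
      Pairwise fun e f => Disjoint ((S.core e).tube δ) ((S.core f).tube δ) := by
  have : Finite D.edgeSet := Subtype.finite
  have := S.r_pos
  have thin := eventually_forall_disjoint_thickening (fun e => (S.core e).isCompact)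
    (fun e => (S.core e).isCompact.isClosed) S.disjoint
  obtain ⟨ε, hε, hε0, hεr⟩ := (thin.and (Ioo_mem_nhdsGT (show 0 < S.r / 2 by positivity))).exists
  have inside (e) : (S.core e).tube (ε / 3) ⊆ Metric.thickening ε (S.core e).M := by
    simpa only [mul_div_cancel₀ ε three_ne_zero] using
      (S.core e).tube_subset_thickening (show 0 < ε / 3 by positivity)
  exact ⟨ε / 3, by positivity, by linarith, fun e f hef => (hε hef).mono (inside e) (inside f)⟩

theorem exists_polyPlan {N : Type*} [Finite N] {D : SimpleGraph N} {φ : D.Drawing}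
    (hφ : φ.crossings = ∅) : Nonempty (PolyPlan D) := by
  obtain ⟨S⟩ := exists_coreSystem hφ
  obtain ⟨δ, hδ, hr, disjoint⟩ := S.exists_width
  choose L h0 hlen hL using fun e => (S.core e).exists_polyLine hδ hr
  refine ⟨⟨S.center, S.r - 2 * δ, by linarith, S.tail, S.head, S.edge_eq, L, ?_,
    fun e f hef => (disjoint hef).mono (hL e) (hL f), ?_, ?_, ?_, ?_, ?_⟩⟩
  · intro x y hxy
    apply Metric.closedBall_disjoint_closedBall
    linarith [S.lt_dist x y hxy]
  · intro e x z hz hx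
    rw [h0, hlen]
    exact S.eq_of_mem_tube hδ hr (hL e hz) hx
  · exact fun e => h0 e ▸ (S.core e).dist_start hr
  · exact fun e => hlen e ▸ (S.core e).swap.dist_start hr
  · intro e
    have first := ((L e).segment_subset_carrier (L e).len_pos).trans (hL e)
    have ne := (L e).ne_succ 0 (L e).len_pos
    rw [h0] at first ne ⊢
    exact (S.core e).inner_sub_start_pos hδ hr ne first
  · intro e
    have hlast : (L e).len - 1 < (L e).len := Nat.sub_lt (L e).len_pos one_pos
    have last := ((L e).segment_subset_carrier hlast).trans (hL e)
    have ne := (L e).ne_succ _ hlast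
    rw [Nat.sub_add_cancel (L e).len_pos, hlen] at last ne
    rw [segment_symm, ← (S.core e).tube_swap] at last
    rw [hlen]
    exact (S.core e).swap.inner_sub_start_pos hδ hr ne.symm last

section Offsets

variable {a b c d d' p p' u u' n : Plane} {s t α β : ℝ}

theorem det_add_right (a b c : Plane) : det a (b + c) = det a b + det a c := by
  simp [det]; ring

theorem det_smul_right (t : ℝ) (a b : Plane) : det a (t • b) = t * det a b := by
  simp [det]; ring

theorem det_sub_right (a b c : Plane) : det a (b - c) = det a b - det a c := by
  simp [det]; ring

theorem det_self (a : Plane) : det a a = 0 := by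
  simp [det]; ring

theorem det_swap (a b : Plane) : det b a = -det a b := by
  simp [det]; ring

theorem exists_det_eq_one_det_eq_one (h : det d d' ≠ 0) : ∃ u, det d u = 1 ∧ det d' u = 1 := by
  refine ⟨(det d d')⁻¹ • (d' - d), ?_, ?_⟩
  · rw [det_smul_right, det_sub_right, det_self, sub_zero, inv_mul_cancel₀ h]
  · rw [det_smul_right, det_sub_right, det_self, zero_sub, ← det_swap, inv_mul_cancel₀ h]

theorem exists_det_eq_one_inner_eq_zero (h : inner ℝ d n ≠ 0) :
    ∃ u, det d u = 1 ∧ inner ℝ u n = 0 := by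
  refine ⟨(inner ℝ d n)⁻¹ • !₂[-n 1, n 0], ?_, ?_⟩
  · have : det d !₂[-n 1, n 0] = inner ℝ d n := by simp [det, inner_eq]
    rw [det_smul_right, this, inv_mul_cancel₀ h]
  · simp [inner_smul_left, inner_eq]
    ring_nf
    simp

theorem disjoint_segment_offset (hu : det (p' - p) u = 1) (hu' : det (p' - p) u' = 1)
    (hst : s ≠ t) :
    Disjoint (segment ℝ (p + s • u) (p' + s • u')) (segment ℝ (p + t • u) (p' + t • u')) := by
  have det_eq (r : ℝ) {z : Plane} (hz : z ∈ segment ℝ (p + r • u) (p' + r • u')) :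
      det (p' - p) (z - p) = r := by
    rw [segment_eq_image_lineMap] at hz
    obtain ⟨x, -, rfl⟩ := hz
    have : AffineMap.lineMap (p + r • u) (p' + r • u') x - p
        = x • (p' - p) + (r * (1 - x)) • u + (r * x) • u' := by
      rw [AffineMap.lineMap_apply_module]
      module
    rw [this, det_add_right, det_add_right, det_smul_right, det_smul_right, det_smul_right,
      det_self, hu, hu']
    ring
  exact Set.disjoint_left.2 fun z hz hz' => hst ((det_eq s hz).symm.trans (det_eq t hz'))

theorem disjoint_segment_offset_corner (hα : 0 ≤ α) (hβ : 0 ≤ β) (hd : det d u = 1)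
    (hd' : det d' u = 1) (hst : s ≠ t) :
    Disjoint (segment ℝ (p + s • u - α • d) (p + s • u))
      (segment ℝ (p + t • u) (p + t • u + β • d')) := by
  rw [segment_symm, segment_eq_image_lineMap, segment_eq_image_lineMap, Set.disjoint_left]
  rintro _ ⟨x, ⟨hx, -⟩, rfl⟩ ⟨y, ⟨hy, -⟩, hxy⟩
  have hu : (s - t) • u = (x * α) • d + (y * β) • d' := by
    rw [AffineMap.lineMap_apply_module, AffineMap.lineMap_apply_module] at hxy
    linear_combination (norm := module) -hxy
  have hs : s - t = y * β * det d d' := by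
    have := congrArg (det d) hu
    simpa [det_add_right, det_smul_right, det_self, hd] using this
  have ht : s - t = -(x * α * det d d') := by
    have := congrArg (det d') hu
    simpa [det_add_right, det_smul_right, det_self, hd', det_swap d d'] using this
  rcases mul_eq_zero.1 (show (x * α + y * β) * det d d' = 0 by linarith) with h | h
  · have : y * β = 0 := by linarith [mul_nonneg hx hα, mul_nonneg hy hβ]
    exact hst (by linarith [show y * β * det d d' = 0 by rw [this, zero_mul]])
  · exact hst (by linarith [show y * β * det d d' = 0 by rw [h, mul_zero]])

theorem disjoint_segment_of_inner {E : Type*} [NormedAddCommGroup E] [InnerProductSpace ℝ E]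
    {p n a b a' b' : E} (ha : inner ℝ (a - p) n = 0) (hb : 0 < inner ℝ (b - p) n)
    (ha' : inner ℝ (a' - p) n = 0) (hb' : inner ℝ (b' - p) n < 0) (h : a ≠ a') :
    Disjoint (segment ℝ a b) (segment ℝ a' b') := by
  have inner_lineMap (a b : E) (ha : inner ℝ (a - p) n = 0) (x : ℝ) :
      inner ℝ (AffineMap.lineMap a b x - p) n = x * inner ℝ (b - p) n := by
    have : AffineMap.lineMap a b x - p = (1 - x) • (a - p) + x • (b - p) := by
      rw [AffineMap.lineMap_apply_module]
      module
    rw [this, inner_add_left, real_inner_smul_left, real_inner_smul_left, ha, mul_zero, zero_add]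
  rw [segment_eq_image_lineMap, segment_eq_image_lineMap, Set.disjoint_left]
  rintro _ ⟨x, ⟨hx, -⟩, rfl⟩ ⟨y, ⟨hy, -⟩, hxy⟩
  have inner_eq : y * inner ℝ (b' - p) n = x * inner ℝ (b - p) n := by
    rw [← inner_lineMap a b ha, ← inner_lineMap a' b' ha', hxy]
  have hx0 : x = 0 := by
    by_contra hne
    nlinarith [mul_pos (hx.lt_of_ne' hne) hb, mul_nonneg hy (neg_nonneg.2 hb'.le)]
  have hy0 : y = 0 := by
    rw [hx0, zero_mul] at inner_eq
    exact (mul_eq_zero.1 inner_eq).resolve_right hb'.ne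
  rw [hx0, hy0, AffineMap.lineMap_apply_zero, AffineMap.lineMap_apply_zero] at hxy
  exact h hxy.symm

end Offsets

theorem PolyLine.exists_offset (L : PolyLine) {n n' : Plane} (hn : inner ℝ (L.p 1 - L.p 0) n ≠ 0)
    (hn' : inner ℝ (L.p (L.len - 1 + 1) - L.p (L.len - 1)) n' ≠ 0) :
    ∃ u : ℕ → Plane, (∀ i < L.len, det (L.p (i + 1) - L.p i) (u i) = 1) ∧
      (∀ i < L.len, det (L.p (i + 1) - L.p i) (u (i + 1)) = 1) ∧
      inner ℝ (u 0) n = 0 ∧ inner ℝ (u L.len) n' = 0 := by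
  have corner (i : ℕ) (hi : i + 1 < L.len) := exists_det_eq_one_det_eq_one
    (by simpa only [orient_eq_det] using L.turn i hi)
  obtain ⟨a, ha, han⟩ := exists_det_eq_one_inner_eq_zero hn
  obtain ⟨b, hb, hbn⟩ := exists_det_eq_one_inner_eq_zero hn'
  choose c hc hc' using corner
  have hlen := L.len_pos
  refine ⟨fun i => i.casesOn a fun i => if h : i + 1 < L.len then c i h else b, ?_, ?_, han, ?_⟩
  · rintro (_ | i) hi
    · exact ha
    · simpa only [dif_pos hi] using hc' i hi
  · intro i hi
    rcases Nat.lt_or_ge (i + 1) L.len with h | h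
    · simpa only [dif_pos h] using hc i h
    · obtain rfl : i = L.len - 1 := by omega
      simpa only [dif_neg h.not_gt] using hb
  · obtain ⟨m, hm⟩ : ∃ m, L.len = m + 1 := ⟨L.len - 1, by omega⟩
    simpa only [hm, lt_irrefl, dite_false] using hbn

namespace PolyPlan

variable {N : Type*} {D : SimpleGraph N} {Q : PolyPlan D}

theorem tail_ne_head (Q : PolyPlan D) (e : D.edgeSet) : Q.tail e ≠ Q.head e := by
  simpa [Q.edge_eq] using D.not_isDiag_of_mem_edgeSet e.2

/-- Directions `u e i` in which the corners of the polygonal lines can be moved such that moving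
all corners of a line by the same factor keeps the directions of its segments, and its ends stay on
the tangents of the disks. -/
structure Offset (Q : PolyPlan D) where
  u : D.edgeSet → ℕ → Plane
  det_left : ∀ e, ∀ i < (Q.line e).len, det ((Q.line e).p (i + 1) - (Q.line e).p i) (u e i) = 1
  det_right : ∀ e, ∀ i < (Q.line e).len,
    det ((Q.line e).p (i + 1) - (Q.line e).p i) (u e (i + 1)) = 1
  inner_tail : ∀ e, inner ℝ (u e 0) ((Q.line e).p 0 - Q.center (Q.tail e)) = 0
  inner_head : ∀ e,
    inner ℝ (u e (Q.line e).len) ((Q.line e).p (Q.line e).len - Q.center (Q.head e)) = 0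

theorem nonempty_offset (Q : PolyPlan D) : Nonempty Q.Offset := by
  have exists_u (e : D.edgeSet) := (Q.line e).exists_offset (Q.out_tail e).ne'
    (n' := (Q.line e).p (Q.line e).len - Q.center (Q.head e)) (by
      rw [Nat.sub_add_cancel (Q.line e).len_pos, ← neg_sub, inner_neg_left]
      exact neg_ne_zero.2 (Q.out_head e).ne')
  choose u h₁ h₂ h₃ h₄ using exists_u
  exact ⟨⟨u, h₁, h₂, h₃, h₄⟩⟩

/-- `k` is the index of the end of the polygonal line `e` at the disk `x`, and `k'` the index next
to it. -/
def EndAt (Q : PolyPlan D) (e : D.edgeSet) (x : N) (k k' : ℕ) : Prop :=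
  (x = Q.tail e ∧ k = 0 ∧ k' = 1) ∨ (x = Q.head e ∧ k = (Q.line e).len ∧ k' = (Q.line e).len - 1)

section EndAt

variable {e f : D.edgeSet} {x : N} {k k' l l' i : ℕ}

theorem exists_endAt_of_mem_carrier {z : Plane} (hz : z ∈ (Q.line e).carrier)
    (hx : z ∈ Metric.closedBall (Q.center x) Q.R) :
    ∃ k k', Q.EndAt e x k k' ∧ z = (Q.line e).p k := by
  rcases Q.mem_ball e x z hz hx with ⟨h, rfl⟩ | ⟨h, rfl⟩
  · exact ⟨0, 1, .inl ⟨h, rfl, rfl⟩, rfl⟩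
  · exact ⟨_, _, .inr ⟨h, rfl, rfl⟩, rfl⟩

namespace EndAt

theorem unique (h : Q.EndAt e x k k') (h' : Q.EndAt e x l l') : k = l ∧ k' = l' := by
  have := Q.tail_ne_head e
  rcases h with ⟨rfl, rfl, rfl⟩ | ⟨rfl, rfl, rfl⟩ <;>
    rcases h' with ⟨h, rfl, rfl⟩ | ⟨h, rfl, rfl⟩ <;> simp_all

theorem dist_eq (h : Q.EndAt e x k k') : dist ((Q.line e).p k) (Q.center x) = Q.R := by
  rcases h with ⟨rfl, rfl, rfl⟩ | ⟨rfl, rfl, rfl⟩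
  · exact Q.dist_tail e
  · exact Q.dist_head e

theorem inner_pos (h : Q.EndAt e x k k') :
    0 < inner ℝ ((Q.line e).p k' - (Q.line e).p k) ((Q.line e).p k - Q.center x) := by
  rcases h with ⟨rfl, rfl, rfl⟩ | ⟨rfl, rfl, rfl⟩
  · exact Q.out_tail e
  · exact Q.out_head e

theorem inner_offset (h : Q.EndAt e x k k') (O : Q.Offset) :
    inner ℝ (O.u e k) ((Q.line e).p k - Q.center x) = 0 := by
  rcases h with ⟨rfl, rfl, rfl⟩ | ⟨rfl, rfl, rfl⟩
  · exact O.inner_tail e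
  · exact O.inner_head e

theorem le_len (h : Q.EndAt e x k k') : k ≤ (Q.line e).len := by
  rcases h with ⟨-, rfl, -⟩ | ⟨-, rfl, -⟩
  · exact Nat.zero_le _
  · exact le_rfl

theorem exists_lt (h : Q.EndAt e x k k') :
    ∃ i < (Q.line e).len, (i = k ∧ i + 1 = k') ∨ (i = k' ∧ i + 1 = k) := by
  have := (Q.line e).len_pos
  rcases h with ⟨-, rfl, rfl⟩ | ⟨-, rfl, rfl⟩
  · exact ⟨0, this, by simp⟩
  · exact ⟨_, Nat.sub_one_lt_of_lt this, .inr ⟨rfl, Nat.sub_add_cancel this⟩⟩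

theorem offset_ne_zero (h : Q.EndAt e x k k') (O : Q.Offset) : O.u e k ≠ 0 := by
  intro h0
  obtain ⟨i, hi, ⟨rfl, -⟩ | ⟨-, rfl⟩⟩ := h.exists_lt
  · simpa [h0, det] using O.det_left e i hi
  · simpa [h0, det] using O.det_right e i hi

theorem mem_carrier (h : Q.EndAt e x k k') : (Q.line e).p k ∈ (Q.line e).carrier := by
  obtain ⟨i, hi, ⟨rfl, -⟩ | ⟨-, rfl⟩⟩ := h.exists_lt
  · exact (Q.line e).segment_subset_carrier hi (left_mem_segment ℝ _ _)
  · exact (Q.line e).segment_subset_carrier hi (right_mem_segment ℝ _ _)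

theorem edge_eq (h : Q.EndAt e x k k') (h' : Q.EndAt f x l l')
    (hp : (Q.line e).p k = (Q.line f).p l) : e = f := by
  by_contra hef
  exact Set.disjoint_left.1 (Q.disjoint_carrier e f hef) h.mem_carrier (hp ▸ h'.mem_carrier)

/-- The end of a line lies on no segment but the last one: the segments that are not adjacent to
that one are disjoint from it, and the line turns before it. -/
theorem index_eq (h : Q.EndAt e x k k') (hi : i < (Q.line e).len)
    (hm : (Q.line e).p k ∈ segment ℝ ((Q.line e).p i) ((Q.line e).p (i + 1))) :
    (i = k ∧ i + 1 = k') ∨ (i = k' ∧ i + 1 = k) := by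
  have hlen := (Q.line e).len_pos
  rcases h with ⟨-, rfl, rfl⟩ | ⟨-, rfl, rfl⟩
  · obtain rfl | rfl | h : i = 0 ∨ i = 1 ∨ 1 < i := by omega
    · simp
    · refine ((Q.line e).turn 0 hi ?_).elim
      have := orient_eq_zero_of_mem_segment hm
      simp only [orient, det, PiLp.sub_apply] at this ⊢
      linear_combination this
    · exact (Set.disjoint_left.1 ((Q.line e).disjoint 0 i (by omega) hi)
        (left_mem_segment ℝ _ _) hm).elim
  · obtain h | h | h : i + 1 = (Q.line e).len ∨ i + 2 = (Q.line e).len ∨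
      i + 1 < (Q.line e).len - 1 := by omega
    · omega
    · refine ((Q.line e).turn i (by omega) ?_).elim
      rw [← h] at hm
      exact orient_eq_zero_of_mem_segment hm
    · refine (Set.disjoint_left.1 ((Q.line e).disjoint i _ h (by omega)) hm ?_).elim
      rw [Nat.sub_add_cancel hlen]
      exact right_mem_segment ℝ _ _

end EndAt

end EndAt

namespace Offset

open Filter Topology

variable (O : Q.Offset) (e : D.edgeSet)

/-- The `i`-th segment of the line `e` after its corners have been moved by the factor `τ`. -/
def segmentAt (τ : ℝ) (i : ℕ) : Set Plane :=
  segment ℝ ((Q.line e).p i + τ • O.u e i) ((Q.line e).p (i + 1) + τ • O.u e (i + 1))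

variable {i : ℕ}

theorem exists_stretch (hi : i < (Q.line e).len) : ∃ c : ℝ, ∀ τ : ℝ,
    (Q.line e).p (i + 1) + τ • O.u e (i + 1) =
      (Q.line e).p i + τ • O.u e i + (1 + τ * c) • ((Q.line e).p (i + 1) - (Q.line e).p i) := by
  have hdet : det ((Q.line e).p (i + 1) - (Q.line e).p i) (O.u e (i + 1) - O.u e i) = 0 := by
    rw [det_sub_right, O.det_right e i hi, O.det_left e i hi, sub_self]
  obtain ⟨c, hc⟩ : ∃ c : ℝ, O.u e (i + 1) - O.u e i = c • ((Q.line e).p (i + 1) - (Q.line e).p i) :=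
    ⟨_, exists_eq_smul_of_det_eq_zero (sub_ne_zero.2 ((Q.line e).ne_succ i hi).symm) hdet⟩
  refine ⟨c, fun τ => ?_⟩
  rw [eq_add_of_sub_eq hc]
  module

theorem eventually_disjoint_segmentAt_succ (hi : i + 1 < (Q.line e).len) {s t : ℝ} (hst : s ≠ t) :
    ∀ᶠ ε : ℝ in 𝓝[≠] 0, Disjoint (O.segmentAt e (ε * s) i) (O.segmentAt e (ε * t) (i + 1)) := by
  obtain ⟨a, ha⟩ := O.exists_stretch e (i.lt_succ_self.trans hi)
  obtain ⟨b, hb⟩ := O.exists_stretch e hi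
  have pos (r c : ℝ) : ∀ᶠ ε : ℝ in 𝓝[≠] 0, 0 < 1 + ε * r * c := by
    have : ContinuousAt (fun ε : ℝ => 1 + ε * r * c) 0 := by fun_prop
    exact (this.eventually_const_lt (by simp)).filter_mono nhdsWithin_le_nhds
  filter_upwards [pos s a, pos t b, self_mem_nhdsWithin] with ε hε₁ hε₂ hε
  rw [segmentAt, segmentAt, hb, eq_sub_of_add_eq (ha (ε * s)).symm]
  exact disjoint_segment_offset_corner hε₁.le hε₂.le (O.det_right e i (i.lt_succ_self.trans hi))
    (O.det_left e _ hi) (fun h => hst (mul_left_cancel₀ hε h))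

end Offset

end PolyPlan

/-! ### Routing along polygonal lines -/

theorem eq_or_eq_of_mem_segment_of_dist_eq {a b c z : Plane} {r : ℝ}
    (ha : a ∈ Metric.closedBall c r) (hb : b ∈ Metric.closedBall c r) (hz : z ∈ segment ℝ a b)
    (hd : dist z c = r) : z = a ∨ z = b := by
  by_contra! hne
  obtain ⟨hza, hzb⟩ := hne
  have hab : a ≠ b := by
    rintro rfl
    exact hza (by simpa using hz)
  have hr : r ≠ 0 := by
    rintro rfl
    exact hab ((dist_le_zero.1 ha).trans (dist_le_zero.1 hb).symm)
  have := (strictConvex_closedBall ℝ c r).openSegment_subset ha hb hab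
    (mem_openSegment_of_ne_left_right hza.symm hzb.symm hz)
  rw [interior_closedBall c hr, Metric.mem_ball] at this
  exact this.ne hd

theorem inner_sub_pos_of_mem_closedBall {p b c : Plane} (hb : b ∈ Metric.closedBall c (dist p c))
    (hbp : b ≠ p) : 0 < inner ℝ (b - p) (c - p) := by
  have sq_le : ‖b - c‖ ^ 2 ≤ ‖p - c‖ ^ 2 :=
    pow_le_pow_left₀ (norm_nonneg _) (by simpa [dist_eq_norm] using hb) 2
  have norm_pos : 0 < ‖b - p‖ ^ 2 := pow_pos (norm_sub_pos_iff.2 hbp) 2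
  have := norm_sub_sq_real (b - p) (c - p)
  rw [sub_sub_sub_cancel_right, norm_sub_rev c p] at this
  linarith

/-- The points along which edges, indexed by `Γ`, are routed in a polygonal plan with nodes `N` and
lines `E`: the vertices, an auxiliary point for each edge in each disk, and a copy for each edge of
each corner of the lines. -/
inductive RoutePoint (V Γ N E : Type*) (K : ℕ)
  | vertex (v : V)
  | hub (g : Γ) (x : N)
  | bend (g : Γ) (e : E) (i : Fin (K + 1))

instance {V Γ N E : Type*} {K : ℕ} [Finite V] [Finite Γ] [Finite N] [Finite E] :
    Finite (RoutePoint V Γ N E K) := by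
  let code : RoutePoint V Γ N E K → V ⊕ (Γ × N) ⊕ (Γ × E × Fin (K + 1))
    | .vertex v => .inl v
    | .hub g x => .inr (.inl (g, x))
    | .bend g e i => .inr (.inr (g, e, i))
  refine Finite.of_injective code fun a b h => ?_
  cases a <;> cases b <;> simp_all [code]

/-- A polygonal plan of `D` together with the choices needed to route edges indexed by `Γ` along it:
a disk for each vertex, and a distinct multiple of the offset directions for each edge. The bound
`K` on the number of segments of a line makes the set of route points finite. -/
structure Layout {N V : Type*} (D : SimpleGraph N) (home : V → N) (Γ : Type*) where
  plan : PolyPlan D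
  offset : plan.Offset
  shift : Γ ↪ ℝ
  K : ℕ
  len_le : ∀ e, (plan.line e).len ≤ K

theorem nonempty_layout {N V Γ : Type*} [Finite N] [Finite Γ] {D : SimpleGraph N} {φ : D.Drawing}
    (hφ : φ.crossings = ∅) (home : V → N) : Nonempty (Layout D home Γ) := by
  obtain ⟨Q⟩ := exists_polyPlan hφ
  obtain ⟨O⟩ := Q.nonempty_offset
  obtain ⟨num, hnum⟩ := exists_injective_nat Γ
  obtain ⟨K, hK⟩ := Finite.exists_le fun e => (Q.line e).len
  exact ⟨⟨Q, O, ⟨fun g => num g, Nat.cast_injective.comp hnum⟩, K, hK⟩⟩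

namespace Layout

open RoutePoint Filter Topology

variable {N V Γ : Type*} {D : SimpleGraph N} {home : V → N} (Λ : Layout D home Γ)

/-- The route points of a layout. -/
abbrev Point : Type _ := RoutePoint V Γ N D.edgeSet Λ.K

/-- The positions of the route points when the offset of the lines is scaled by `ε`. All points of a
disk are at its center, as a perturbation separates them later. -/
noncomputable def pos (ε : ℝ) : Λ.Point → Plane
  | vertex v => Λ.plan.center (home v)
  | hub _ x => Λ.plan.center x
  | bend g e i => (Λ.plan.line e).p i + (ε * Λ.shift g) • Λ.offset.u e i

/-- The steps of the edge `g` along a line. -/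
def IsStrip (g : Γ) (s : Sym2 Λ.Point) : Prop :=
  ∃ e, ∃ i : Fin Λ.K, (i : ℕ) < (Λ.plan.line e).len ∧
    s = s(bend g e i.castSucc, bend g e i.succ)

/-- The route points of the edge `g` in the disk of `x`. -/
inductive IsAt (g : Γ) : N → Λ.Point → Prop
  | vertex (v : V) : IsAt g (home v) (vertex v)
  | hub (x : N) : IsAt g x (hub g x)
  | bend {e : D.edgeSet} {x : N} {k : Fin (Λ.K + 1)} {k' : ℕ} (hk : Λ.plan.EndAt e x k k') :
      IsAt g x (bend g e k)

/-- The steps of the edge `g` inside the disk of `x`. -/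
def IsChord (g : Γ) (x : N) (s : Sym2 Λ.Point) : Prop :=
  ∃ w w', w ≠ w' ∧ Λ.IsAt g x w ∧ Λ.IsAt g x w' ∧ s = s(w, w')

variable {Λ} {g h : Γ} {s t : Sym2 Λ.Point} {x y : N} {e : D.edgeSet}
  {w : Λ.Point} {k k' : ℕ}

theorem continuous_pos : Continuous Λ.pos := by
  refine continuous_pi fun w => ?_
  cases w <;> simp only [pos] <;> fun_prop

theorem seg_pos_strip (ε : ℝ) (i : Fin Λ.K) :
    seg (Λ.pos ε) s(bend g e i.castSucc, bend g e i.succ) =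
      Λ.offset.segmentAt e (ε * Λ.shift g) i := by
  simp [pos, PolyPlan.Offset.segmentAt]

theorem seg_pos_zero_strip (i : Fin Λ.K) :
    seg (Λ.pos 0) s(bend g e i.castSucc, bend g e i.succ) =
      segment ℝ ((Λ.plan.line e).p i) ((Λ.plan.line e).p (i + 1)) := by
  simp [pos]

theorem IsAt.pos_mem_closedBall (hw : Λ.IsAt g x w) :
    Λ.pos 0 w ∈ Metric.closedBall (Λ.plan.center x) Λ.plan.R := by
  cases hw with
  | bend hk => simp [pos, hk.dist_eq]
  | _ => exact Metric.mem_closedBall_self Λ.plan.R_pos.le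

theorem IsAt.exists_eq_bend_of_dist_eq (hw : Λ.IsAt g x w)
    (hd : dist (Λ.pos 0 w) (Λ.plan.center x) = Λ.plan.R) :
    ∃ e, ∃ k : Fin (Λ.K + 1), ∃ k', Λ.plan.EndAt e x k k' ∧ w = .bend g e k ∧
      Λ.pos 0 w = (Λ.plan.line e).p k := by
  cases hw with
  | bend hk => exact ⟨_, _, _, hk, rfl, by simp [pos]⟩
  | _ => exact (Λ.plan.R_pos.ne ((dist_self _).symm.trans hd)).elim

theorem IsAt.eq_bend {k : Fin (Λ.K + 1)} (hw : Λ.IsAt g x w) (hk : Λ.plan.EndAt e x k k')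
    (hp : Λ.pos 0 w = (Λ.plan.line e).p k) : w = .bend g e k := by
  obtain ⟨f, l, l', hl, rfl, hp'⟩ := hw.exists_eq_bend_of_dist_eq (hp ▸ hk.dist_eq)
  obtain rfl := hk.edge_eq hl (hp.symm.trans hp')
  rw [Fin.ext (hk.unique hl).1]

theorem IsAt.inner_pos {k : Fin (Λ.K + 1)} (hw : Λ.IsAt g x w) (hk : Λ.plan.EndAt e x k k')
    (hne : w ≠ .bend g e k) :
    0 < inner ℝ (Λ.pos 0 w - (Λ.plan.line e).p k) (Λ.plan.center x - (Λ.plan.line e).p k) :=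
  inner_sub_pos_of_mem_closedBall (hk.dist_eq ▸ hw.pos_mem_closedBall)
    fun h => hne (hw.eq_bend hk h)

theorem IsChord.seg_subset_closedBall (hs : Λ.IsChord g x s) :
    seg (Λ.pos 0) s ⊆ Metric.closedBall (Λ.plan.center x) Λ.plan.R := by
  obtain ⟨w, w', -, hw, hw', rfl⟩ := hs
  exact (convex_closedBall _ _).segment_subset hw.pos_mem_closedBall hw'.pos_mem_closedBall

theorem IsChord.exists_eq_of_dist_eq (hs : Λ.IsChord g x s) {z : Plane}
    (hz : z ∈ seg (Λ.pos 0) s) (hd : dist z (Λ.plan.center x) = Λ.plan.R) :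
    ∃ w w', w ≠ w' ∧ Λ.IsAt g x w ∧ Λ.IsAt g x w' ∧ s = s(w, w') ∧ Λ.pos 0 w = z := by
  obtain ⟨w, w', hww, hw, hw', rfl⟩ := hs
  rcases eq_or_eq_of_mem_segment_of_dist_eq hw.pos_mem_closedBall hw'.pos_mem_closedBall hz hd
    with h | h
  · exact ⟨w, w', hww, hw, hw', rfl, h.symm⟩
  · exact ⟨w', w, hww.symm, hw', hw, Sym2.eq_swap, h.symm⟩

theorem eventually_disjoint_of_zero (h : Disjoint (seg (Λ.pos 0) s) (seg (Λ.pos 0) t)) :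
    ∀ᶠ ε in 𝓝[≠] 0, Disjoint (seg (Λ.pos ε) s) (seg (Λ.pos ε) t) :=
  ((continuous_pos.tendsto 0).eventually (Plane.eventually_disjoint_seg h)).filter_mono
    nhdsWithin_le_nhds

theorem mul_shift_ne (hgh : g ≠ h) {ε : ℝ} (hε : ε ≠ 0) : ε * Λ.shift g ≠ ε * Λ.shift h :=
  (mul_right_injective₀ hε).ne (Λ.shift.injective.ne hgh)

theorem eventually_disjoint_strip_of_le {i j : Fin Λ.K} (hij : i ≤ j)
    (hj : (j : ℕ) < (Λ.plan.line e).len)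
    (hst : ∀ w ∈ s(bend g e i.castSucc, bend g e i.succ),
      w ∉ (s(bend h e j.castSucc, bend h e j.succ) : Sym2 Λ.Point)) :
    ∀ᶠ ε in 𝓝[≠] 0, Disjoint (seg (Λ.pos ε) s(bend g e i.castSucc, bend g e i.succ))
      (seg (Λ.pos ε) s(bend h e j.castSucc, bend h e j.succ)) := by
  have hi := lt_of_le_of_lt (Fin.le_def.1 hij) hj
  obtain hij | hij | hij : (i : ℕ) = j ∨ (i : ℕ) + 1 = j ∨ (i : ℕ) + 1 < j := by
    have := Fin.le_def.1 hij
    omega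
  · obtain rfl := Fin.ext hij
    have hgh : g ≠ h := by
      rintro rfl
      exact hst _ (Sym2.mem_mk_left _ _) (Sym2.mem_mk_left _ _)
    filter_upwards [self_mem_nhdsWithin] with ε hε
    rw [seg_pos_strip, seg_pos_strip]
    exact disjoint_segment_offset (Λ.offset.det_left e _ hi) (Λ.offset.det_right e _ hi)
      (mul_shift_ne hgh hε)
  · have hgh : g ≠ h := by
      rintro rfl
      have : j.castSucc = i.succ := Fin.ext (by simpa using hij.symm)
      exact hst _ (Sym2.mem_mk_right _ _) (this ▸ Sym2.mem_mk_left _ _)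
    simp only [seg_pos_strip, ← hij]
    exact Λ.offset.eventually_disjoint_segmentAt_succ e (hij ▸ hj) (Λ.shift.injective.ne hgh)
  · apply eventually_disjoint_of_zero
    rw [seg_pos_zero_strip, seg_pos_zero_strip]
    exact (Λ.plan.line e).disjoint i j hij hj

theorem eventually_disjoint_strip_strip (hst : ∀ w ∈ s, w ∉ t) (hs : Λ.IsStrip g s)
    (ht : Λ.IsStrip h t) : ∀ᶠ ε in 𝓝[≠] 0, Disjoint (seg (Λ.pos ε) s) (seg (Λ.pos ε) t) := by
  obtain ⟨e, i, hi, rfl⟩ := hs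
  obtain ⟨f, j, hj, rfl⟩ := ht
  rcases eq_or_ne e f with rfl | hef
  · rcases le_total i j with hij | hij
    · exact eventually_disjoint_strip_of_le hij hj hst
    · exact (eventually_disjoint_strip_of_le hij hi fun w hw hw' => hst w hw' hw).mono
        fun _ h => h.symm
  · apply eventually_disjoint_of_zero
    rw [seg_pos_zero_strip, seg_pos_zero_strip]
    exact (Λ.plan.disjoint_carrier e f hef).mono ((Λ.plan.line e).segment_subset_carrier hi)
      ((Λ.plan.line f).segment_subset_carrier hj)

theorem eventually_inner_pos_of_zero (p u : Plane)
    (h : 0 < inner ℝ (Λ.pos 0 w - p) u) :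
    ∀ᶠ ε in 𝓝 0, 0 < inner ℝ (Λ.pos ε w - p) u := by
  have cont : Continuous fun ε => Λ.pos ε w := continuous_pi_iff.1 continuous_pos _
  have : ContinuousAt (fun ε => inner ℝ (Λ.pos ε w - p) u) 0 := by fun_prop
  exact this.eventually_const_lt h

/-- The segment of a line leaving a disk and the chord of another edge to the same end lie on
different sides of the tangent. -/
theorem eventually_disjoint_end {k k' : Fin (Λ.K + 1)} (hk : Λ.plan.EndAt e x k k')
    (hgh : g ≠ h) (hw : Λ.IsAt h x w) (hne : bend h e k ≠ w) :
    ∀ᶠ ε in 𝓝[≠] 0, Disjoint (seg (Λ.pos ε) s(bend g e k, bend g e k'))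
      (seg (Λ.pos ε) s(bend h e k, w)) := by
  let p := (Λ.plan.line e).p k
  have tangent (g : Γ) (ε : ℝ) :
      inner ℝ (Λ.pos ε (bend g e k) - p) (p - Λ.plan.center x) = 0 := by
    rw [pos, add_sub_cancel_left, inner_smul_left, hk.inner_offset, mul_zero]
  have outside :
      ∀ᶠ ε in 𝓝 0, 0 < inner ℝ (Λ.pos ε (bend g e k') - p) (p - Λ.plan.center x) :=
    eventually_inner_pos_of_zero _ _ (by simpa [pos] using hk.inner_pos)
  have inside : ∀ᶠ ε in 𝓝 0, 0 < inner ℝ (Λ.pos ε w - p) (Λ.plan.center x - p) :=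
    eventually_inner_pos_of_zero _ _ (hw.inner_pos hk hne.symm)
  filter_upwards [outside.filter_mono nhdsWithin_le_nhds, inside.filter_mono nhdsWithin_le_nhds,
    self_mem_nhdsWithin] with ε houtside hinside hε
  rw [← neg_sub p (Λ.plan.center x), inner_neg_right, neg_pos] at hinside
  refine disjoint_segment_of_inner (tangent g ε) houtside (tangent h ε) hinside fun heq => ?_
  exact mul_shift_ne hgh hε (smul_left_injective ℝ (hk.offset_ne_zero Λ.offset)
    (add_left_cancel heq))

theorem eventually_disjoint_strip_chord (hst : ∀ w ∈ s, w ∉ t) (hs : Λ.IsStrip g s)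
    (ht : Λ.IsChord h x t) : ∀ᶠ ε in 𝓝[≠] 0, Disjoint (seg (Λ.pos ε) s) (seg (Λ.pos ε) t) := by
  by_cases hdis : Disjoint (seg (Λ.pos 0) s) (seg (Λ.pos 0) t)
  · exact eventually_disjoint_of_zero hdis
  obtain ⟨z, hzs, hzt⟩ := Set.not_disjoint_iff.1 hdis
  obtain ⟨e, i, hi, rfl⟩ := hs
  rw [seg_pos_zero_strip] at hzs
  obtain ⟨_, k', hk, rfl⟩ := PolyPlan.exists_endAt_of_mem_carrier
    ((Λ.plan.line e).segment_subset_carrier hi hzs) (ht.seg_subset_closedBall hzt)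
  obtain ⟨w, w', hww, hw, hw', rfl, hp⟩ := ht.exists_eq_of_dist_eq hzt hk.dist_eq
  obtain ⟨f, l, l', hl, rfl, hp'⟩ := hw.exists_eq_bend_of_dist_eq (hp ▸ hk.dist_eq)
  obtain rfl := hk.edge_eq hl (hp.symm.trans hp')
  obtain ⟨rfl, rfl⟩ := hk.unique hl
  obtain ⟨m, rfl, hmi⟩ : ∃ m : Fin (Λ.K + 1), k' = m ∧
      (s(bend g e i.castSucc, bend g e i.succ) : Sym2 Λ.Point) = s(bend g e l, bend g e m) := by
    rcases hk.index_eq hi hzs with ⟨h₁, h₂⟩ | ⟨h₁, h₂⟩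
    · obtain rfl : l = i.castSucc := Fin.ext (by simpa using h₁.symm)
      exact ⟨i.succ, by simpa using h₂.symm, rfl⟩
    · obtain rfl : l = i.succ := Fin.ext (by simpa using h₂.symm)
      exact ⟨i.castSucc, by simpa using h₁.symm, Sym2.eq_swap⟩
  rw [hmi] at hst ⊢
  refine eventually_disjoint_end (k' := m) hk ?_ hw' hww
  rintro rfl
  exact hst _ (Sym2.mem_mk_left _ _) (Sym2.mem_mk_left _ _)

theorem eventually_disjoint_chord_chord (hxy : x ≠ y) (hs : Λ.IsChord g x s)
    (ht : Λ.IsChord h y t) : ∀ᶠ ε in 𝓝[≠] 0, Disjoint (seg (Λ.pos ε) s) (seg (Λ.pos ε) t) :=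
  eventually_disjoint_of_zero
    ((Λ.plan.disjoint_ball x y hxy).mono hs.seg_subset_closedBall ht.seg_subset_closedBall)

end Layout

/-- The edge a route point is reserved for. -/
def RoutePoint.owner {V Γ N E : Type*} {K : ℕ} : RoutePoint V Γ N E K → Option Γ
  | vertex _ => none
  | hub g _ => some g
  | bend g _ _ => some g

namespace Layout

open RoutePoint Filter Topology

variable {N V Γ : Type*} {D : SimpleGraph N} {home : V → N} {Λ : Layout D home Γ}

theorem exists_routing_of_reachable {G : SimpleGraph V} {Λ : Layout D home G.edgeSet}
    (host : G.edgeSet → SimpleGraph Λ.Point)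
    (howner : ∀ g, ∀ s ∈ (host g).edgeSet, ∀ w ∈ s,
      w.owner = some g ∨ ∃ v ∈ (g : Sym2 V), w = vertex v)
    (hreach : ∀ (g : G.edgeSet) (v w : V), (g : Sym2 V) = s(v, w) →
      (host g).Reachable (vertex v) (vertex w)) :
    ∃ R : Routing G Λ.Point, ∀ g, ∀ s ∈ (R.walk g).edges, s ∈ (host g).edgeSet := by
  have exists_ends (g : G.edgeSet) : ∃ v w, (g : Sym2 V) = s(v, w) := by
    obtain ⟨⟨v, w⟩, h⟩ := g
    exact ⟨v, w, rfl⟩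
  choose tail head edge_eq using exists_ends
  choose walk isPath using fun g => (hreach g _ _ (edge_eq g)).exists_isPath
  have owner_eq_or {g w} (hw : w ∈ (walk g).support) :
      w.owner = some g ∨ ∃ v ∈ (g : Sym2 V), w = vertex v := by
    rcases SimpleGraph.Walk.mem_support_iff_exists_mem_edges.1 hw with rfl | ⟨s, hs, hws⟩
    · exact .inr ⟨_, edge_eq g ▸ Sym2.mem_mk_right _ _, rfl⟩
    · exact howner g s ((walk g).edges_subset_edgeSet hs) w hws
  refine ⟨⟨⟨vertex, fun _ _ => RoutePoint.vertex.inj⟩, _, tail, head, edge_eq, walk, isPath,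
    fun g v hv => ?_, fun g h hgh w hg hh => ?_⟩, fun g s hs =>
      (walk g).edges_subset_edgeSet hs⟩
  · rcases owner_eq_or hv with h | ⟨v', hv', h⟩
    · simp [owner] at h
    · exact RoutePoint.vertex.inj h ▸ hv'
  · rcases owner_eq_or hg with hg | ⟨v, -, rfl⟩
    · rcases owner_eq_or hh with hh | ⟨v, -, rfl⟩
      · exact (hgh (Option.some.inj (hg.symm.trans hh))).elim
      · exact ⟨v, rfl⟩
    · exact ⟨v, rfl⟩

variable {g h : Γ} {x y : N} {s t : Sym2 Λ.Point} {w : Λ.Point} {H : SimpleGraph Λ.Point}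
  {e : D.edgeSet}

theorem IsStrip.owner_eq (hs : Λ.IsStrip g s) (hw : w ∈ s) : w.owner = some g := by
  obtain ⟨e, i, -, rfl⟩ := hs
  rcases Sym2.mem_iff.1 hw with rfl | rfl <;> rfl

theorem IsStrip.not_isDiag (hs : Λ.IsStrip g s) : ¬ s.IsDiag := by
  obtain ⟨e, i, -, rfl⟩ := hs
  simp [Fin.castSucc_lt_succ.ne]

theorem reachable_bend (hH : ∀ s, Λ.IsStrip g s → s ∈ H.edgeSet) (e : D.edgeSet) (n : ℕ)
    (hn : n ≤ (Λ.plan.line e).len) :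
    H.Reachable (bend g e 0) (bend g e ⟨n, Nat.lt_succ_of_le (hn.trans (Λ.len_le e))⟩) := by
  induction n with
  | zero => rfl
  | succ n ih =>
    exact (ih (Nat.le_of_succ_le hn)).trans
      (SimpleGraph.Adj.reachable (hH _ ⟨e, ⟨n, hn.trans (Λ.len_le e)⟩, hn, rfl⟩))

theorem reachable_of_endAt (hH : ∀ s, Λ.IsStrip g s → s ∈ H.edgeSet)
    {k l : Fin (Λ.K + 1)} {k' l' : ℕ} (hk : Λ.plan.EndAt e x k k') (hl : Λ.plan.EndAt e y l l') :
    H.Reachable (bend g e k) (bend g e l) :=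
  (reachable_bend hH e k hk.le_len).symm.trans (reachable_bend hH e l hl.le_len)

theorem exists_endAt (e : D.edgeSet) (hx : x ∈ (e : Sym2 N)) :
    ∃ k : Fin (Λ.K + 1), ∃ k', Λ.plan.EndAt e x k k' := by
  rw [Λ.plan.edge_eq, Sym2.mem_iff] at hx
  rcases hx with rfl | rfl
  · exact ⟨0, 1, .inl ⟨rfl, rfl, rfl⟩⟩
  · exact ⟨⟨_, Nat.lt_succ_of_le (Λ.len_le e)⟩, _, .inr ⟨rfl, rfl, rfl⟩⟩

/-- The steps inside the disk of `x` by which the edge `g` is routed through its center. -/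
def IsRay (g : Γ) (x : N) (s : Sym2 Λ.Point) : Prop :=
  (∃ v, home v = x ∧ s = s(hub g x, vertex v)) ∨
    ∃ e, ∃ k : Fin (Λ.K + 1), ∃ k', Λ.plan.EndAt e x k k' ∧ s = s(hub g x, bend g e k)

theorem IsRay.isChord (hs : Λ.IsRay g x s) : Λ.IsChord g x s := by
  rcases hs with ⟨v, rfl, rfl⟩ | ⟨e, k, k', hk, rfl⟩
  · exact ⟨_, _, by simp, .hub _, .vertex v, rfl⟩
  · exact ⟨_, _, by simp, .hub _, .bend hk, rfl⟩

theorem IsRay.hub_mem (hs : Λ.IsRay g x s) : hub g x ∈ s := by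
  rcases hs with ⟨v, -, rfl⟩ | ⟨e, k, k', -, rfl⟩ <;> exact Sym2.mem_mk_left _ _

theorem IsRay.owner_eq_or (hs : Λ.IsRay g x s) (hw : w ∈ s) :
    w.owner = some g ∨ ∃ v, w = vertex v := by
  rcases hs with ⟨v, rfl, rfl⟩ | ⟨e, k, k', -, rfl⟩ <;>
    rcases Sym2.mem_iff.1 hw with rfl | rfl <;> simp [owner]

theorem IsStrip.not_isRay (hs : Λ.IsStrip g s) : ¬ Λ.IsRay h x s := by
  obtain ⟨e, i, -, rfl⟩ := hs
  intro hs
  simpa using hs.hub_mem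

theorem IsRay.eq (hs : Λ.IsRay g x s) (hs' : Λ.IsRay g y s) : x = y := by
  rcases hs with ⟨v, -, rfl⟩ | ⟨e, k, k', -, rfl⟩ <;> simpa [eq_comm] using hs'.hub_mem

theorem exists_forall_disjoint [Finite V] [Finite Γ] [Finite N] (Λ : Layout D home Γ) :
    ∃ ε, ∀ (g h : Γ) (s t : Sym2 Λ.Point), (∀ w ∈ s, w ∉ t) →
      (Λ.IsStrip g s ∨ ∃ x, Λ.IsRay g x s) → (Λ.IsStrip h t ∨ ∃ x, Λ.IsRay h x t) →
      (¬ ∃ x, Λ.IsRay g x s ∧ Λ.IsRay h x t) →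
      Disjoint (seg (Λ.pos ε) s) (seg (Λ.pos ε) t) := by
  apply Eventually.exists (f := 𝓝[≠] 0)
  simp only [eventually_all]
  rintro g h s t hst (hs | ⟨x, hs⟩) (ht | ⟨y, ht⟩) hno
  · exact eventually_disjoint_strip_strip hst hs ht
  · exact eventually_disjoint_strip_chord hst hs ht.isChord
  · exact (eventually_disjoint_strip_chord (fun w hw hw' => hst w hw' hw) ht hs.isChord).mono
      fun _ h => h.symm
  · refine eventually_disjoint_chord_chord ?_ hs.isChord ht.isChord
    rintro rfl
    exact hno ⟨x, hs, ht⟩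


variable (Λ) in
/-- The steps at the disposal of the edge `g` when it may enter only the disks in `X` and visit only
the vertices in `U`. -/
def host (g : Γ) (X : Set N) (U : Set V) : SimpleGraph Λ.Point :=
  .fromEdgeSet {s | Λ.IsStrip g s ∨ ∃ x ∈ X, Λ.IsRay g x s ∧ ∀ v, vertex v ∈ s → v ∈ U}

variable {X : Set N} {U : Set V} {v : V}

theorem isStrip_or_isRay_of_mem_host (hs : s ∈ (Λ.host g X U).edgeSet) :
    Λ.IsStrip g s ∨ ∃ x ∈ X, Λ.IsRay g x s := by
  rw [host, SimpleGraph.edgeSet_fromEdgeSet] at hs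
  exact hs.1.imp_right fun ⟨x, hx, hxs, _⟩ => ⟨x, hx, hxs⟩

theorem owner_eq_or_eq_vertex_of_mem_host (hs : s ∈ (Λ.host g X U).edgeSet) (hw : w ∈ s) :
    w.owner = some g ∨ ∃ v ∈ U, w = vertex v := by
  rw [host, SimpleGraph.edgeSet_fromEdgeSet] at hs
  rcases hs.1 with hs | ⟨x, -, hs, hU⟩
  · exact .inl (hs.owner_eq hw)
  · refine (hs.owner_eq_or hw).imp_right ?_
    rintro ⟨v, rfl⟩
    exact ⟨v, hU v hw, rfl⟩

theorem mem_edgeSet_host_of_isStrip (hs : Λ.IsStrip g s) : s ∈ (Λ.host g X U).edgeSet := by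
  rw [host, SimpleGraph.edgeSet_fromEdgeSet]
  exact ⟨.inl hs, hs.not_isDiag⟩

theorem host_adj_hub_vertex (hv : v ∈ U) (hX : home v ∈ X) :
    (Λ.host g X U).Adj (hub g (home v)) (vertex v) := by
  rw [host, SimpleGraph.fromEdgeSet_adj]
  refine ⟨.inr ⟨home v, hX, .inl ⟨v, rfl, rfl⟩, fun v' hv' => ?_⟩, by simp⟩
  obtain rfl : v' = v := by simpa using hv'
  exact hv

theorem host_adj_hub_bend {k : Fin (Λ.K + 1)} {k' : ℕ} (hx : x ∈ X)
    (hk : Λ.plan.EndAt e x k k') : (Λ.host g X U).Adj (hub g x) (bend g e k) := by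
  rw [host, SimpleGraph.fromEdgeSet_adj]
  exact ⟨.inr ⟨x, hx, .inr ⟨e, k, k', hk, rfl⟩, by simp⟩, by simp⟩

theorem host_reachable_hub_of_adj (h : D.Adj x y) (hx : x ∈ X) (hy : y ∈ X) :
    (Λ.host g X U).Reachable (hub g x) (hub g y) := by
  obtain ⟨k, k', hk⟩ := Λ.exists_endAt ⟨s(x, y), h⟩ (Sym2.mem_mk_left x y)
  obtain ⟨l, l', hl⟩ := Λ.exists_endAt ⟨s(x, y), h⟩ (Sym2.mem_mk_right x y)
  exact ((host_adj_hub_bend hx hk).reachable.trans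
    (reachable_of_endAt (fun _ => mem_edgeSet_host_of_isStrip) hk hl)).trans
    (host_adj_hub_bend hy hl).reachable.symm

theorem host_reachable_hub (hX : (D.induce X).Preconnected) (hx : x ∈ X) (hy : y ∈ X) :
    (Λ.host g X U).Reachable (hub g x) (hub g y) := by
  obtain ⟨p⟩ := hX ⟨x, hx⟩ ⟨y, hy⟩
  suffices ∀ {a b : X}, (D.induce X).Walk a b →
      (Λ.host g X U).Reachable (hub g (a : N)) (hub g (b : N)) from this p
  intro a b p
  induction p with
  | nil => rfl
  | @cons a c _ h _ ih => exact (host_reachable_hub_of_adj (D.induce_adj.1 h) a.2 c.2).trans ih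

theorem host_reachable_vertex {v' : V} (hX : (D.induce X).Preconnected) (hv : v ∈ U) (hv' : v' ∈ U)
    (hx : home v ∈ X) (hx' : home v' ∈ X) :
    (Λ.host g X U).Reachable (vertex v) (vertex v') :=
  ((host_adj_hub_vertex hv hx).reachable.symm.trans (host_reachable_hub hX hx hx')).trans
    (host_adj_hub_vertex hv' hx').reachable

end Layout

end Plane

/-! ### Crossings of a graph drawn along a planar decomposition -/

namespace SimpleGraph.Decomposition

open Plane Plane.RoutePoint

variable {V : Type*} {G : SimpleGraph V} (B : G.Decomposition)

/-- The nodes whose bags contain an end of the edge `g`. -/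
def touching (g : G.edgeSet) : Set B.Node :=
  {x | ∃ v ∈ (g : Sym2 V), v ∈ B.bag x}

theorem preconnected_induce_touching (g : G.edgeSet) :
    (B.graph.induce (B.touching g)).Preconnected := by
  obtain ⟨⟨v, w⟩, h⟩ := g
  have touching_eq : B.touching ⟨s(v, w), h⟩ = {x | v ∈ B.bag x} ∪ {x | w ∈ B.bag x} := by
    ext x
    simp [touching]
  obtain ⟨x, y, hx, hy, rfl | hxy⟩ := B.touch v w h <;> rw [touching_eq]
  · exact (induce_union_connected (B.connected v).preconnected (B.connected w).preconnected
      ⟨x, hx, hy⟩).preconnected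
  · exact (connected_induce_union (B.connected v).preconnected (B.connected w).preconnected hx hy
      hxy).preconnected

theorem card_bag_le (x : B.Node) : (B.bag x).card ≤ B.width :=
  letI := B.fintypeNode
  Finset.le_sup (f := fun x => (B.bag x).card) (Finset.mem_univ x)

theorem ncard_setOf_mem_touching_le [Finite V] {k Δ : ℕ} (hk : B.width ≤ k)
    (hΔ : ∀ v, {g : G.edgeSet | v ∈ (g : Sym2 V)}.ncard ≤ Δ) (x : B.Node) :
    {g | x ∈ B.touching g}.ncard ≤ k * Δ := by
  have eq_biUnion : {g | x ∈ B.touching g} =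
      ⋃ v ∈ B.bag x, {g : G.edgeSet | v ∈ (g : Sym2 V)} := by
    ext g
    simp [touching, and_comm]
  calc {g | x ∈ B.touching g}.ncard
      ≤ ∑ v ∈ B.bag x, {g : G.edgeSet | v ∈ (g : Sym2 V)}.ncard :=
        eq_biUnion ▸ Finset.set_ncard_biUnion_le _ _
    _ ≤ (B.bag x).card * Δ := Finset.sum_le_card_nsmul _ _ _ fun v _ => hΔ v
    _ ≤ k * Δ := Nat.mul_le_mul_right _ ((B.card_bag_le x).trans hk)

variable {B} {home : V → B.Node} (Λ : Layout B.graph home G.edgeSet)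

theorem exists_routing (hhome : ∀ v, v ∈ B.bag (home v)) :
    ∃ R : Routing G Λ.Point, ∀ g, ∀ s ∈ (R.walk g).edges,
      Λ.IsStrip g s ∨ ∃ x ∈ B.touching g, Λ.IsRay g x s := by
  obtain ⟨R, hR⟩ := Layout.exists_routing_of_reachable
    (fun g => Λ.host g (B.touching g) {v | v ∈ (g : Sym2 V)})
    (fun g s hs w hw => Layout.owner_eq_or_eq_vertex_of_mem_host hs hw) fun g v w hg => by
      have hv : v ∈ (g : Sym2 V) := hg ▸ Sym2.mem_mk_left _ _
      have hw : w ∈ (g : Sym2 V) := hg ▸ Sym2.mem_mk_right _ _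
      exact Layout.host_reachable_vertex (B.preconnected_induce_touching g) hv hw
        ⟨v, hv, hhome v⟩ ⟨w, hw, hhome w⟩
  exact ⟨R, fun g s hs => Layout.isStrip_or_isRay_of_mem_host (hR g s hs)⟩

variable {Λ}

/-- The steps of the routes that enter the disk of `x`. -/
noncomputable def entering (R : Routing G Λ.Point) (x : B.Node) : Set (Sym2 Λ.Point) :=
  ⋃ g ∈ {g | x ∈ B.touching g}, {s | s ∈ (R.walk g).edges ∧ hub g x ∈ s}

theorem ncard_entering_le [Finite V] {k Δ : ℕ} (hk : B.width ≤ k)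
    (hΔ : ∀ v, {g : G.edgeSet | v ∈ (g : Sym2 V)}.ncard ≤ Δ) (R : Routing G Λ.Point) (x : B.Node) :
    (entering R x).ncard ≤ k * Δ * 2 := by
  classical
  have ncard_le (g : G.edgeSet) : {s | s ∈ (R.walk g).edges ∧ hub g x ∈ s}.ncard ≤ 2 := by
    rw [show {s | s ∈ (R.walk g).edges ∧ hub g x ∈ s} =
      (((R.walk g).edges.filter (hub g x ∈ ·)).toFinset : Set (Sym2 Λ.Point)) by ext; simp,
      Set.ncard_coe_finset]
    exact (List.toFinset_card_le _).trans (length_filter_mem_edges_le_two (R.isPath g) _)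
  let T := (Set.toFinite {g | x ∈ B.touching g}).toFinset
  calc (entering R x).ncard
      = (⋃ g ∈ T, {s | s ∈ (R.walk g).edges ∧ hub g x ∈ s}).ncard := by simp [entering, T]
    _ ≤ ∑ g ∈ T, {s | s ∈ (R.walk g).edges ∧ hub g x ∈ s}.ncard := Finset.set_ncard_biUnion_le _ _
    _ ≤ T.card * 2 := Finset.sum_le_card_nsmul _ _ _ fun g _ => ncard_le g
    _ ≤ k * Δ * 2 := by
        gcongr
        rw [← Set.ncard_eq_toFinset_card]
        exact B.ncard_setOf_mem_touching_le hk hΔ x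

theorem meetings_subset {pos : Λ.Point → Plane} {R : Routing G Λ.Point}
    (hR : ∀ g, ∀ s ∈ (R.walk g).edges, Λ.IsStrip g s ∨ ∃ x ∈ B.touching g, Λ.IsRay g x s)
    (hpos : ∀ g h s t, (∀ w ∈ s, w ∉ t) → s ∈ (R.walk g).edges → t ∈ (R.walk h).edges →
      (¬ ∃ x, Λ.IsRay g x s ∧ Λ.IsRay h x t) → Disjoint (seg pos s) (seg pos t)) :
    R.meetings pos ⊆ ⋃ x, entering R x ×ˢ entering R x := by
  have mem_entering {g x s} (hs : s ∈ (R.walk g).edges) (hx : Λ.IsRay g x s) :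
      s ∈ entering R x := by
    rcases hR g s hs with h | ⟨y, hy, h⟩
    · exact (h.not_isRay hx).elim
    · exact Set.mem_biUnion (hx.eq h ▸ hy) ⟨hs, hx.hub_mem⟩
  rintro ⟨s, t⟩ ⟨g, h, -, hs, ht, hst, hnd⟩
  obtain ⟨x, hxs, hxt⟩ : ∃ x, Λ.IsRay g x s ∧ Λ.IsRay h x t := by
    by_contra hne
    exact hnd (hpos g h s t hst hs ht hne)
  exact Set.mem_iUnion.2 ⟨x, mem_entering hs hxs, mem_entering ht hxt⟩

theorem crossingNumber_le [Finite V] (hB : B.Planar) {k Δ : ℕ} (hk : B.width ≤ k)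
    (hΔ : ∀ v, {g : G.edgeSet | v ∈ (g : Sym2 V)}.ncard ≤ Δ) :
    G.crossingNumber ≤ ((B.order * (k * Δ * 2) ^ 2 : ℕ) : ℕ∞) := by
  let _ := B.fintypeNode
  obtain ⟨φ, hφ⟩ := hB
  have exists_home (v : V) : ∃ x, v ∈ B.bag x :=
    let ⟨x, hx⟩ := (B.connected v).nonempty
    ⟨x, hx⟩
  choose home hhome using exists_home
  obtain ⟨Λ⟩ := nonempty_layout (Γ := G.edgeSet) hφ home
  obtain ⟨ε, hε⟩ := Λ.exists_forall_disjoint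
  obtain ⟨R, hR⟩ := exists_routing Λ hhome
  have hpos (g h s t) (hst : ∀ w ∈ s, w ∉ t) (hs : s ∈ (R.walk g).edges)
      (ht : t ∈ (R.walk h).edges) : (¬ ∃ x, Λ.IsRay g x s ∧ Λ.IsRay h x t) →
        Disjoint (seg (Λ.pos ε) s) (seg (Λ.pos ε) t) :=
    hε g h s t hst ((hR g s hs).imp_right fun ⟨x, _, hx⟩ => ⟨x, hx⟩)
      ((hR h t ht).imp_right fun ⟨x, _, hx⟩ => ⟨x, hx⟩)
  have selfAvoiding : R.SelfAvoiding (Λ.pos ε) := fun g s hs t ht hst =>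
    hpos g g s t hst hs ht fun ⟨x, hxs, hxt⟩ => hst _ hxs.hub_mem hxt.hub_mem
  obtain ⟨ψ, hψ⟩ := selfAvoiding.exists_drawing
  refine (iInf_le _ ψ).trans (hψ.trans ?_)
  rw [← (Set.toFinite _).cast_ncard_eq, Nat.cast_le]
  calc (R.meetings (Λ.pos ε)).ncard
      ≤ (⋃ x ∈ (Finset.univ : Finset B.Node), entering R x ×ˢ entering R x).ncard :=
        Set.ncard_le_ncard (by simpa using meetings_subset hR hpos) (Set.toFinite _)
    _ ≤ ∑ x, (entering R x ×ˢ entering R x).ncard := Finset.set_ncard_biUnion_le _ _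
    _ ≤ (Finset.univ : Finset B.Node).card * (k * Δ * 2) ^ 2 :=
        Finset.sum_le_card_nsmul _ _ _ fun x _ => by
          rw [Set.ncard_prod, sq]
          exact Nat.mul_le_mul (ncard_entering_le hk hΔ R x) (ncard_entering_le hk hΔ R x)

end SimpleGraph.Decomposition

/-! ### Contractions of planar graphs -/

theorem exists_embedding_lt {Γ : Type*} [Countable Γ] (κ : Γ → ℝ) :
    ∃ σ : Γ ↪ ℝ, ∀ g h, κ g < κ h → σ g < σ h := by
  obtain ⟨num, num_injective⟩ := exists_injective_nat Γ
  let _ : LinearOrder Γ := LinearOrder.lift' (fun g => toLex (κ g, num g)) fun g h hgh =>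
    num_injective (congrArg (fun q => (ofLex q).2) hgh)
  obtain ⟨σ⟩ := Order.embedding_from_countable_to_dense Γ ℝ
  exact ⟨σ.toEmbedding, fun g h hgh => σ.lt_iff_lt.2 (Prod.Lex.toLex_lt_toLex.2 (.inl hgh))⟩

namespace Plane

section Slope

variable {E : Type*} [NormedAddCommGroup E] [InnerProductSpace ℝ E]

/-- The slope of the vector `v` in the plane of the orthogonal vectors `n` and `u`, the former being
the horizontal one. It is meant for vectors with `0 < inner ℝ v n`. -/
noncomputable def slope (n u v : E) : ℝ :=
  inner ℝ v u / inner ℝ v n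

theorem disjoint_segment_of_slope_le {n u q q' b b' : E} (hn : inner ℝ q n = inner ℝ q' n)
    (hu : inner ℝ q u < inner ℝ q' u) (hb : 0 < inner ℝ (b - q) n) (hb' : 0 < inner ℝ (b' - q') n)
    (hslope : slope n u (b - q) ≤ slope n u (b' - q')) :
    Disjoint (segment ℝ q b) (segment ℝ q' b') := by
  rw [Set.disjoint_left, segment_eq_image', segment_eq_image']
  rintro _ ⟨t, ⟨ht, -⟩, rfl⟩ ⟨t', -, heq⟩
  have horizontal_eq : t' * inner ℝ (b' - q') n = t * inner ℝ (b - q) n := by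
    have := congrArg (inner ℝ · n) heq
    simp only [inner_add_left, real_inner_smul_left, hn] at this
    linarith
  have rise_eq : inner ℝ q' u + t' * inner ℝ (b' - q') n * slope n u (b' - q') =
      inner ℝ q u + t * inner ℝ (b - q) n * slope n u (b - q) := by
    have := congrArg (inner ℝ · u) heq
    simp only [inner_add_left, real_inner_smul_left] at this
    rwa [mul_assoc, mul_assoc, slope, slope, mul_div_cancel₀ _ hb.ne', mul_div_cancel₀ _ hb'.ne']
  rw [horizontal_eq] at rise_eq
  have := mul_le_mul_of_nonneg_left hslope (mul_nonneg ht hb.le)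
  linarith

end Slope

theorem eq_zero_of_inner_eq_zero {n u w : Plane} (hn : n ≠ 0) (hu : u ≠ 0) (hun : inner ℝ u n = 0)
    (hwn : inner ℝ w n = 0) (hwu : inner ℝ w u = 0) : w = 0 := by
  have norm_pos : 0 < ‖n‖ ^ 2 * ‖u‖ ^ 2 := by positivity
  have : ‖w‖ ^ 2 * (‖n‖ ^ 2 * ‖u‖ ^ 2) = 0 := by
    simp only [← real_inner_self_eq_norm_sq, inner_eq] at *
    linear_combination (w 0 ^ 2 + w 1 ^ 2) * (u 0 * n 0 + u 1 * n 1) * hun +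
      (n 0 * u 1 - n 1 * u 0) * ((w 0 * u 1 - w 1 * u 0) * hwn + (w 1 * n 0 - w 0 * n 1) * hwu)
  exact norm_eq_zero.1 (pow_eq_zero_iff two_ne_zero |>.1 <|
    (mul_eq_zero.1 this).resolve_right norm_pos.ne')

/-- The slope is the coordinate of the stereographic projection from `p`. -/
theorem eq_of_slope_eq {p c u b b' : Plane} (hu : u ≠ 0) (hup : inner ℝ u (c - p) = 0)
    (hb : dist b c = dist p c) (hb' : dist b' c = dist p c) (hbp : b ≠ p) (hbp' : b' ≠ p)
    (h : slope (c - p) u (b - p) = slope (c - p) u (b' - p)) : b = b' := by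
  have sq_norm {b : Plane} (hb : dist b c = dist p c) :
      ‖b - p‖ ^ 2 = 2 * inner ℝ (b - p) (c - p) := by
    have := norm_sub_sq_real (b - p) (c - p)
    rw [sub_sub_sub_cancel_right, ← dist_eq_norm, hb, dist_comm, dist_eq_norm] at this
    linarith
  have hn : c - p ≠ 0 := by
    rintro hn
    rw [sub_eq_zero.1 hn, dist_self, dist_eq_zero] at hb
    exact hbp hb
  have pos := inner_sub_pos_of_mem_closedBall hb.le hbp
  have pos' := inner_sub_pos_of_mem_closedBall hb'.le hbp'
  set H := inner ℝ (b - p) (c - p)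
  set H' := inner ℝ (b' - p) (c - p)
  have smul_eq : H' • (b - p) = H • (b' - p) := by
    rw [← sub_eq_zero]
    refine eq_zero_of_inner_eq_zero hn hu hup ?_ ?_
    · rw [inner_sub_left, real_inner_smul_left, real_inner_smul_left, mul_comm, sub_self]
    · rw [slope, slope, div_eq_div_iff pos.ne' pos'.ne'] at h
      rw [inner_sub_left, real_inner_smul_left, real_inner_smul_left]
      linarith
  have H_eq : H' = H := by
    have := congrArg (‖·‖ ^ 2) smul_eq
    simp only [norm_smul, mul_pow, Real.norm_eq_abs, sq_abs, sq_norm hb, sq_norm hb'] at this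
    have : (H' - H) * (2 * H * H') = 0 := by linear_combination this
    exact sub_eq_zero.1 ((mul_eq_zero.1 this).resolve_right (by positivity))
  rw [H_eq] at smul_eq
  exact sub_left_injective (smul_right_injective _ pos.ne' smul_eq)

namespace Layout

open RoutePoint Filter Topology

variable {N V Γ : Type*} {D : SimpleGraph N} {home : V → N} {Λ : Layout D home Γ}
  {g h : Γ} {y : N} {w w' : Λ.Point} {e : D.edgeSet} {k : Fin (Λ.K + 1)} {k' : ℕ}

variable (Λ) in
/-- The slope at which the point `q` is seen from the end `k` of the line `e` at the disk of `y`. -/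
noncomputable def slopeAt (y : N) (e : D.edgeSet) (k : ℕ) (q : Plane) : ℝ :=
  slope (Λ.plan.center y - (Λ.plan.line e).p k) (Λ.offset.u e k) (q - (Λ.plan.line e).p k)

theorem inner_offset_center_sub {k k' : ℕ} (hk : Λ.plan.EndAt e y k k') :
    inner ℝ (Λ.offset.u e k) (Λ.plan.center y - (Λ.plan.line e).p k) = 0 := by
  rw [← neg_sub ((Λ.plan.line e).p k), inner_neg_right, hk.inner_offset, neg_zero]

theorem eq_of_slopeAt_eq {k k' : ℕ} {q q' : Plane} (hk : Λ.plan.EndAt e y k k')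
    (hq : dist q (Λ.plan.center y) = Λ.plan.R) (hq' : dist q' (Λ.plan.center y) = Λ.plan.R)
    (hne : q ≠ (Λ.plan.line e).p k) (hne' : q' ≠ (Λ.plan.line e).p k)
    (h : Λ.slopeAt y e k q = Λ.slopeAt y e k q') : q = q' :=
  eq_of_slope_eq (hk.offset_ne_zero Λ.offset) (inner_offset_center_sub hk)
    (hq.trans hk.dist_eq.symm) (hq'.trans hk.dist_eq.symm) hne hne' h

/-- Segments that fan out inside a disk from the copies of the end of a line are disjoint if the
copies are ordered as the slopes. -/
theorem eventually_disjoint_fan (hk : Λ.plan.EndAt e y k k') (hw : Λ.IsAt g y w)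
    (hw' : Λ.IsAt h y w') (hne : w ≠ bend g e k) (hne' : w' ≠ bend h e k)
    (hgh : Λ.shift g < Λ.shift h)
    (hslope : Λ.slopeAt y e k (Λ.pos 0 w) < Λ.slopeAt y e k (Λ.pos 0 w')) :
    ∀ᶠ ε in 𝓝[>] 0, Disjoint (seg (Λ.pos ε) s(bend g e k, w))
      (seg (Λ.pos ε) s(bend h e k, w')) := by
  set p := (Λ.plan.line e).p k
  set n := Λ.plan.center y - p
  set u := Λ.offset.u e k
  have inner_u_n : inner ℝ u n = 0 := inner_offset_center_sub hk
  have pos_zero (g : Γ) : Λ.pos 0 (bend g e k) = p := by simp [pos, p]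
  have cont_inner (w w' : Λ.Point) (v : Plane) :
      Continuous fun ε => inner ℝ (Λ.pos ε w - Λ.pos ε w') v :=
    ((continuous_pi_iff.1 continuous_pos w).sub
      (continuous_pi_iff.1 continuous_pos w')).inner continuous_const
  have inner_pos {g : Γ} {w : Λ.Point} (hw : Λ.IsAt g y w) (hne : w ≠ bend g e k) :
      0 < inner ℝ (Λ.pos 0 w - Λ.pos 0 (bend g e k)) n := pos_zero g ▸ hw.inner_pos hk hne
  have ev_pos {g : Γ} {w : Λ.Point} (hw : Λ.IsAt g y w) (hne : w ≠ bend g e k) :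
      ∀ᶠ ε in 𝓝 0, 0 < inner ℝ (Λ.pos ε w - Λ.pos ε (bend g e k)) n :=
    (cont_inner w _ n).continuousAt.eventually_const_lt (inner_pos hw hne)
  have cont_slope {g : Γ} {w : Λ.Point} (hw : Λ.IsAt g y w) (hne : w ≠ bend g e k) :
      ContinuousAt (fun ε => slope n u (Λ.pos ε w - Λ.pos ε (bend g e k))) 0 :=
    (cont_inner w _ u).continuousAt.div (cont_inner w _ n).continuousAt (inner_pos hw hne).ne'
  have ev_slope := (cont_slope hw hne).eventually_lt (cont_slope hw' hne')
    (by simpa only [pos_zero] using! hslope)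
  filter_upwards [((ev_pos hw hne).and ((ev_pos hw' hne').and ev_slope)).filter_mono
    nhdsWithin_le_nhds, self_mem_nhdsWithin] with ε ⟨hpos, hpos', hε⟩ hε0
  refine disjoint_segment_of_slope_le ?_ ?_ hpos hpos' hε.le
  · simp [pos, inner_add_left, real_inner_smul_left, inner_u_n, u]
  · have : ε * Λ.shift g * inner ℝ u u < ε * Λ.shift h * inner ℝ u u :=
      mul_lt_mul_of_pos_right (mul_lt_mul_of_pos_left hgh hε0)
        (real_inner_self_pos.2 (hk.offset_ne_zero Λ.offset))
    simpa only [pos, inner_add_left, real_inner_smul_left, add_lt_add_iff_left] using this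

end Layout

end Plane

/-- When the vertex `y` of `D` is contracted into `x`, the edge `g` of the result comes from the
edge `e` at `y`. -/
def IsRedirected {N : Type*} {D : SimpleGraph N} {y : N} (x : N) {H : SimpleGraph {z // z ≠ y}}
    (g : H.edgeSet) (e : D.edgeSet) : Prop :=
  ∃ b, (g : Sym2 {z // z ≠ y}).map Subtype.val = s(x, b) ∧ (e : Sym2 N) = s(y, b)

namespace IsRedirected

variable {N : Type*} {D : SimpleGraph N} {x y : N} {H : SimpleGraph {z // z ≠ y}}
  {g h : H.edgeSet} {e f : D.edgeSet}

theorem mem (hg : IsRedirected x g e) : y ∈ (e : Sym2 N) := by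
  obtain ⟨b, -, he⟩ := hg
  exact he ▸ Sym2.mem_mk_left _ _

theorem edge_unique (he : IsRedirected x g e) (hf : IsRedirected x g f) : e = f := by
  obtain ⟨b, hg, he⟩ := he
  obtain ⟨b', hg', hf⟩ := hf
  obtain rfl := Sym2.congr_right.1 (hg.symm.trans hg')
  exact Subtype.ext (he.trans hf.symm)

theorem unique (hg : IsRedirected x g e) (hh : IsRedirected x h e) : g = h := by
  obtain ⟨b, hg, he⟩ := hg
  obtain ⟨b', hh, he'⟩ := hh
  obtain rfl := Sym2.congr_right.1 (he.symm.trans he')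
  exact Subtype.ext (Sym2.map.injective Subtype.val_injective (hg.trans hh.symm))

theorem ne (hg : IsRedirected x g e) : (e : Sym2 N) ≠ s(x, y) := by
  obtain ⟨b, hg, he⟩ := hg
  intro hxy
  obtain rfl : b = x := Sym2.congr_right.1 (he.symm.trans (hxy.trans Sym2.eq_swap))
  exact H.not_isDiag_of_mem_edgeSet g.2
    ((Sym2.isDiag_map Subtype.val_injective).1 (hg ▸ Sym2.mk_isDiag_iff.2 rfl))

end IsRedirected

namespace Plane.Layout

open RoutePoint Filter Topology

variable {N : Type*} {D : SimpleGraph N} {x y : N} {H : SimpleGraph {z // z ≠ y}}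
  {Λ : Layout D (Subtype.val : {z // z ≠ y} → N) H.edgeSet}
  {g h : H.edgeSet} {s t : Sym2 Λ.Point} {w : Λ.Point} {z : N} {e e₀ : D.edgeSet}

/-- The steps from an end of the edge `g` to a line. -/
def IsSpoke (g : H.edgeSet) (z : N) (s : Sym2 Λ.Point) : Prop :=
  ∃ v ∈ (g : Sym2 {z // z ≠ y}), ∃ e, ∃ k : Fin (Λ.K + 1), ∃ k',
    z = v ∧ Λ.plan.EndAt e v k k' ∧ s = s(vertex v, bend g e k)

/-- The steps by which a redirected edge gets past `y`, from the line of the contracted edge to its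
own line. -/
def IsTurn (e₀ : D.edgeSet) (x : N) (g : H.edgeSet) (s : Sym2 Λ.Point) : Prop :=
  ∃ e, ∃ k₀ k : Fin (Λ.K + 1), ∃ k₀' k', IsRedirected x g e ∧ Λ.plan.EndAt e₀ y k₀ k₀' ∧
    Λ.plan.EndAt e y k k' ∧ s = s(bend g e₀ k₀, bend g e k)

theorem IsSpoke.isChord (hs : Λ.IsSpoke g z s) : Λ.IsChord g z s := by
  obtain ⟨v, -, e, k, k', rfl, hk, rfl⟩ := hs
  exact ⟨_, _, by simp, .vertex v, .bend hk, rfl⟩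

theorem IsSpoke.exists_mem (hs : Λ.IsSpoke g z s) : ∃ v : {z // z ≠ y}, z = v ∧ vertex v ∈ s := by
  obtain ⟨v, -, e, k, k', rfl, -, rfl⟩ := hs
  exact ⟨v, rfl, Sym2.mem_mk_left _ _⟩

theorem IsTurn.isChord (he₀ : (e₀ : Sym2 N) = s(x, y)) (hs : Λ.IsTurn e₀ x g s) :
    Λ.IsChord g y s := by
  obtain ⟨e, k₀, k, k₀', k', hg, hk₀, hk, rfl⟩ := hs
  refine ⟨_, _, fun h => ?_, .bend hk₀, .bend hk, rfl⟩
  exact hg.ne ((congrArg Subtype.val (RoutePoint.bend.inj h).2.1).symm.trans he₀)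

variable (Λ) in
/-- The slopes at which the redirected edges turn at `y` are ordered as their shifts. -/
def TurnsOrdered (e₀ : D.edgeSet) (x : N) : Prop :=
  ∀ g h e f (k₀ k l : Fin (Λ.K + 1)) (k₀' k' l' : ℕ), Λ.plan.EndAt e₀ y k₀ k₀' →
    IsRedirected x g e → Λ.plan.EndAt e y k k' → IsRedirected x h f → Λ.plan.EndAt f y l l' →
    Λ.slopeAt y e₀ k₀ ((Λ.plan.line e).p k) < Λ.slopeAt y e₀ k₀ ((Λ.plan.line f).p l) →
    Λ.shift g < Λ.shift h

theorem exists_turnsOrdered [Finite N] {φ : D.Drawing} (hφ : φ.crossings = ∅) (e₀ : D.edgeSet)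
    (hy : y ∈ (e₀ : Sym2 N)) :
    ∃ Λ : Layout D (Subtype.val : {z // z ≠ y} → N) H.edgeSet, Λ.TurnsOrdered e₀ x := by
  obtain ⟨Λ⟩ := nonempty_layout (Γ := H.edgeSet) hφ (Subtype.val : {z // z ≠ y} → N)
  obtain ⟨k₀, k₀', hk₀⟩ := Λ.exists_endAt e₀ hy
  have exists_slope (g : H.edgeSet) : ∃ κ, ∀ e (k : Fin (Λ.K + 1)) k', IsRedirected x g e →
      Λ.plan.EndAt e y k k' → Λ.slopeAt y e₀ k₀ ((Λ.plan.line e).p k) = κ := by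
    by_cases hg : ∃ e, IsRedirected (D := D) x g e
    · obtain ⟨e, hge⟩ := hg
      obtain ⟨k, k', hk⟩ := Λ.exists_endAt e hge.mem
      refine ⟨Λ.slopeAt y e₀ k₀ ((Λ.plan.line e).p k), fun f l l' hgf hl => ?_⟩
      obtain rfl := hge.edge_unique hgf
      rw [(hl.unique hk).1]
    · exact ⟨0, fun e _ _ hge => (hg ⟨e, hge⟩).elim⟩
  choose κ hκ using exists_slope
  obtain ⟨σ, hσ⟩ := exists_embedding_lt κ
  refine ⟨{ Λ with shift := σ }, fun g h e f l₀ k l l₀' k' l' hl₀ hg hk hh hl hlt => hσ g h ?_⟩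
  obtain ⟨heq, -⟩ := hk₀.unique hl₀
  rw [← hκ g e k k' hg hk, ← hκ h f l l' hh hl, heq]
  exact hlt

theorem IsTurn.eventually_disjoint (he₀ : (e₀ : Sym2 N) = s(x, y)) (hΛ : Λ.TurnsOrdered e₀ x)
    (hst : ∀ w ∈ s, w ∉ t) (hs : Λ.IsTurn e₀ x g s) (ht : Λ.IsTurn e₀ x h t) :
    ∀ᶠ ε in 𝓝[>] 0, Disjoint (seg (Λ.pos ε) s) (seg (Λ.pos ε) t) := by
  obtain ⟨e, k₀, k, k₀', k', hg, hk₀, hk, rfl⟩ := hs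
  obtain ⟨f, l₀, l, l₀', l', hh, hl₀, hl, rfl⟩ := ht
  obtain rfl := Fin.ext (hk₀.unique hl₀).1
  have hgh : g ≠ h := by
    rintro rfl
    exact hst _ (Sym2.mem_mk_left _ _) (Sym2.mem_mk_left _ _)
  have hef : e ≠ f := by
    rintro rfl
    exact hgh (hg.unique hh)
  have ne_e₀ {g : H.edgeSet} {e} (hg : IsRedirected x g e) : e ≠ e₀ := by
    rintro rfl
    exact hg.ne he₀
  have p_ne {e f : D.edgeSet} {k l : Fin (Λ.K + 1)} {k' l' : ℕ} (hef : e ≠ f)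
      (hk : Λ.plan.EndAt e y k k') (hl : Λ.plan.EndAt f y l l') :
      (Λ.plan.line e).p k ≠ (Λ.plan.line f).p l := fun h => hef (hk.edge_eq hl h)
  have bend_ne {g : H.edgeSet} {e : D.edgeSet} {k : Fin (Λ.K + 1)} (hg : IsRedirected x g e) :
      (bend g e k : Λ.Point) ≠ bend g e₀ k₀ := fun h => ne_e₀ hg (RoutePoint.bend.inj h).2.1
  have slope_ne : Λ.slopeAt y e₀ k₀ ((Λ.plan.line e).p k) ≠
      Λ.slopeAt y e₀ k₀ ((Λ.plan.line f).p l) :=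
    mt (eq_of_slopeAt_eq hk₀ hk.dist_eq hl.dist_eq (p_ne (ne_e₀ hg) hk hk₀)
      (p_ne (ne_e₀ hh) hl hk₀)) (p_ne hef hk hl)
  rcases slope_ne.lt_or_gt with hlt | hlt
  · exact eventually_disjoint_fan hk₀ (.bend hk) (.bend hl) (bend_ne hg) (bend_ne hh)
      (hΛ g h e f k₀ k l k₀' k' l' hk₀ hg hk hh hl hlt) (by simpa [pos] using hlt)
  · exact (eventually_disjoint_fan hk₀ (.bend hl) (.bend hk) (bend_ne hh) (bend_ne hg)
      (hΛ h g f e k₀ l k k₀' l' k' hk₀ hh hl hg hk hlt) (by simpa [pos] using hlt)).mono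
      fun _ h => h.symm

variable (Λ) in
/-- The steps at the disposal of the edge `g` of the contraction of the line `e₀` into `x`. -/
def IsContractionStep (e₀ : D.edgeSet) (x : N) (g : H.edgeSet) (s : Sym2 Λ.Point) : Prop :=
  Λ.IsStrip g s ∨ (∃ z, Λ.IsSpoke g z s) ∨ Λ.IsTurn e₀ x g s

theorem eventually_disjoint_of_isContractionStep (he₀ : (e₀ : Sym2 N) = s(x, y))
    (hΛ : Λ.TurnsOrdered e₀ x) (hst : ∀ w ∈ s, w ∉ t) (hs : Λ.IsContractionStep e₀ x g s)
    (ht : Λ.IsContractionStep e₀ x h t) :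
    ∀ᶠ ε in 𝓝[>] 0, Disjoint (seg (Λ.pos ε) s) (seg (Λ.pos ε) t) := by
  have hts : ∀ w ∈ t, w ∉ s := fun w hw hw' => hst w hw' hw
  have of_ne {s t : Sym2 Λ.Point}
      (h : ∀ᶠ ε in 𝓝[≠] 0, Disjoint (seg (Λ.pos ε) s) (seg (Λ.pos ε) t)) :
      ∀ᶠ ε in 𝓝[>] 0, Disjoint (seg (Λ.pos ε) s) (seg (Λ.pos ε) t) :=
    h.filter_mono (nhdsWithin_mono _ fun _ hε => ne_of_gt hε)
  have spoke_turn {g h s t z} (hs : Λ.IsSpoke g z s) (ht : Λ.IsTurn e₀ x h t) :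
      ∀ᶠ ε in 𝓝[>] 0, Disjoint (seg (Λ.pos ε) s) (seg (Λ.pos ε) t) := by
    obtain ⟨v, rfl, -⟩ := hs.exists_mem
    exact of_ne (eventually_disjoint_chord_chord v.2 hs.isChord (ht.isChord he₀))
  rcases hs with hs | ⟨z, hs⟩ | hs <;> rcases ht with ht | ⟨z', ht⟩ | ht
  · exact of_ne (eventually_disjoint_strip_strip hst hs ht)
  · exact of_ne (eventually_disjoint_strip_chord hst hs ht.isChord)
  · exact of_ne (eventually_disjoint_strip_chord hst hs (ht.isChord he₀))
  · exact (of_ne (eventually_disjoint_strip_chord hts ht hs.isChord)).mono fun _ h => h.symm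
  · refine of_ne (eventually_disjoint_chord_chord ?_ hs.isChord ht.isChord)
    rintro rfl
    obtain ⟨v, rfl, hv⟩ := hs.exists_mem
    obtain ⟨v', hvv', hv'⟩ := ht.exists_mem
    exact hst _ hv (Subtype.ext hvv' ▸ hv')
  · exact spoke_turn hs ht
  · exact (of_ne (eventually_disjoint_strip_chord hts ht (hs.isChord he₀))).mono
      fun _ h => h.symm
  · exact (spoke_turn ht hs).mono fun _ h => h.symm
  · exact IsTurn.eventually_disjoint he₀ hΛ hst hs ht

variable (Λ) in
/-- The graph of the steps at the disposal of the edge `g` of the contraction. -/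
def contractionHost (e₀ : D.edgeSet) (x : N) (g : H.edgeSet) : SimpleGraph Λ.Point :=
  .fromEdgeSet {s | Λ.IsContractionStep e₀ x g s}

theorem owner_eq_or_of_mem_contractionHost (hs : s ∈ (Λ.contractionHost e₀ x g).edgeSet)
    (hw : w ∈ s) : w.owner = some g ∨ ∃ v ∈ (g : Sym2 {z // z ≠ y}), w = vertex v := by
  rw [contractionHost, SimpleGraph.edgeSet_fromEdgeSet] at hs
  rcases hs.1 with hs | ⟨z, v, hv, e, k, k', -, -, rfl⟩ | ⟨e, k₀, k, k₀', k', -, -, -, rfl⟩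
  · exact .inl (hs.owner_eq hw)
  · rcases Sym2.mem_iff.1 hw with rfl | rfl
    · exact .inr ⟨v, hv, rfl⟩
    · exact .inl rfl
  · rcases Sym2.mem_iff.1 hw with rfl | rfl <;> exact .inl rfl

theorem mem_edgeSet_contractionHost_of_isStrip (s : Sym2 Λ.Point) (hs : Λ.IsStrip g s) :
    s ∈ (Λ.contractionHost e₀ x g).edgeSet := by
  rw [contractionHost, SimpleGraph.edgeSet_fromEdgeSet]
  exact ⟨.inl hs, hs.not_isDiag⟩

theorem contractionHost_adj_vertex_bend {v : {z // z ≠ y}} {k : Fin (Λ.K + 1)} {k' : ℕ}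
    (hv : v ∈ (g : Sym2 {z // z ≠ y})) (hk : Λ.plan.EndAt e v k k') :
    (Λ.contractionHost e₀ x g).Adj (vertex v) (bend g e k) := by
  rw [contractionHost, SimpleGraph.fromEdgeSet_adj]
  exact ⟨.inr (.inl ⟨v, v, hv, e, k, k', rfl, hk, rfl⟩), by simp⟩

theorem contractionHost_adj_bend_bend (he₀ : (e₀ : Sym2 N) = s(x, y)) {k₀ k : Fin (Λ.K + 1)}
    {k₀' k' : ℕ} (hg : IsRedirected x g e) (hk₀ : Λ.plan.EndAt e₀ y k₀ k₀')
    (hk : Λ.plan.EndAt e y k k') :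
    (Λ.contractionHost e₀ x g).Adj (bend g e₀ k₀) (bend g e k) := by
  rw [contractionHost, SimpleGraph.fromEdgeSet_adj]
  refine ⟨.inr (.inr ⟨e, k₀, k, k₀', k', hg, hk₀, hk, rfl⟩), fun h => ?_⟩
  exact hg.ne (congrArg Subtype.val (RoutePoint.bend.inj h).2.1 ▸ he₀)

theorem contractionHost_reachable_of_adj {a b : {z // z ≠ y}} (hab : D.Adj a b)
    (hg : (g : Sym2 {z // z ≠ y}) = s(a, b)) :
    (Λ.contractionHost e₀ x g).Reachable (vertex a) (vertex b) := by
  obtain ⟨k, k', hk⟩ := Λ.exists_endAt ⟨s((a : N), (b : N)), hab⟩ (Sym2.mem_mk_left _ _)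
  obtain ⟨l, l', hl⟩ := Λ.exists_endAt ⟨s((a : N), (b : N)), hab⟩ (Sym2.mem_mk_right _ _)
  exact ((contractionHost_adj_vertex_bend (hg ▸ Sym2.mem_mk_left _ _) hk).reachable.trans
    (reachable_of_endAt mem_edgeSet_contractionHost_of_isStrip hk hl)).trans
    (contractionHost_adj_vertex_bend (hg ▸ Sym2.mem_mk_right _ _) hl).reachable.symm

theorem contractionHost_reachable_of_redirected (he₀ : (e₀ : Sym2 N) = s(x, y))
    {a b : {z // z ≠ y}} (hax : a = x) (hyb : D.Adj y b)
    (hg : (g : Sym2 {z // z ≠ y}) = s(a, b)) :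
    (Λ.contractionHost e₀ x g).Reachable (vertex a) (vertex b) := by
  have hge : IsRedirected x g (⟨s(y, b), hyb⟩ : D.edgeSet) :=
    ⟨b, by simp [hg, hax], rfl⟩
  obtain ⟨k, k', hk⟩ := Λ.exists_endAt (x := (a : N)) e₀ (by simp [he₀, hax])
  obtain ⟨l, l', hl⟩ := Λ.exists_endAt (x := y) e₀ (by simp [he₀])
  obtain ⟨m, m', hm⟩ := Λ.exists_endAt ⟨s(y, (b : N)), hyb⟩ (Sym2.mem_mk_left _ _)
  obtain ⟨n, n', hn⟩ := Λ.exists_endAt ⟨s(y, (b : N)), hyb⟩ (Sym2.mem_mk_right _ _)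
  have strips := mem_edgeSet_contractionHost_of_isStrip (Λ := Λ) (e₀ := e₀) (x := x) (g := g)
  exact ((contractionHost_adj_vertex_bend (hg ▸ Sym2.mem_mk_left _ _) hk).reachable.trans
    (reachable_of_endAt strips hk hl)).trans
    ((contractionHost_adj_bend_bend he₀ hge hl hm).reachable.trans
    ((reachable_of_endAt strips hm hn).trans
    (contractionHost_adj_vertex_bend (hg ▸ Sym2.mem_mk_right _ _) hn).reachable.symm))

end Plane.Layout

namespace SimpleGraph

open Plane Filter Topology

theorem IsPlanar.contract_edge {N : Type*} [Finite N] {D : SimpleGraph N} (hD : D.IsPlanar)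
    {x y : N} (hxy : D.Adj x y) (H : SimpleGraph {z // z ≠ y})
    (hH : ∀ a b, H.Adj a b → D.Adj a b ∨ (a.1 = x ∧ D.Adj y b) ∨ (b.1 = x ∧ D.Adj y a)) :
    H.IsPlanar := by
  obtain ⟨φ, hφ⟩ := hD
  let e₀ : D.edgeSet := ⟨s(x, y), hxy⟩
  obtain ⟨Λ, hΛ⟩ := Layout.exists_turnsOrdered (x := x) (H := H) hφ e₀ (Sym2.mem_mk_right x y)
  have reachable (g : H.edgeSet) (a b) (hg : (g : Sym2 {z // z ≠ y}) = s(a, b)) :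
      (Λ.contractionHost e₀ x g).Reachable (.vertex a) (.vertex b) := by
    have hab : H.Adj a b := by simpa [hg] using g.2
    rcases hH a b hab with h | ⟨ha, h⟩ | ⟨hb, h⟩
    · exact Layout.contractionHost_reachable_of_adj h hg
    · exact Layout.contractionHost_reachable_of_redirected rfl ha h hg
    · exact (Layout.contractionHost_reachable_of_redirected rfl hb h (hg.trans Sym2.eq_swap)).symm
  obtain ⟨R, hR⟩ := Layout.exists_routing_of_reachable _
    (fun g s hs w hw => Layout.owner_eq_or_of_mem_contractionHost hs hw) reachable
  have step {g s} (hs : s ∈ (R.walk g).edges) : Λ.IsContractionStep e₀ x g s := by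
    have := hR g s hs
    rw [Layout.contractionHost, edgeSet_fromEdgeSet] at this
    exact this.1
  obtain ⟨ε, hε⟩ : ∃ ε, ∀ (g h : H.edgeSet) (s t : Sym2 Λ.Point), (∀ w ∈ s, w ∉ t) →
      Λ.IsContractionStep e₀ x g s → Λ.IsContractionStep e₀ x h t →
      Disjoint (seg (Λ.pos ε) s) (seg (Λ.pos ε) t) := by
    apply Eventually.exists (f := 𝓝[>] 0)
    simp only [eventually_all]
    exact fun g h s t hst hs ht =>
      Layout.eventually_disjoint_of_isContractionStep rfl hΛ hst hs ht
  have selfAvoiding : R.SelfAvoiding (Λ.pos ε) := fun g s hs t ht hst =>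
    hε g g s t hst (step hs) (step ht)
  have meetings_eq : R.meetings (Λ.pos ε) = ∅ := Set.eq_empty_of_forall_notMem
    fun ⟨s, t⟩ ⟨g, h, _, hs, ht, hst, hnd⟩ => hnd (hε g h s t hst (step hs) (step ht))
  obtain ⟨ψ, hψ⟩ := selfAvoiding.exists_drawing
  exact ⟨ψ, Set.encard_eq_zero.1 (le_antisymm (by simpa [meetings_eq] using hψ) bot_le)⟩

end SimpleGraph

theorem reachable_of_forall_adj {α β : Type*} {G : SimpleGraph α} {H : SimpleGraph β} (r : α → β)
    (hr : ∀ a b, G.Adj a b → H.Reachable (r a) (r b)) {a b : α} (h : G.Reachable a b) :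
    H.Reachable (r a) (r b) := by
  simp only [SimpleGraph.reachable_iff_reflTransGen] at hr h ⊢
  exact h.lift' r hr

theorem preconnected_of_surjective {α β : Type*} {G : SimpleGraph α} {H : SimpleGraph β} {r : α → β}
    (hsurj : Function.Surjective r) (hr : ∀ a b, G.Adj a b → H.Reachable (r a) (r b))
    (h : G.Preconnected) : H.Preconnected :=
  hsurj.forall₂.2 fun a b => reachable_of_forall_adj r hr (h a b)

theorem exists_embedding_extending {α β X : Type*} [Countable β] (f : α ↪ β) (p : α ↪ X)
    {C : Set X} (hC : Cᶜ.Infinite) (hp : ∀ a, p a ∈ C) :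
    ∃ q : β ↪ X, (∀ a, q (f a) = p a) ∧ ∀ b ∉ Set.range f, q b ∉ C := by
  have := hC.to_subtype
  obtain ⟨num, hnum⟩ := exists_injective_nat β
  let g (b : β) : (Cᶜ : Set X) := Infinite.natEmbedding _ (num b)
  have hg : Function.Injective g := (Infinite.natEmbedding _).injective.comp hnum
  let q : β → X := Function.extend f p fun b => (g b : X)
  have q_apply (a) : q (f a) = p a := f.injective.extend_apply ..
  have q_of_notMem {b} (hb : b ∉ Set.range f) : q b = g b := Function.extend_apply' _ _ _ hb
  refine ⟨⟨q, fun a b hab => ?_⟩, q_apply, fun b hb => (q_of_notMem hb).symm ▸ (g b).2⟩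
  by_cases ha : a ∈ Set.range f <;> by_cases hb : b ∈ Set.range f
  · obtain ⟨⟨a, rfl⟩, b, rfl⟩ := And.intro ha hb
    rw [q_apply, q_apply] at hab
    rw [p.injective hab]
  · obtain ⟨a, rfl⟩ := ha
    exact ((g b).2 (q_of_notMem hb ▸ hab ▸ q_apply a ▸ hp a)).elim
  · obtain ⟨b, rfl⟩ := hb
    exact ((g a).2 (q_of_notMem ha ▸ hab.symm ▸ q_apply b ▸ hp b)).elim
  · rw [q_of_notMem ha, q_of_notMem hb] at hab
    exact hg (Subtype.ext hab)

open Classical in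
/-- The map onto the complement of the vertex `z` that merges `z` into `x`. -/
noncomputable def mergeInto {N : Type*} {x z : N} (hxz : x ≠ z) (w : N) : {w // w ≠ z} :=
  if hw : w = z then ⟨x, hxz⟩ else ⟨w, hw⟩

section MergeInto

variable {N : Type*} {x z : N} (hxz : x ≠ z)

theorem mergeInto_self : mergeInto hxz z = ⟨x, hxz⟩ :=
  dif_pos rfl

theorem mergeInto_coe (w : {w // w ≠ z}) : mergeInto hxz w = w :=
  dif_neg w.2

theorem apply_mergeInto {α : Type*} {f : N → α} (hf : f z = f x) (w : N) :
    f (mergeInto hxz w) = f w := by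
  by_cases hw : w = z
  · rw [hw, mergeInto_self, hf]
  · exact congrArg f (congrArg Subtype.val (mergeInto_coe hxz ⟨w, hw⟩))

theorem preconnected_induce_map_mergeInto {N' : Type*} {D : SimpleGraph N} {f : N → N'}
    (hf : f z = f x) {a : N'} (h : (D.induce (f ⁻¹' {a})).Preconnected) :
    ((D.map (mergeInto hxz)).induce ((fun w => f w.1) ⁻¹' {a})).Preconnected := by
  let r (w : f ⁻¹' {a}) : (fun w : {w // w ≠ z} => f w) ⁻¹' {a} :=
    ⟨mergeInto hxz w, (apply_mergeInto hxz hf w).trans w.2⟩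
  have r_surjective : Function.Surjective r := fun u =>
    ⟨⟨u, u.2⟩, Subtype.ext (mergeInto_coe hxz u)⟩
  refine preconnected_of_surjective r_surjective (fun u v huv => ?_) h
  by_cases huv' : r u = r v
  · exact huv' ▸ SimpleGraph.Reachable.rfl
  · exact SimpleGraph.Adj.reachable ⟨fun h => huv' (Subtype.ext h), u, v, huv, rfl, rfl⟩

end MergeInto

namespace SimpleGraph

variable {N N' : Type*} {D : SimpleGraph N}

theorem Drawing.isCompact_arc (φ : D.Drawing) (e : D.edgeSet) : IsCompact (φ.arc e) := by
  obtain ⟨⟨x, y⟩, he⟩ := e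
  exact IsArc.isCompact (φ.arc_simple x y he)

theorem Drawing.exists_of_mem_arc {φ : D.Drawing} (hφ : φ.crossings = ∅) {e f : D.edgeSet}
    (hef : e ≠ f) {p : EuclideanSpace ℝ (Fin 2)} (he : p ∈ φ.arc e) (hf : p ∈ φ.arc f) :
    ∃ v, p = φ.point v ∧ v ∈ (e : Sym2 N) ∧ v ∈ (f : Sym2 N) := by
  by_contra h
  exact (hφ ▸ show p ∈ φ.crossings from ⟨e, f, hef, he, hf, h⟩ : p ∈ (∅ : Set _))

theorem IsPlanar.of_arcs {point : N → EuclideanSpace ℝ (Fin 2)}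
    (hpoint : Function.Injective point) {arc : D.edgeSet → Set (EuclideanSpace ℝ (Fin 2))}
    (harc : ∀ v w (h : D.Adj v w), IsArc (point v) (point w) (arc ⟨s(v, w), h⟩))
    (hmem : ∀ e v, point v ∈ arc e → v ∈ (e : Sym2 N))
    (hcross : ∀ e f, e ≠ f → ∀ p ∈ arc e, p ∈ arc f → ∃ v, p = point v) :
    D.IsPlanar := by
  refine ⟨⟨point, hpoint, arc, harc, hmem, ?_⟩, ?_⟩
  · rintro e f g hef - - p ⟨⟨he, hf⟩, hg⟩
    obtain ⟨v, rfl⟩ := hcross e f hef p he hf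
    exact ⟨v, rfl, hmem e v he, hmem f v hf, hmem g v hg⟩
  · refine Set.eq_empty_of_forall_notMem fun p ⟨e, f, hef, he, hf, h⟩ => ?_
    obtain ⟨v, rfl⟩ := hcross e f hef p he hf
    exact h ⟨v, rfl, hmem e v he, hmem f v hf⟩

theorem IsPlanar.of_isContained {D' : SimpleGraph N'} (hD : D.IsPlanar) (h : D' ⊑ D) :
    D'.IsPlanar := by
  obtain ⟨φ, hφ⟩ := hD
  obtain ⟨f⟩ := h
  refine .of_arcs (φ.point_injective.comp f.injective) (arc := fun e => φ.arc (f.mapEdgeSet e))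
    (fun v w hvw => φ.arc_simple _ _ (f.toHom.map_adj hvw)) (fun e v hv => ?_) ?_
  · obtain ⟨u, hu, huv⟩ := Sym2.mem_map.1 (φ.mem_of_point_mem_arc _ _ hv)
    exact f.injective huv ▸ hu
  · intro e e' hee p he he'
    obtain ⟨v, rfl, hv, -⟩ := Drawing.exists_of_mem_arc hφ (f.mapEdgeSet.injective.ne hee) he he'
    obtain ⟨u, -, rfl⟩ := Sym2.mem_map.1 hv
    exact ⟨u, rfl⟩

theorem IsPlanar.mono {D' : SimpleGraph N} (hD : D.IsPlanar) (h : D' ≤ D) : D'.IsPlanar :=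
  hD.of_isContained (.of_le h)

/- The vertices outside the range of `f` are isolated: place them off the drawing of `D`. -/
theorem IsPlanar.map [Finite N] [Countable N'] (hD : D.IsPlanar) (f : N ↪ N') :
    (D.map f).IsPlanar := by
  obtain ⟨φ, hφ⟩ := hD
  let C : Set (EuclideanSpace ℝ (Fin 2)) := (⋃ e, φ.arc e) ∪ Set.range φ.point
  have hC : IsCompact C :=
    (isCompact_iUnion fun e => φ.isCompact_arc e).union (Set.finite_range _).isCompact
  have infinite_compl : Cᶜ.Infinite := fun hfin =>
    noncompact_univ _ (Set.union_compl_self C ▸ hC.union hfin.isCompact)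
  obtain ⟨point, hpoint, point_notMem⟩ := exists_embedding_extending f
    ⟨φ.point, φ.point_injective⟩ infinite_compl fun v => .inr ⟨v, rfl⟩
  have hedge (e : (D.map f).edgeSet) : ∃ e' : D.edgeSet, (e' : Sym2 N).map f = e := by
    obtain ⟨e', he', h⟩ : (e : Sym2 N') ∈ Sym2.map f '' D.edgeSet := edgeSet_map f D ▸ e.2
    exact ⟨⟨e', he'⟩, h⟩
  choose i hi using hedge
  refine .of_arcs point.injective (arc := fun e => φ.arc (i e)) ?_ ?_ ?_
  · intro a b hab
    obtain ⟨-, x, y, hxy, rfl, rfl⟩ := id hab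
    have hixy : i ⟨s(f x, f y), hab⟩ = ⟨s(x, y), hxy⟩ :=
      Subtype.ext (Sym2.map.injective f.injective (hi _))
    rw [hixy, hpoint, hpoint]
    exact φ.arc_simple x y hxy
  · intro e a ha
    by_cases hx : a ∈ Set.range f
    · obtain ⟨x, rfl⟩ := hx
      rw [hpoint] at ha
      rw [← hi e]
      exact Sym2.mem_map.2 ⟨x, φ.mem_of_point_mem_arc _ _ ha, rfl⟩
    · exact (point_notMem a hx (.inl (Set.mem_iUnion.2 ⟨_, ha⟩))).elim
  · intro e e' hee p hp hp'
    have hne : i e ≠ i e' := fun h => hee (Subtype.ext (by rw [← hi e, ← hi e', h]))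
    obtain ⟨v, rfl, -⟩ := Drawing.exists_of_mem_arc hφ hne hp hp'
    exact ⟨f v, (hpoint v).symm⟩

theorem IsPlanar.map_of_injOn_support [Finite N] [Countable N'] (hD : D.IsPlanar) {f : N → N'}
    (hf : Set.InjOn f D.support) : (D.map f).IsPlanar := by
  refine ((hD.of_isContained ⟨Copy.induce D D.support⟩).map
    ⟨fun x => f x, hf.injective⟩).mono ?_
  rintro _ _ ⟨hne, u, v, huv, rfl, rfl⟩
  exact ⟨hne, ⟨u, huv.mem_support_left⟩, ⟨v, huv.mem_support_right⟩, huv, rfl, rfl⟩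

theorem IsPlanar.map_mergeInto [Finite N] (hD : D.IsPlanar) {x z : N} (hxz : D.Adj x z) :
    (D.map (mergeInto hxz.ne)).IsPlanar := by
  refine hD.contract_edge hxz _ ?_
  rintro _ _ ⟨-, u, v, huv, rfl, rfl⟩
  by_cases hu : u = z <;> by_cases hv : v = z
  · exact (huv.ne (hu.trans hv.symm)).elim
  · subst hu
    exact .inr (.inl ⟨congrArg Subtype.val (mergeInto_self _), mergeInto_coe _ ⟨v, hv⟩ ▸ huv⟩)
  · subst hv
    exact .inr (.inr ⟨congrArg Subtype.val (mergeInto_self _),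
      mergeInto_coe _ ⟨u, hu⟩ ▸ huv.symm⟩)
  · exact .inl (by rwa [mergeInto_coe _ ⟨u, hu⟩, mergeInto_coe _ ⟨v, hv⟩])

/- While `f` is not injective, one of its fibers contains an edge; contract it. -/
theorem IsPlanar.map_of_preconnected_fibers [Finite N] [Countable N'] (hD : D.IsPlanar)
    (f : N → N') (hf : ∀ a, (D.induce (f ⁻¹' {a})).Preconnected) : (D.map f).IsPlanar := by
  induction hn : Nat.card N generalizing N with
  | zero =>
    have := (Nat.card_eq_zero.1 hn).resolve_right (not_infinite_iff_finite.2 ‹_›)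
    exact hD.map ⟨f, Function.injective_of_subsingleton f⟩
  | succ n ih =>
    by_cases hinj : Function.Injective f
    · exact hD.map ⟨f, hinj⟩
    obtain ⟨x, z, hxz, hfz⟩ : ∃ x z, D.Adj x z ∧ f z = f x := by
      obtain ⟨x, y, hxy, hne⟩ := Function.not_injective_iff.1 hinj
      obtain ⟨p⟩ := hf (f x) ⟨x, rfl⟩ ⟨y, hxy.symm⟩
      cases p with
      | nil => exact (hne rfl).elim
      | @cons _ z _ h _ => exact ⟨x, z, h, z.2⟩
    have card_eq : Nat.card {w // w ≠ z} = n := by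
      classical
      have := Nat.card_congr (Equiv.optionSubtypeNe z)
      rw [Finite.card_option] at this
      omega
    refine (ih (hD.map_mergeInto hxz) (fun w => f w)
      (fun a => preconnected_induce_map_mergeInto hxz.ne hfz (hf a)) card_eq).mono ?_
    rintro _ _ ⟨hne, u, v, huv, rfl, rfl⟩
    have f_merge := apply_mergeInto hxz.ne hfz
    refine ⟨hne, _, _, ⟨fun h => hne ?_, u, v, huv, rfl, rfl⟩, f_merge u, f_merge v⟩
    rw [← f_merge u, ← f_merge v, h]

end SimpleGraph

/-! ### Partitions into connected parts -/

section Branch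

variable {N : Type*} {D : SimpleGraph N} {A C : Set N} {a v w z : N}

theorem exists_adj_of_preconnected_induce (hC : (D.induce C).Preconnected) {S : Set N}
    (hv : v ∈ C ∩ S) (hw : w ∈ C \ S) : ∃ x ∈ C ∩ S, ∃ y ∈ C \ S, D.Adj x y := by
  obtain ⟨p⟩ := hC ⟨v, hv.1⟩ ⟨w, hw.1⟩
  obtain ⟨d, -, hfst, hsnd⟩ := p.exists_boundary_dart (Subtype.val ⁻¹' S) hv.2 hw.2
  exact ⟨d.fst, ⟨d.fst.2, hfst⟩, d.snd, ⟨d.snd.2, hsnd⟩, d.adj⟩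

/-- The vertex set of the component of `z` in the subgraph of `D` induced on `A`. -/
def branch (D : SimpleGraph N) (A : Set N) (z : N) : Set N :=
  {w | ∃ p : D.Walk z w, ∀ u ∈ p.support, u ∈ A}

theorem mem_branch_self (hz : z ∈ A) : z ∈ branch D A z :=
  ⟨.nil, by simpa using hz⟩

theorem branch_subset : branch D A z ⊆ A :=
  fun _ ⟨p, hp⟩ => hp _ p.end_mem_support

theorem mem_of_mem_branch (h : w ∈ branch D A z) : z ∈ A :=
  let ⟨p, hp⟩ := h
  hp _ p.start_mem_support

theorem mem_branch_comm : w ∈ branch D A z ↔ z ∈ branch D A w :=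
  have symm {z w} : w ∈ branch D A z → z ∈ branch D A w := fun ⟨p, hp⟩ =>
    ⟨p.reverse, by simpa using hp⟩
  ⟨symm, symm⟩

theorem mem_branch_trans (hv : v ∈ branch D A z) (hw : w ∈ branch D A v) : w ∈ branch D A z := by
  obtain ⟨⟨p, hp⟩, q, hq⟩ := And.intro hv hw
  refine ⟨p.append q, fun u hu => ?_⟩
  rw [SimpleGraph.Walk.mem_support_append_iff] at hu
  exact hu.elim (hp u) (hq u)

theorem mem_branch_of_adj (hw : w ∈ branch D A z) (h : D.Adj w v) (hv : v ∈ A) :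
    v ∈ branch D A z :=
  mem_branch_trans hw ⟨h.toWalk, by simp [branch_subset hw, hv]⟩

theorem connected_induce_branch (hz : z ∈ A) : (D.induce (branch D A z)).Connected := by
  classical
  refine SimpleGraph.induce_connected_of_patches z (mem_branch_self hz) fun {w} ⟨p, hp⟩ => ?_
  refine ⟨{u | u ∈ p.support}, fun u hu => ?_, p.start_mem_support, p.end_mem_support,
    p.connected_induce_support _ _⟩
  exact ⟨p.takeUntil u hu, fun x hx => hp x (p.support_takeUntil_subset_support hu hx)⟩

theorem exists_mem_branch_adj (hA : (D.induce A).Preconnected) (ha : a ∈ A)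
    (hz : z ∈ A \ {a}) : ∃ w ∈ branch D (A \ {a}) z, D.Adj w a := by
  obtain ⟨w, hw, v, hv, hwv⟩ := exists_adj_of_preconnected_induce hA
    ⟨hz.1, mem_branch_self hz⟩ ⟨ha, fun h => (branch_subset h).2 rfl⟩
  obtain rfl : v = a := by
    by_contra hva
    exact hv.2 (mem_branch_of_adj hw.2 hwv ⟨hv.1, hva⟩)
  exact ⟨w, hw.2, hwv⟩

/- The remaining branches of `A` at `a`, as well as `C \ A`, hang on `a`. -/
theorem connected_induce_diff_branch (hAC : A ⊆ C) (hA : (D.induce A).Preconnected)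
    (hCA : (D.induce (C \ A)).Preconnected) (ha : a ∈ A)
    (hab : (C \ A).Nonempty → ∃ b ∈ C \ A, D.Adj a b) :
    (D.induce (C \ branch D (A \ {a}) z)).Connected := by
  have ha' : a ∈ C \ branch D (A \ {a}) z := ⟨hAC ha, fun h => (branch_subset h).2 rfl⟩
  have patch {S : Set N} (hS : S ⊆ C \ branch D (A \ {a}) z) (hconn : (D.induce S).Preconnected)
      {b} (hb : b ∈ S) (hab : D.Adj a b) {v} (hv : v ∈ S) :
      ∃ S' ⊆ C \ branch D (A \ {a}) z, ∃ (ha : a ∈ S') (hv : v ∈ S'),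
        (D.induce S').Reachable ⟨a, ha⟩ ⟨v, hv⟩ :=
    ⟨{a} ∪ S, Set.union_subset (Set.singleton_subset_iff.2 ha') hS, .inl rfl, .inr hv,
      SimpleGraph.connected_induce_union .of_subsingleton hconn (Set.mem_singleton a) hb hab _ _⟩
  refine SimpleGraph.induce_connected_of_patches a ha' fun {v} hv => ?_
  by_cases hvA : v ∈ A
  · by_cases hva : v = a
    · exact ⟨{a}, Set.singleton_subset_iff.2 ha', rfl, hva, by
        simp only [hva, SimpleGraph.Reachable.rfl]⟩
    · have hv' : v ∈ A \ {a} := ⟨hvA, hva⟩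
      obtain ⟨w, hw, hwa⟩ := exists_mem_branch_adj hA ha hv'
      refine patch (fun u hu => ⟨hAC (branch_subset hu).1, fun hu' => hv.2 ?_⟩)
        (connected_induce_branch hv').preconnected hw hwa.symm (mem_branch_self hv')
      exact mem_branch_trans hu' (mem_branch_comm.1 hu)
  · obtain ⟨b, hb, hab⟩ := hab ⟨v, hv.1, hvA⟩
    exact patch (fun u hu => ⟨hu.1, fun hu' => hu.2 (branch_subset hu').1⟩) hCA hb hab ⟨hv.1, hvA⟩

theorem ncard_le_of_ncard_branch_le [Finite N] {d m : ℕ} (hA : (D.induce A).Preconnected)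
    (ha : a ∈ A) (hd : (D.neighborSet a).ncard ≤ d)
    (hm : ∀ z ∈ A \ {a}, (branch D (A \ {a}) z).ncard ≤ m) : A.ncard ≤ d * m + 1 := by
  let T : Finset N := (D.neighborSet a).toFinite.toFinset
  have cover : A ⊆ insert a (⋃ w ∈ T, branch D (A \ {a}) w) := by
    intro z hz
    refine or_iff_not_imp_left.2 fun hza => ?_
    obtain ⟨w, hw, hwa⟩ := exists_mem_branch_adj hA ha ⟨hz, hza⟩
    exact Set.mem_biUnion (by simpa [T] using hwa.symm) (mem_branch_comm.1 hw)
  have ncard_branch_le (w) (_ : w ∈ T) : (branch D (A \ {a}) w).ncard ≤ m := by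
    rcases (branch D (A \ {a}) w).eq_empty_or_nonempty with h | ⟨v, hv⟩
    · simp [h]
    · exact hm w (mem_of_mem_branch hv)
  calc A.ncard ≤ (⋃ w ∈ T, branch D (A \ {a}) w).ncard + 1 :=
        (Set.ncard_le_ncard cover).trans (Set.ncard_insert_le _ _)
    _ ≤ T.card * m + 1 := by
        gcongr
        exact (T.set_ncard_biUnion_le _).trans (Finset.sum_le_card_nsmul _ _ _ ncard_branch_le)
    _ ≤ d * m + 1 := by
        gcongr
        rwa [← Set.ncard_eq_toFinset_card]

/- Among the connected sets `A` with at least `m + 1` vertices and connected complement, a smallest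
one has only small branches at each vertex adjacent to the complement. -/
theorem exists_split_of_preconnected_induce [Finite N] {d m : ℕ}
    (hd : ∀ x, (D.neighborSet x).ncard ≤ d) (hC : (D.induce C).Preconnected)
    (hcard : d * m + 1 + m < C.ncard) :
    ∃ A ⊆ C, (D.induce A).Preconnected ∧ (D.induce (C \ A)).Preconnected ∧
      m < A.ncard ∧ m < (C \ A).ncard := by
  obtain ⟨A, ⟨hAC, hA, hCA, hmA⟩, hmin⟩ := Set.exists_min_image
    {A : Set N | A ⊆ C ∧ (D.induce A).Preconnected ∧ (D.induce (C \ A)).Preconnected ∧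
      m < A.ncard} Set.ncard (Set.toFinite _)
    ⟨C, le_rfl, hC, by rw [Set.sdiff_self]; exact fun x => x.2.elim, by lia⟩
  refine ⟨A, hAC, hA, hCA, hmA, ?_⟩
  obtain ⟨a, ha, hab⟩ : ∃ a ∈ A, (C \ A).Nonempty → ∃ b ∈ C \ A, D.Adj a b := by
    obtain ⟨a, ha⟩ : A.Nonempty := (Set.ncard_pos (Set.toFinite A)).1 (by lia)
    rcases (C \ A).eq_empty_or_nonempty with h | ⟨c, hc⟩
    · exact ⟨a, ha, fun hne => (hne.ne_empty h).elim⟩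
    · obtain ⟨a', ha', b, hb, h⟩ := exists_adj_of_preconnected_induce hC ⟨hAC ha, ha⟩ hc
      exact ⟨a', ha'.2, fun _ => ⟨b, hb, h⟩⟩
  have ncard_branch_le (z) (hz : z ∈ A \ {a}) : (branch D (A \ {a}) z).ncard ≤ m := by
    by_contra! hbig
    have hle := hmin _ ⟨branch_subset.trans (Set.sdiff_subset.trans hAC),
      (connected_induce_branch hz).preconnected,
      (connected_induce_diff_branch hAC hA hCA ha hab).preconnected, hbig⟩
    have hlt : (branch D (A \ {a}) z).ncard < A.ncard := (Set.ncard_le_ncard branch_subset).trans_lt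
      (Set.ncard_sdiff_singleton_lt_of_mem ha)
    lia
  have := ncard_le_of_ncard_branch_le hA ha (hd a) ncard_branch_le
  have := Set.ncard_sdiff_add_ncard_of_subset hAC
  lia

end Branch

theorem exists_range_lt_of_split {N : Type*} [Finite N] {P : Set N → Prop} {f : N → N} {a : N}
    (hf : ∀ c, P (f ⁻¹' {c})) {A : Set N} (hA : A ⊂ f ⁻¹' {a}) (hne : A.Nonempty) (hPA : P A)
    (hPB : P (f ⁻¹' {a} \ A)) :
    ∃ f' : N → N, (∀ c, P (f' ⁻¹' {c})) ∧ (Set.range f).ncard < (Set.range f').ncard := by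
  classical
  obtain ⟨x, hx⟩ := hne
  obtain ⟨y, hy, hyA⟩ := Set.exists_of_ssubset hA
  have f_x : f x = a := hA.1 hx
  obtain ⟨b, hb⟩ : ∃ b, ∀ x, f x ≠ b := by
    have : ¬ Function.Surjective f := fun hsurj => hyA <|
      Finite.injective_iff_surjective.2 hsurj (f_x.trans hy.symm) ▸ hx
    simpa [Function.Surjective] using this
  let f' : N → N := A.piecewise (fun _ => b) f
  have f'_of_mem {u} (hu : u ∈ A) : f' u = b := A.piecewise_eq_of_mem _ _ hu
  have f'_of_notMem {u} (hu : u ∉ A) : f' u = f u := A.piecewise_eq_of_notMem _ _ hu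
  have mem_fiber {u c} : u ∈ f' ⁻¹' {c} ↔ (u ∈ A ∧ b = c) ∨ (u ∉ A ∧ f u = c) := by
    by_cases hu : u ∈ A
    · simp [f'_of_mem, hu]
    · simp [f'_of_notMem, hu]
  refine ⟨f', fun c => ?_, Set.ncard_lt_ncard ⟨?_, fun h => ?_⟩ (Set.toFinite _)⟩
  · by_cases hcb : c = b
    · convert hPA
      ext u
      rw [mem_fiber]
      simp [hcb, hb]
    · convert show P (f ⁻¹' {c} \ A) from ?_
      · ext u
        rw [mem_fiber]
        simp [Ne.symm hcb, and_comm]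
      · by_cases hca : c = a
        · exact hca ▸ hPB
        · convert hf c
          refine sdiff_eq_left.2 (Set.disjoint_left.2 fun u hu huA => hca ?_)
          exact hu.symm.trans (hA.1 huA)
  · rintro _ ⟨u, rfl⟩
    by_cases hu : u ∈ A
    · exact ⟨y, (f'_of_notMem hyA).trans (hy.trans (hA.1 hu).symm)⟩
    · exact ⟨u, f'_of_notMem hu⟩
  · obtain ⟨u, hu⟩ := h ⟨x, f'_of_mem hx⟩
    exact hb u hu

theorem exists_fibers_ncard_le {N : Type*} [Finite N] {P : Set N → Prop} {K : ℕ} {f : N → N}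
    (hf : ∀ a, P (f ⁻¹' {a}))
    (hP : ∀ C, P C → K < C.ncard → ∃ A ⊂ C, A.Nonempty ∧ P A ∧ P (C \ A)) :
    ∃ f : N → N, (∀ a, P (f ⁻¹' {a})) ∧ ∀ a, (f ⁻¹' {a}).ncard ≤ K := by
  obtain ⟨f, hf, hmax⟩ := Set.exists_max_image {f : N → N | ∀ a, P (f ⁻¹' {a})}
    (fun f => (Set.range f).ncard) (Set.toFinite _) ⟨f, hf⟩
  refine ⟨f, hf, fun a => ?_⟩
  by_contra! hbig
  obtain ⟨A, hA, hne, hPA, hPB⟩ := hP _ (hf a) hbig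
  obtain ⟨f', hf', hlt⟩ := exists_range_lt_of_split hf hA hne hPA hPB
  exact (hmax f' hf').not_gt hlt

theorem exists_connected_partition {N : Type*} [Finite N] {D : SimpleGraph N} {d m : ℕ}
    (hd : ∀ x, (D.neighborSet x).ncard ≤ d) :
    ∃ f : N → N, (∀ a, (D.induce (f ⁻¹' {a})).Preconnected) ∧
      (∀ a, (f ⁻¹' {a}).ncard ≤ d * m + 1 + m) ∧
      ∀ a, m < (f ⁻¹' {a}).ncard ∨ ∀ x y, f x = a → D.Adj x y → f y = a := by
  let P (C : Set N) : Prop := (D.induce C).Preconnected ∧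
    (m < C.ncard ∨ ∀ x y, x ∈ C → D.Adj x y → y ∈ C)
  have split (C) (hC : P C) (hcard : d * m + 1 + m < C.ncard) :
      ∃ A ⊂ C, A.Nonempty ∧ P A ∧ P (C \ A) := by
    obtain ⟨A, hAC, hA, hCA, hmA, hmCA⟩ := exists_split_of_preconnected_induce hd hC.1 hcard
    refine ⟨A, ⟨hAC, fun h => ?_⟩, (Set.ncard_pos (Set.toFinite A)).1 (by lia), ⟨hA, .inl hmA⟩,
      hCA, .inl hmCA⟩
    rw [Set.sdiff_eq_empty.2 h, Set.ncard_empty] at hmCA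
    lia
  let f₀ (x : N) : N := (D.connectedComponentMk x).out
  have f₀_eq {x y} : f₀ x = f₀ y ↔ D.Reachable x y := by
    rw [← SimpleGraph.ConnectedComponent.eq]
    exact (Function.LeftInverse.injective (g := Quot.mk _) Quot.out_eq).eq_iff
  have hf₀ (a) : P (f₀ ⁻¹' {a}) := by
    refine ⟨fun x y => ?_, .inr fun x y hx hxy => (f₀_eq.2 hxy.reachable).symm.trans hx⟩
    obtain ⟨p⟩ := f₀_eq.1 (x.2.trans y.2.symm)
    classical
    exact ⟨p.induce _ fun u hu => (f₀_eq.2 ⟨p.takeUntil u hu⟩).symm.trans x.2⟩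
  obtain ⟨f, hf, hcard⟩ := exists_fibers_ncard_le hf₀ split
  exact ⟨f, fun a => (hf a).1, hcard, fun a => (hf a).2⟩

theorem mul_ncard_setOf_lt_ncard_preimage_le {α β : Type*} [Finite α] [Finite β] (f : α → β)
    (m : ℕ) : (m + 1) * {b | m < (f ⁻¹' {b}).ncard}.ncard ≤ Nat.card α := by
  classical
  have := Fintype.ofFinite α
  have := Fintype.ofFinite β
  let L : Set β := {b | m < (f ⁻¹' {b}).ncard}
  calc (m + 1) * L.ncard
      ≤ ∑ b ∈ L.toFinset, (f ⁻¹' {b}).ncard := by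
        rw [Set.ncard_eq_toFinset_card', mul_comm, ← smul_eq_mul]
        exact Finset.card_nsmul_le_sum _ _ _ fun b hb => show b ∈ L from Set.mem_toFinset.1 hb
    _ ≤ ∑ b, (f ⁻¹' {b}).ncard := Finset.sum_le_sum_of_subset (Finset.subset_univ _)
    _ = Nat.card α := by
        rw [Nat.card_eq_fintype_card, ← Finset.card_univ,
          Finset.card_eq_sum_card_fiberwise (f := f) (t := Finset.univ) (by simp)]
        exact Finset.sum_congr rfl fun b _ => by simp [Set.ncard_eq_toFinset_card']

theorem exists_injOn_of_ncard_le {α β : Type*} [Finite α] [Finite β] [Nonempty β] {s : Set α}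
    (h : s.ncard ≤ Nat.card β) : ∃ f : α → β, Set.InjOn f s := by
  rw [← Set.ncard_univ, ← Nat.cast_le (α := ℕ∞), (Set.toFinite _).cast_ncard_eq,
    (Set.toFinite _).cast_ncard_eq] at h
  obtain ⟨f, -, hf⟩ := s.toFinite.exists_injOn_of_encard_le h
  exact ⟨f, hf⟩

namespace SimpleGraph.Decomposition

variable {V : Type*} {G : SimpleGraph V} (B : G.Decomposition)

theorem width_le {k : ℕ} (h : ∀ x, (B.bag x).card ≤ k) : B.width ≤ k :=
  letI := B.fintypeNode
  Finset.sup_le fun x _ => h x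

theorem order_eq_card : B.order = Nat.card B.Node :=
  letI := B.fintypeNode
  Nat.card_eq_fintype_card.symm

theorem eq_of_mem_bag_of_notMem_support {v : V} {x y : B.Node} (hx : v ∈ B.bag x)
    (hy : v ∈ B.bag y) (hxB : x ∉ B.graph.support) : y = x := by
  obtain ⟨p⟩ := (B.connected v).preconnected ⟨x, hx⟩ ⟨y, hy⟩
  cases p with
  | nil => rfl
  | cons h _ => exact (hxB ⟨_, h⟩).elim

section Map

variable {N : Type} (f : B.Node → N)

open Classical in
/-- The union of the bags of the nodes in the fiber of `f` over `a`. -/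
noncomputable def mergedBag (a : N) : Finset V :=
  letI := B.fintypeNode
  (Finset.univ.filter (f · = a)).biUnion B.bag

variable {B f} in
theorem mem_mergedBag {a : N} {v : V} : v ∈ B.mergedBag f a ↔ ∃ x, f x = a ∧ v ∈ B.bag x := by
  simp [mergedBag]

theorem card_mergedBag_le {n k : ℕ} (hk : B.width ≤ k) {a : N}
    (hn : {x | f x = a ∧ (B.bag x).Nonempty}.ncard ≤ n) : (B.mergedBag f a).card ≤ n * k := by
  classical
  let := B.fintypeNode
  let S := {x | f x = a ∧ (B.bag x).Nonempty}.toFinset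
  have subset_biUnion : B.mergedBag f a ⊆ S.biUnion B.bag := fun v hv => by
    obtain ⟨x, hx, hv⟩ := mem_mergedBag.1 hv
    exact Finset.mem_biUnion.2 ⟨x, Set.mem_toFinset.2 ⟨hx, v, hv⟩, hv⟩
  calc (B.mergedBag f a).card
      ≤ (S.biUnion B.bag).card := Finset.card_le_card subset_biUnion
    _ ≤ S.card * k := Finset.card_biUnion_le_card_mul _ _ k fun x _ => (B.card_bag_le x).trans hk
    _ ≤ n * k := Nat.mul_le_mul_right _ (by rwa [← Set.ncard_eq_toFinset_card'])

theorem connected_induce_mem_mergedBag (v : V) :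
    ((B.graph.map f).induce {a | v ∈ B.mergedBag f a}).Connected := by
  let r (x : {x | v ∈ B.bag x}) : {a | v ∈ B.mergedBag f a} :=
    ⟨f x, mem_mergedBag.2 ⟨x, rfl, x.2⟩⟩
  have r_surjective : Function.Surjective r := by
    rintro ⟨_, ha⟩
    obtain ⟨x, rfl, hx⟩ := mem_mergedBag.1 ha
    exact ⟨⟨x, hx⟩, rfl⟩
  have := (B.connected v).nonempty.map r
  refine ⟨preconnected_of_surjective r_surjective (fun x y hxy => ?_) (B.connected v).preconnected⟩
  by_cases hr : r x = r y
  · exact hr ▸ SimpleGraph.Reachable.rfl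
  · exact SimpleGraph.Adj.reachable ⟨fun h => hr (Subtype.ext h), x, y, hxy, rfl, rfl⟩

/-- The decomposition obtained by identifying the nodes with the same image under `f`, the bags of
identified nodes being united. -/
noncomputable def map [Fintype N] : G.Decomposition where
  Node := N
  graph := B.graph.map f
  bag := B.mergedBag f
  connected := B.connected_induce_mem_mergedBag f
  touch v w h := by
    obtain ⟨x, y, hx, hy, hxy⟩ := B.touch v w h
    refine ⟨f x, f y, mem_mergedBag.2 ⟨x, rfl, hx⟩, mem_mergedBag.2 ⟨y, rfl, hy⟩, ?_⟩
    exact or_iff_not_imp_left.2 fun hne =>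
      ⟨hne, x, y, hxy.resolve_left fun h => hne (congrArg f h), rfl, rfl⟩

theorem width_map_le [Fintype N] {n k : ℕ} (hk : B.width ≤ k)
    (hn : ∀ a, {x | f x = a ∧ (B.bag x).Nonempty}.ncard ≤ n) : (B.map f).width ≤ n * k :=
  width_le _ fun a => B.card_mergedBag_le f hk (hn a)

end Map

variable {B}

/- Fill the nodes up injectively twice: once by the nodes having a neighbor, and once by the other
nodes with nonempty bags, each of which contains a vertex that lies in no other bag. -/
theorem exists_injOn_support [Fintype V] [Nonempty V]
    (h : B.graph.support.ncard ≤ Fintype.card V) :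
    ∃ f : B.Node → Fin (Fintype.card V), Set.InjOn f B.graph.support ∧
      ∀ i, {x | f x = i ∧ (B.bag x).Nonempty}.ncard ≤ 2 := by
  classical
  let := B.fintypeNode
  have : Nonempty (Fin (Fintype.card V)) := (Fintype.equivFin V).symm.surjective.nonempty
  let S := B.graph.support
  obtain ⟨g, hg⟩ : ∃ g : B.Node → Fin (Fintype.card V), Set.InjOn g S :=
    exists_injOn_of_ncard_le (by rwa [Nat.card_fin])
  let pick (x : B.Node) : V := if hx : (B.bag x).Nonempty then hx.choose else Classical.arbitrary V
  have pick_mem {x} (hx : (B.bag x).Nonempty) : pick x ∈ B.bag x := by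
    simp only [pick, dif_pos hx, hx.choose_spec]
  have pick_injOn : Set.InjOn pick {x | x ∉ S ∧ (B.bag x).Nonempty} := fun x hx y hy hxy =>
    (B.eq_of_mem_bag_of_notMem_support (pick_mem hx.2) (hxy ▸ pick_mem hy.2) hx.1).symm
  let f := S.piecewise g (Fintype.equivFin V ∘ pick)
  have f_eqOn : Set.EqOn f g S := S.piecewise_eqOn _ _
  refine ⟨f, hg.congr f_eqOn.symm, fun i => ?_⟩
  let T := {x | x ∉ S ∧ (B.bag x).Nonempty}
  have f_injOn : Set.InjOn f T := by
    refine Set.InjOn.congr ((Fintype.equivFin V).injective.comp_injOn pick_injOn) fun x hx => ?_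
    exact (S.piecewise_eq_of_notMem _ _ hx.1).symm
  have ncard_le_one {A : Set B.Node} (hA : Set.InjOn f A) : (A ∩ f ⁻¹' {i}).ncard ≤ 1 :=
    Set.ncard_le_one_iff_subsingleton.2 fun x hx y hy => hA hx.1 hy.1 (hx.2.trans hy.2.symm)
  calc {x | f x = i ∧ (B.bag x).Nonempty}.ncard
      ≤ (S ∩ f ⁻¹' {i} ∪ T ∩ f ⁻¹' {i}).ncard := by
        refine Set.ncard_le_ncard (fun x hx => ?_) (Set.toFinite _)
        by_cases hxS : x ∈ S
        · exact .inl ⟨hxS, hx.1⟩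
        · exact .inr ⟨⟨hxS, hx.2⟩, hx.1⟩
    _ ≤ 1 + 1 := (Set.ncard_union_le _ _).trans
        (add_le_add (ncard_le_one (hg.congr f_eqOn.symm)) (ncard_le_one f_injOn))

theorem exists_order_eq_card [Fintype V] [Nonempty V] (hB : B.Planar) {k : ℕ} (hk : B.width ≤ k)
    (h : B.graph.support.ncard ≤ Fintype.card V) :
    ∃ B' : G.Decomposition, B'.Planar ∧ B'.width ≤ 2 * k ∧ B'.order = Fintype.card V := by
  let := B.fintypeNode
  obtain ⟨f, hf, ncard_le⟩ := exists_injOn_support h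
  exact ⟨B.map f, IsPlanar.map_of_injOn_support (N' := Fin _) hB hf, B.width_map_le f hk ncard_le,
    Fintype.card_fin _⟩

theorem exists_support_ncard_le (hB : B.Planar) {k d n m : ℕ} (hk : B.width ≤ k)
    (hd : ∀ x, (B.graph.neighborSet x).ncard ≤ d) (horder : B.order ≤ (m + 1) * n) :
    ∃ B' : G.Decomposition, B'.Planar ∧ B'.width ≤ (d * m + 1 + m) * k ∧
      B'.graph.support.ncard ≤ n := by
  let := B.fintypeNode
  obtain ⟨f, hconn, ncard_le, hlarge⟩ := exists_connected_partition (m := m) hd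
  refine ⟨B.map f, IsPlanar.map_of_preconnected_fibers hB f hconn, B.width_map_le f hk fun a =>
    (Set.ncard_le_ncard (fun x hx => hx.1) (Set.toFinite _)).trans (ncard_le a), ?_⟩
  have support_subset : (B.graph.map f).support ⊆ {a | m < (f ⁻¹' {a}).ncard} := by
    rintro _ ⟨_, hne, x, y, hxy, rfl, rfl⟩
    exact (hlarge (f x)).resolve_right fun h => hne (h x y rfl hxy).symm
  refine (Set.ncard_le_ncard support_subset (Set.toFinite _)).trans ?_
  refine Nat.le_of_mul_le_mul_left ?_ m.succ_pos
  exact (mul_ncard_setOf_lt_ncard_preimage_le f m).trans (B.order_eq_card ▸ horder)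

theorem exists_compressed [Fintype V] (hB : B.Planar) {k d m : ℕ} (hk : B.width ≤ k)
    (hd : ∀ x, (B.graph.neighborSet x).ncard ≤ d) (horder : B.order ≤ (m + 1) * Fintype.card V) :
    ∃ B' : G.Decomposition, B'.Planar ∧ B'.width ≤ 2 * ((d * m + 1 + m) * k) ∧
      B'.order = Fintype.card V := by
  rcases isEmpty_or_nonempty V with hV | hV
  · have order_eq : B.order = Fintype.card V := by simpa using horder
    exact ⟨B, hB, B.width_le fun x => by simp [Finset.eq_empty_of_isEmpty], order_eq⟩
  · obtain ⟨B', hB', width_le, ncard_le⟩ := exists_support_ncard_le hB hk hd horder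
    exact exists_order_eq_card hB' width_le ncard_le

end SimpleGraph.Decomposition

/-! ### Planarization of a drawing -/

theorem isArc_image_Icc {X : Type*} [TopologicalSpace X] {a b : X} (γ : Path a b)
    (hγ : Function.Injective γ) {s t : unitInterval} (hst : s < t) :
    IsArc (γ s) (γ t) (γ '' Set.Icc s t) := by
  refine ⟨γ.subpath s t, fun u v huv => Subtype.ext ?_, γ.range_subpath_of_le s t hst.le⟩
  have h := congrArg Subtype.val (hγ huv)
  simp only [Set.Icc.coe_convexComb] at h
  have hne : (t : ℝ) - s ≠ 0 := (sub_pos.2 (show (s : ℝ) < t from hst)).ne'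
  exact mul_left_cancel₀ hne (by linear_combination h)

section CovBy

variable {α : Type*} [LinearOrder α]

theorem covBy_eq_of_mem_Ioo {T : Set α} {s t s' t' : T} (h : s ⋖ t) (h' : s' ⋖ t') {r : α}
    (hr : r ∈ Set.Ioo (s : α) t) (hr' : r ∈ Set.Ioo (s' : α) t') : s = s' ∧ t = t' := by
  have lt : s < t' := hr.1.trans hr'.2
  have lt' : s' < t := hr'.1.trans hr.2
  exact ⟨(h'.le_of_lt lt).antisymm (h.le_of_lt lt'), (h.ge_of_gt lt).antisymm (h'.ge_of_gt lt')⟩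

theorem ncard_neighborSet_hasse_le_two [Finite α] (a : α) :
    ((SimpleGraph.hasse α).neighborSet a).ncard ≤ 2 := by
  have above_le : {b | a ⋖ b}.ncard ≤ 1 :=
    Set.ncard_le_one_iff_subsingleton.2 fun b hb c hc => hb.unique_right hc
  have below_le : {b | b ⋖ a}.ncard ≤ 1 :=
    Set.ncard_le_one_iff_subsingleton.2 fun b hb c hc => hb.unique_left hc
  exact (Set.ncard_union_le {b | a ⋖ b} {b | b ⋖ a}).trans (add_le_add above_le below_le)

end CovBy

namespace SimpleGraph.Drawing

variable {V : Type*} {G : SimpleGraph V} (φ : G.Drawing)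

/-- The vertices of the planarization of a drawing: the points representing vertices, and the
crossings. -/
def nodes : Set Plane :=
  Set.range φ.point ∪ φ.crossings

theorem ncard_nodes_le [Finite V] : φ.nodes.ncard ≤ Nat.card V + φ.crossings.ncard := by
  refine (Set.ncard_union_le _ _).trans (Nat.add_le_add_right ?_ _)
  rw [← Set.image_univ, ← Set.ncard_univ]
  exact Set.ncard_image_le

variable {φ}

theorem mem_nodes_of_mem_arc {e f : G.edgeSet} (hef : e ≠ f) {p : Plane} (he : p ∈ φ.arc e)
    (hf : p ∈ φ.arc f) : p ∈ φ.nodes := by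
  by_cases h : ∃ v : V, p = φ.point v ∧ v ∈ (e : Sym2 V) ∧ v ∈ (f : Sym2 V)
  · obtain ⟨v, rfl, -⟩ := h
    exact .inl ⟨v, rfl⟩
  · exact .inr ⟨e, f, hef, he, hf, h⟩

theorem ncard_setOf_mem_arc_le_two [Finite V] {p : Plane} (hp : p ∉ Set.range φ.point) :
    {e | p ∈ φ.arc e}.ncard ≤ 2 := by
  by_contra! h
  obtain ⟨a, b, c, ha, hb, hc, hab, hac, hbc⟩ := (Set.two_lt_ncard_iff (Set.toFinite _)).1 h
  obtain ⟨v, rfl, -⟩ := φ.no_three a b c hab hac hbc p ⟨⟨ha, hb⟩, hc⟩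
  exact hp ⟨v, rfl⟩

theorem ncard_setOf_mem_arc_le [Finite V] {Δ : ℕ}
    (hΔ : ∀ v, {g : G.edgeSet | v ∈ (g : Sym2 V)}.ncard ≤ Δ) (p : Plane) :
    {e | p ∈ φ.arc e}.ncard ≤ Δ + 2 := by
  by_cases hp : p ∈ Set.range φ.point
  · obtain ⟨v, rfl⟩ := hp
    exact (Set.ncard_le_ncard (fun e => φ.mem_of_point_mem_arc e v) (Set.toFinite _)).trans
      ((hΔ v).trans (Nat.le_add_right _ _))
  · exact (ncard_setOf_mem_arc_le_two hp).trans (Nat.le_add_left _ _)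

variable (φ) in
/-- Injective parametrizations of the edges of a drawing, which in particular orient them. -/
structure Parametrization where
  tail : G.edgeSet → V
  head : G.edgeSet → V
  edge_eq : ∀ e : G.edgeSet, (e : Sym2 V) = s(tail e, head e)
  path : ∀ e, _root_.Path (φ.point (tail e)) (φ.point (head e))
  path_injective : ∀ e, Function.Injective (path e)
  range_path : ∀ e, Set.range (path e) = φ.arc e

variable (φ) in
theorem nonempty_parametrization : Nonempty φ.Parametrization := by
  have exists_path (e : G.edgeSet) : ∃ (v w : V) (γ : _root_.Path (φ.point v) (φ.point w)),
      (e : Sym2 V) = s(v, w) ∧ Function.Injective γ ∧ Set.range γ = φ.arc e := by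
    obtain ⟨⟨v, w⟩, h⟩ := e
    obtain ⟨γ, hγ, range_eq⟩ := φ.arc_simple v w h
    exact ⟨v, w, γ, rfl, hγ, range_eq⟩
  choose tail head path edge_eq path_injective range_path using exists_path
  exact ⟨⟨tail, head, edge_eq, path, path_injective, range_path⟩⟩

namespace Parametrization

variable (P : φ.Parametrization)

theorem path_mem_arc (e : G.edgeSet) (t : unitInterval) : P.path e t ∈ φ.arc e :=
  P.range_path e ▸ ⟨t, rfl⟩

theorem path_notMem_range_point {e : G.edgeSet} {t : unitInterval} (h0 : t ≠ 0) (h1 : t ≠ 1) :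
    P.path e t ∉ Set.range φ.point := by
  rintro ⟨v, hv⟩
  have hve : v ∈ (e : Sym2 V) := φ.mem_of_point_mem_arc e v (hv ▸ P.path_mem_arc e t)
  rw [P.edge_eq e, Sym2.mem_iff] at hve
  rcases hve with rfl | rfl
  · exact h0 (P.path_injective e (hv.symm.trans (P.path e).source.symm))
  · exact h1 (P.path_injective e (hv.symm.trans (P.path e).target.symm))

/-- The times at which the edge `e` passes through a node. -/
def times (e : G.edgeSet) : Set unitInterval :=
  P.path e ⁻¹' φ.nodes

theorem zero_mem_times (e : G.edgeSet) : 0 ∈ P.times e :=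
  .inl ⟨P.tail e, (P.path e).source.symm⟩

theorem one_mem_times (e : G.edgeSet) : 1 ∈ P.times e :=
  .inl ⟨P.head e, (P.path e).target.symm⟩

theorem finite_times (hφ : φ.nodes.Finite) (e : G.edgeSet) : (P.times e).Finite :=
  hφ.preimage (P.path_injective e).injOn

/-- The node through which the edge `e` passes at a given time. -/
def node (e : G.edgeSet) : P.times e ↪ φ.nodes :=
  ⟨fun t => ⟨P.path e t, t.2⟩, fun _ _ h =>
    Subtype.ext (P.path_injective e (congrArg Subtype.val h))⟩

/-- The planarization of a drawing: consecutive nodes along an edge are adjacent. -/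
def planarization : SimpleGraph φ.nodes :=
  ⨆ e, (hasse (P.times e)).map (P.node e)

theorem planarization_adj {p q : φ.nodes} : P.planarization.Adj p q ↔
    ∃ e, ∃ s t : P.times e, s ⋖ t ∧ s(p, q) = s(P.node e s, P.node e t) := by
  simp only [planarization, iSup_adj, map_adj, hasse_adj, Sym2.eq_iff]
  constructor
  · rintro ⟨e, s, t, h | h, rfl, rfl⟩
    · exact ⟨e, s, t, h, .inl ⟨rfl, rfl⟩⟩
    · exact ⟨e, t, s, h, .inr ⟨rfl, rfl⟩⟩
  · rintro ⟨e, s, t, h, ⟨rfl, rfl⟩ | ⟨rfl, rfl⟩⟩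
    · exact ⟨e, s, t, .inl h, rfl, rfl⟩
    · exact ⟨e, t, s, .inr h, rfl, rfl⟩

/-- A piece of an edge between two consecutive nodes. -/
structure Piece where
  edge : G.edgeSet
  start : P.times edge
  finish : P.times edge
  covBy : start ⋖ finish

namespace Piece

variable {P}

/-- The nodes at which a piece ends. -/
def ends (π : P.Piece) : Sym2 φ.nodes :=
  s(P.node π.edge π.start, P.node π.edge π.finish)

/-- The points of a piece. -/
def carrier (π : P.Piece) : Set Plane :=
  P.path π.edge '' Set.Icc (π.start : unitInterval) π.finish

theorem isArc_carrier {π : P.Piece} {p q : φ.nodes} (h : π.ends = s(p, q)) :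
    IsArc (p : Plane) q π.carrier := by
  have isArc := isArc_image_Icc (P.path π.edge) (P.path_injective _) π.covBy.lt
  rcases Sym2.eq_iff.1 h with ⟨rfl, rfl⟩ | ⟨rfl, rfl⟩
  · exact isArc
  · exact isArc.symm

theorem mem_ends_of_mem_carrier {π : P.Piece} {p : φ.nodes} (hp : (p : Plane) ∈ π.carrier) :
    p ∈ π.ends := by
  obtain ⟨r, hr, hrp⟩ := hp
  let r' : P.times π.edge := ⟨r, Set.mem_preimage.2 (hrp ▸ p.2)⟩
  have node_eq : P.node π.edge r' = p := Subtype.ext hrp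
  rcases π.covBy.eq_or_eq (c := r') hr.1 hr.2 with h | h
  · exact Sym2.mem_iff.2 (.inl (h ▸ node_eq.symm))
  · exact Sym2.mem_iff.2 (.inr (h ▸ node_eq.symm))

theorem exists_mem_Ioo_of_notMem_nodes {π : P.Piece} {p : Plane} (hp : p ∈ π.carrier)
    (hnode : p ∉ φ.nodes) :
    ∃ r ∈ Set.Ioo (π.start : unitInterval) π.finish, P.path π.edge r = p := by
  obtain ⟨r, hr, rfl⟩ := hp
  have ne (t : P.times π.edge) : (t : unitInterval) ≠ r := fun h => hnode (h ▸ t.2)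
  exact ⟨r, ⟨hr.1.lt_of_ne (ne _), hr.2.lt_of_ne' (ne _)⟩, rfl⟩

theorem mem_nodes_of_mem_carrier {π π' : P.Piece} (hπ : π ≠ π') {p : Plane} (hp : p ∈ π.carrier)
    (hp' : p ∈ π'.carrier) : p ∈ φ.nodes := by
  by_contra hnode
  obtain ⟨r, hr, hrp⟩ := exists_mem_Ioo_of_notMem_nodes hp hnode
  obtain ⟨r', hr', hrp'⟩ := exists_mem_Ioo_of_notMem_nodes hp' hnode
  obtain ⟨e, s, t, hst⟩ := π
  obtain ⟨e', s', t', hst'⟩ := π'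
  obtain rfl : e = e' := by
    by_contra hee
    exact hnode (mem_nodes_of_mem_arc hee (hrp ▸ P.path_mem_arc e r)
      (hrp' ▸ P.path_mem_arc e' r'))
  obtain rfl : r = r' := P.path_injective e (hrp.trans hrp'.symm)
  obtain ⟨rfl, rfl⟩ := covBy_eq_of_mem_Ioo hst hst' hr hr'
  exact hπ rfl

end Piece

theorem isPlanar_planarization : P.planarization.IsPlanar := by
  have exists_piece (ε : P.planarization.edgeSet) : ∃ π : P.Piece, π.ends = ε := by
    obtain ⟨⟨p, q⟩, h⟩ := ε
    obtain ⟨e, s, t, hst, h⟩ := P.planarization_adj.1 h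
    exact ⟨⟨e, s, t, hst⟩, h.symm⟩
  choose piece ends_piece using exists_piece
  refine .of_arcs Subtype.val_injective (arc := fun ε => (piece ε).carrier)
    (fun p q h => Piece.isArc_carrier (ends_piece ⟨s(p, q), h⟩))
    (fun ε p hp => ends_piece ε ▸ Piece.mem_ends_of_mem_carrier hp) fun ε ε' hε p hp hp' => ?_
  have piece_ne : piece ε ≠ piece ε' := fun h =>
    hε (Subtype.ext (by rw [← ends_piece, ← ends_piece, h]))
  exact ⟨⟨p, Piece.mem_nodes_of_mem_carrier piece_ne hp hp'⟩, rfl⟩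

theorem ncard_neighborSet_map_node_le (hφ : φ.nodes.Finite) (e : G.edgeSet) (p : φ.nodes) :
    (((hasse (P.times e)).map (P.node e)).neighborSet p).ncard ≤ 2 := by
  have := (P.finite_times hφ e).to_subtype
  by_cases hp : p ∈ Set.range (P.node e)
  · obtain ⟨t, rfl⟩ := hp
    have neighborSet_eq : ((hasse (P.times e)).map (P.node e)).neighborSet (P.node e t) =
        P.node e '' (hasse (P.times e)).neighborSet t := by
      ext q
      simp [mem_neighborSet]
    rw [neighborSet_eq]
    exact (Set.ncard_image_le (Set.toFinite _)).trans (ncard_neighborSet_hasse_le_two t)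
  · have neighborSet_eq : ((hasse (P.times e)).map (P.node e)).neighborSet p = ∅ :=
      Set.eq_empty_of_forall_notMem fun q ⟨_, t, _, _, ht, _⟩ => hp ⟨t, ht⟩
    rw [neighborSet_eq, Set.ncard_empty]
    exact Nat.zero_le _

theorem ncard_neighborSet_planarization_le [Finite V] (hφ : φ.nodes.Finite) {Δ : ℕ}
    (hΔ : ∀ v, {g : G.edgeSet | v ∈ (g : Sym2 V)}.ncard ≤ Δ) (p : φ.nodes) :
    (P.planarization.neighborSet p).ncard ≤ (Δ + 2) * 2 := by
  have := hφ.to_subtype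
  let E := (Set.toFinite {e | (p : Plane) ∈ φ.arc e}).toFinset
  have neighborSet_subset : P.planarization.neighborSet p ⊆
      ⋃ e ∈ E, ((hasse (P.times e)).map (P.node e)).neighborSet p := fun q hq => by
    obtain ⟨e, h⟩ := iSup_adj.1 hq
    obtain ⟨-, t, -, -, rfl, -⟩ := id h
    exact Set.mem_biUnion ((Set.Finite.mem_toFinset _).2 (P.path_mem_arc e t)) h
  calc (P.planarization.neighborSet p).ncard
      ≤ ∑ e ∈ E, (((hasse (P.times e)).map (P.node e)).neighborSet p).ncard :=
        (Set.ncard_le_ncard neighborSet_subset (Set.toFinite _)).trans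
          (Finset.set_ncard_biUnion_le _ _)
    _ ≤ E.card * 2 :=
        Finset.sum_le_card_nsmul _ _ _ fun e _ => P.ncard_neighborSet_map_node_le hφ e p
    _ ≤ (Δ + 2) * 2 := by
        rw [← Set.ncard_eq_toFinset_card]
        exact Nat.mul_le_mul_right _ (ncard_setOf_mem_arc_le hΔ _)

end Parametrization

variable (φ) in
/-- The node at which a vertex is drawn. -/
def vertexNode (v : V) : φ.nodes :=
  ⟨φ.point v, .inl ⟨v, rfl⟩⟩

namespace Parametrization

variable (P : φ.Parametrization)

theorem node_of_eq_zero {e : G.edgeSet} {t : P.times e} (h : (t : unitInterval) = 0) :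
    P.node e t = φ.vertexNode (P.tail e) :=
  Subtype.ext ((congrArg (P.path e) h).trans (P.path e).source)

theorem node_of_eq_one {e : G.edgeSet} {t : P.times e} (h : (t : unitInterval) = 1) :
    P.node e t = φ.vertexNode (P.head e) :=
  Subtype.ext ((congrArg (P.path e) h).trans (P.path e).target)

/-- The vertices assigned to a node of the planarization: an edge hands its tail to all the nodes
through which it passes before its head. -/
def nodeVertices (p : φ.nodes) : Set V :=
  {v | p = φ.vertexNode v ∨
    ∃ e, P.tail e = v ∧ ∃ t : P.times e, (t : unitInterval) ≠ 1 ∧ P.node e t = p}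

theorem tail_mem_nodeVertices {e : G.edgeSet} {t : P.times e} (h : (t : unitInterval) ≠ 1) :
    P.tail e ∈ P.nodeVertices (P.node e t) :=
  .inr ⟨e, rfl, t, h, rfl⟩

theorem nodeVertices_subset (p : φ.nodes) (hp : (p : Plane) ∉ Set.range φ.point) :
    P.nodeVertices p ⊆ P.tail '' {e | (p : Plane) ∈ φ.arc e} := by
  rintro v (rfl | ⟨e, rfl, t, -, rfl⟩)
  · exact (hp ⟨v, rfl⟩).elim
  · exact ⟨e, P.path_mem_arc e t, rfl⟩

theorem nodeVertices_vertexNode (v : V) : P.nodeVertices (φ.vertexNode v) ⊆ {v} := by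
  rintro w (h | ⟨e, rfl, t, ht, h⟩)
  · exact φ.point_injective (congrArg Subtype.val h).symm
  · have eq_zero : (t : unitInterval) = 0 := by
      by_contra h0
      exact P.path_notMem_range_point h0 ht ⟨v, (congrArg Subtype.val h).symm⟩
    exact φ.point_injective (congrArg Subtype.val ((P.node_of_eq_zero eq_zero).symm.trans h))

theorem ncard_nodeVertices_le_two [Finite V] (p : φ.nodes) : (P.nodeVertices p).ncard ≤ 2 := by
  by_cases hp : (p : Plane) ∈ Set.range φ.point
  · obtain ⟨v, hv⟩ := hp
    obtain rfl : φ.vertexNode v = p := Subtype.ext hv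
    refine (Set.ncard_le_ncard (P.nodeVertices_vertexNode v) (Set.toFinite _)).trans ?_
    rw [Set.ncard_singleton]
    exact one_le_two
  · exact (Set.ncard_le_ncard (P.nodeVertices_subset p hp) (Set.toFinite _)).trans
      ((Set.ncard_image_le (Set.toFinite _)).trans (ncard_setOf_mem_arc_le_two hp))

theorem planarization_adj_of_covBy {e : G.edgeSet} {s t : P.times e} (h : s ⋖ t) :
    P.planarization.Adj (P.node e s) (P.node e t) :=
  P.planarization_adj.2 ⟨e, s, t, h, rfl⟩

theorem exists_covBy (hφ : φ.nodes.Finite) {e : G.edgeSet} {t : P.times e}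
    (h : (t : unitInterval) ≠ 0) : ∃ s, s ⋖ t := by
  have := (P.finite_times hφ e).to_subtype
  have zero_lt : (⟨0, P.zero_mem_times e⟩ : P.times e) < t :=
    unitInterval.pos_iff_ne_zero.2 h
  exact exists_covBy_of_wellFoundedGT fun hmin => hmin.not_lt zero_lt

theorem reachable_vertexNode_tail (hφ : φ.nodes.Finite) (e : G.edgeSet) (t : P.times e)
    (ht : (t : unitInterval) ≠ 1) :
    (P.planarization.induce {p | P.tail e ∈ P.nodeVertices p}).Reachable
      ⟨φ.vertexNode (P.tail e), .inl rfl⟩ ⟨P.node e t, P.tail_mem_nodeVertices ht⟩ := by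
  have := (P.finite_times hφ e).to_subtype
  induction t using WellFoundedLT.induction with
  | ind t ih =>
    by_cases h0 : (t : unitInterval) = 0
    · simp only [P.node_of_eq_zero h0, Reachable.rfl]
    · obtain ⟨s, hst⟩ := P.exists_covBy hφ h0
      have s_ne_one : (s : unitInterval) ≠ 1 :=
        (lt_of_lt_of_le (show (s : unitInterval) < t from hst.lt) unitInterval.le_one').ne
      exact (ih s hst.lt s_ne_one).trans (Adj.reachable (P.planarization_adj_of_covBy hst))

theorem connected_induce_planarization (hφ : φ.nodes.Finite) (v : V) :
    (P.planarization.induce {p | v ∈ P.nodeVertices p}).Connected := by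
  refine connected_iff_exists_forall_reachable _ |>.2 ⟨⟨φ.vertexNode v, .inl rfl⟩, ?_⟩
  rintro ⟨_, rfl | ⟨e, rfl, t, ht, rfl⟩⟩
  · exact .rfl
  · exact P.reachable_vertexNode_tail hφ e t ht

theorem exists_planarization_adj (hφ : φ.nodes.Finite) (e : G.edgeSet) :
    ∃ p q, P.tail e ∈ P.nodeVertices p ∧ P.head e ∈ P.nodeVertices q ∧
      P.planarization.Adj p q := by
  obtain ⟨s, hs⟩ := P.exists_covBy hφ (t := ⟨1, P.one_mem_times e⟩) one_ne_zero
  exact ⟨_, _, P.tail_mem_nodeVertices (show (s : unitInterval) < 1 from hs.lt).ne,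
    .inl (P.node_of_eq_one rfl), P.planarization_adj_of_covBy hs⟩

/-- The decomposition of a graph given by the planarization of a drawing. -/
noncomputable def decomposition [Finite V] (hφ : φ.nodes.Finite) : G.Decomposition where
  Node := φ.nodes
  fintypeNode := hφ.fintype
  graph := P.planarization
  bag p := (Set.toFinite (P.nodeVertices p)).toFinset
  connected v := by
    have nodes_eq : {p | v ∈ P.nodeVertices p} =
        {p | v ∈ (Set.toFinite (P.nodeVertices p)).toFinset} :=
      Set.ext fun p => by simp only [Set.mem_ofPred_eq, Set.Finite.mem_toFinset]
    exact nodes_eq ▸ P.connected_induce_planarization hφ v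
  touch v w h := by
    simp only [Set.Finite.mem_toFinset]
    obtain ⟨p, q, hp, hq, hpq⟩ := P.exists_planarization_adj hφ ⟨s(v, w), h⟩
    rcases Sym2.eq_iff.1 (P.edge_eq ⟨s(v, w), h⟩) with ⟨hv, hw⟩ | ⟨hv, hw⟩
    · exact ⟨p, q, hv ▸ hp, hw ▸ hq, .inr hpq⟩
    · exact ⟨q, p, hv ▸ hq, hw ▸ hp, .inr hpq.symm⟩

end Parametrization

theorem exists_decomposition [Finite V] (φ : G.Drawing) (hφ : φ.crossings.Finite) {Δ : ℕ}
    (hΔ : ∀ v, {g : G.edgeSet | v ∈ (g : Sym2 V)}.ncard ≤ Δ) :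
    ∃ B : G.Decomposition, B.Planar ∧ B.width ≤ 2 ∧
      B.order ≤ Nat.card V + φ.crossings.ncard ∧
      ∀ x, (B.graph.neighborSet x).ncard ≤ (Δ + 2) * 2 := by
  obtain ⟨P⟩ := φ.nonempty_parametrization
  have finite_nodes : φ.nodes.Finite := (Set.finite_range _).union hφ
  refine ⟨P.decomposition finite_nodes, P.isPlanar_planarization,
    Decomposition.width_le _ fun p => ?_, ?_, P.ncard_neighborSet_planarization_le finite_nodes hΔ⟩
  · exact (Set.ncard_eq_toFinset_card _ _).symm.trans_le (P.ncard_nodeVertices_le_two p)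
  · rw [Decomposition.order_eq_card]
    exact (Nat.card_coe_set_eq _).trans_le φ.ncard_nodes_le

end SimpleGraph.Drawing

theorem SimpleGraph.Drawing.exists_of_crossingNumber_le {V : Type*} {G : SimpleGraph V}
    {b : ℝ≥0}
    (h : (G.crossingNumber : ℝ≥0∞) ≤ (b : ℝ≥0∞)) :
    ∃ φ : G.Drawing, φ.crossings.Finite ∧ (φ.crossings.ncard : ℝ≥0) ≤ b := by
  have ne_top : G.crossingNumber ≠ ⊤ := fun h_top =>
    ENNReal.coe_ne_top (top_le_iff.1 (by simpa only [h_top, ENat.toENNReal_top] using h))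
  have : Nonempty G.Drawing := by
    by_contra h_empty
    rw [not_nonempty_iff] at h_empty
    exact ne_top (iInf_of_empty _)
  obtain ⟨φ, encard_eq : φ.crossings.encard = G.crossingNumber⟩ :=
    ciInf_mem fun φ : G.Drawing => φ.crossings.encard
  have finite_crossings : φ.crossings.Finite := Set.encard_ne_top_iff.1 (encard_eq ▸ ne_top)
  refine ⟨φ, finite_crossings, ?_⟩
  rw [← encard_eq, ← finite_crossings.cast_ncard_eq, ENat.toENNReal_coe] at h
  exact_mod_cast h

theorem ncard_setOf_mem_edge_le {V : Type*} [Fintype V] {G : SimpleGraph V} [DecidableRel G.Adj]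
    {Δ : ℕ} (hΔ : G.maxDegree ≤ Δ) (v : V) :
    {g : G.edgeSet | v ∈ (g : Sym2 V)}.ncard ≤ Δ := by
  classical
  refine le_trans ?_ ((G.degree_le_maxDegree v).trans hΔ)
  rw [← SimpleGraph.card_incidenceFinset_eq_degree, ← Set.ncard_coe_finset,
    SimpleGraph.coe_incidenceFinset]
  exact Set.ncard_le_ncard_of_injOn Subtype.val (fun e he => ⟨e.2, he⟩)
    Subtype.val_injective.injOn (Set.toFinite _)

namespace SimpleGraph.Decomposition

theorem exists_of_crossingNumber_le {V : Type*} [Fintype V]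
    {G : SimpleGraph V} [DecidableRel G.Adj] {Δ : ℕ}
    (hΔ : G.maxDegree ≤ Δ) {c : ℝ≥0}
    (h : (G.crossingNumber : ℝ≥0∞) ≤ (c : ℝ≥0∞) * (Fintype.card V : ℝ≥0∞)) :
    ∃ B : G.Decomposition, B.Planar ∧ B.width ≤ 2 ∧
      (B.order : ℝ≥0) ≤ (c + 1) * (Fintype.card V : ℝ≥0) ∧
      ∀ x, (B.graph.neighborSet x).ncard ≤ (Δ + 2) * 2 := by
  obtain ⟨φ, finite_crossings, ncard_le⟩ :=
    Drawing.exists_of_crossingNumber_le (b := c * Fintype.card V) (by exact_mod_cast h)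
  obtain ⟨B, planar, width_le, order_le, ncard_neighborSet_le⟩ :=
    φ.exists_decomposition finite_crossings (ncard_setOf_mem_edge_le hΔ)
  refine ⟨B, planar, width_le, ?_, ncard_neighborSet_le⟩
  rw [Nat.card_eq_fintype_card] at order_le
  calc (B.order : ℝ≥0) ≤ Fintype.card V + φ.crossings.ncard := by exact_mod_cast order_le
    _ ≤ Fintype.card V + c * Fintype.card V := by gcongr
    _ = (c + 1) * Fintype.card V := by ring

theorem crossingNumber_le_of_order_le {V : Type*} [Fintype V]
    {G : SimpleGraph V} [DecidableRel G.Adj] {Δ : ℕ}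
    (hΔ : G.maxDegree ≤ Δ) {B : G.Decomposition} (hB : B.Planar) {k : ℕ}
    (hk : B.width ≤ k) {c : ℝ≥0} (horder : (B.order : ℝ≥0) ≤ c * (Fintype.card V : ℝ≥0)) :
    (G.crossingNumber : ℝ≥0∞) ≤
      ((c * ((k * Δ * 2) ^ 2 : ℕ) : ℝ≥0) : ℝ≥0∞) * (Fintype.card V : ℝ≥0∞) := by
  have crossingNumber_le := ENat.toENNReal_le.2
    (crossingNumber_le hB hk (ncard_setOf_mem_edge_le hΔ))
  rw [ENat.toENNReal_coe] at crossingNumber_le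
  have order_mul_le : ((B.order * (k * Δ * 2) ^ 2 : ℕ) : ℝ≥0) ≤
      c * ((k * Δ * 2) ^ 2 : ℕ) * (Fintype.card V : ℝ≥0) := by
    rw [Nat.cast_mul, mul_right_comm c]
    exact mul_le_mul_left horder _
  exact crossingNumber_le.trans (by exact_mod_cast order_mul_le)

end SimpleGraph.Decomposition

/-- For every family of finite graphs of bounded degree, the following are equivalent: linear
crossing number; planar decompositions of bounded width whose order is the number of vertices;
planar decompositions of width (at most) two and linear order. -/
theorem mainTheorem3 {ι : Type*} (V : ι → Type*) [∀ i, Fintype (V i)]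
    (G : ∀ i, SimpleGraph (V i)) [∀ i, DecidableRel (G i).Adj]
    (Δ : ℕ) (hΔ : ∀ i, (G i).maxDegree ≤ Δ) :
    List.TFAE [
      ∃ c₁ : ℝ≥0, ∀ i,
        ((G i).crossingNumber : ℝ≥0∞) ≤ (c₁ : ℝ≥0∞) * (Fintype.card (V i) : ℝ≥0∞),
      ∃ c₂ : ℕ, ∀ i, ∃ D : (G i).Decomposition,
        D.Planar ∧ D.width ≤ c₂ ∧ D.order = Fintype.card (V i),
      ∃ c₃ : ℝ≥0, ∀ i, ∃ D : (G i).Decomposition,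
        D.Planar ∧ D.width ≤ 2 ∧ (D.order : ℝ≥0) ≤ c₃ * (Fintype.card (V i) : ℝ≥0)] := by
  tfae_have 1 → 2 := fun ⟨c, h⟩ => by
    refine ⟨2 * (((Δ + 2) * 2 * ⌈c⌉₊ + 1 + ⌈c⌉₊) * 2), fun i => ?_⟩
    obtain ⟨B, planar, width_le, order_le, ncard_neighborSet_le⟩ :=
      SimpleGraph.Decomposition.exists_of_crossingNumber_le (hΔ i) (h i)
    refine SimpleGraph.Decomposition.exists_compressed planar width_le ncard_neighborSet_le ?_
    have order_le_ceil : (B.order : ℝ≥0) ≤ (⌈c⌉₊ + 1) * (Fintype.card (V i) : ℝ≥0) :=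
      order_le.trans (by gcongr; exact Nat.le_ceil c)
    exact_mod_cast order_le_ceil
  tfae_have 1 → 3 := fun ⟨c, h⟩ => ⟨c + 1, fun i => by
    obtain ⟨B, planar, width_le, order_le, -⟩ :=
      SimpleGraph.Decomposition.exists_of_crossingNumber_le (hΔ i) (h i)
    exact ⟨B, planar, width_le, order_le⟩⟩
  tfae_have 2 → 1 := fun ⟨k, h⟩ => ⟨1 * ((k * Δ * 2) ^ 2 : ℕ), fun i => by
    obtain ⟨B, planar, width_le, order_eq⟩ := h i
    exact SimpleGraph.Decomposition.crossingNumber_le_of_order_le (hΔ i) planar width_le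
      (by rw [order_eq, one_mul])⟩
  tfae_have 3 → 1 := fun ⟨c, h⟩ => ⟨c * ((2 * Δ * 2) ^ 2 : ℕ), fun i => by
    obtain ⟨B, planar, width_le, order_le⟩ := h i
    exact SimpleGraph.Decomposition.crossingNumber_le_of_order_le (hΔ i) planar width_le order_le⟩
  tfae_finish
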